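/- **Theorem 2.1.** Let $X$ and $S$ be smooth schemes over $\mathbb C$ and let $f:X\to S$ be a flat family of normal crossing varieties of dimension $d$: $f$ is flat, and every fibre over a closed point is a reduced scheme whose completed local rings at closed points are isomorphic to $\mathbb C[[x_0,\dots,x_d]]/(x_0\cdots x_r)$ with some $0\le r\le d$. Let $\Delta\subset S$ be a (reduced) normal crossing divisor such that $Y:=f^{-1}(\Delta)\subset X$ is a normal crossing divisor and $f:X\smallsetminus Y\to S\smallsetminus\Delta$ is smooth. Equip $X$ and $S$ with the log structures $\log Y$, $\log\Delta$ of functions invertible outside $Y$, $\Delta$, and assume that $(X,\log Y)\to(S,\log\Delta)$ is log smooth. Assume that $\mathcal O_S\to f_*\mathcal O_X$ is an isomorphism, and let $\mathcal L$ be a line bundle on $X$. *Notation.* $T_X(\log Y)$, $T_{X/S}(\log Y)$, $T_S(\log\Delta)$ are the sheaves of logarithmic derivations of $X/\mathbb C$, $X/S$, $S/\mathbb C$. Let $\mathcal D_X$ (resp. $\mathcal D_{X/S}$) be the sheaf of rings of operators on $\mathcal O_X$ generated by $\mathcal O_X$ and $T_X(\log Y)$ (resp. $T_{X/S}(\log Y)$),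 filtered by $\mathcal D^0=\mathcal O_X$ and $\mathcal D^{k}=\{P\in\mathcal D: [P,a]\in\mathcal D^{k-1}\text{ for all local functions }a\}$ for $k\ge1$. Put $\mathcal D^k(\mathcal L)=\mathcal L\otimes\mathcal D^k\otimes\mathcal L^{-1}$, regarded as operators on $\mathcal L$, and $\mathcal W_{X/S}(\mathcal L)=\mathcal D^1_X(\mathcal L)+\mathcal D^2_{X/S}(\mathcal L)$. The first order symbol $\sigma_1:\mathcal D^1_{X/S}(\mathcal L)\to T_{X/S}(\log Y)$ is given by $\sigma_1(D)(a)s=D(as)-aD(s)$. The second order symbol $\sigma:\mathcal W_{X/S}(\mathcal L)\to S^2T_{X/S}(\log Y)$ is given by $\sigma(D)(a,b)s=D(abs)-aD(bs)-bD(as)+abD(s)$, where $\delta\delta'\in S^2T_{X/S}(\log Y)$ is identified with $(a,b)\mapsto\delta(a)\delta'(b)+\delta'(a)\delta(b)$. The map $\bar\varepsilon:\mathcal W_{X/S}(\mathcal L)\to f^*T_S(\log\Delta)$ is given by $\bar\varepsilon(D)(a)s=D(f^*(a)s)-f^*(a)D(s)$ for local functions $a$ on $S$. Let - $\kappa_{X/S}:T_S(\log\Delta)\to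 R^1f_*T_{X/S}(\log Y)$ be induced by the connecting map of $0\to T_{X/S}(\log Y)\to T_X(\log Y)\to f^*T_S(\log\Delta)\to0$; - $\cup[\mathcal L]:f_*T_{X/S}(\log Y)\to R^1f_*\mathcal O_X$ be the connecting map of $0\to\mathcal O_X\to\mathcal D^1_{X/S}(\mathcal L)\xrightarrow{\sigma_1}T_{X/S}(\log Y)\to0$; - $\mu_{\mathcal L}:f_*S^2T_{X/S}(\log Y)\to R^1f_*T_{X/S}(\log Y)$ be the composite of $R^1f_*\sigma_1$ with the connecting map of $0\to\mathcal D^1_{X/S}(\mathcal L)\to\mathcal D^2_{X/S}(\mathcal L)\xrightarrow{\sigma}S^2T_{X/S}(\log Y)\to0$. A *projective logarithmic heat operator* is an $\mathcal O_S$-linear map $\widetilde H:T_S(\log\Delta)\to f_*\mathcal W_{X/S}(\mathcal L)/\mathcal O_S$ with $f_*\bar\varepsilon\circ\widetilde H$ equal to the canonical map $T_S(\log\Delta)\to f_*f^*T_S(\log\Delta)$; its symbol is $\rho_{\widetilde H}:=f_*\sigma\circ\widetilde H$. A *projective logarithmic connection* on an $\mathcal O_S$-module $E$ is an $\mathcal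 O_S$-linear map $\nabla:T_S(\log\Delta)\to\mathcal End_{\mathbb C}(E)/\mathcal O_S$ whose local representatives satisfy $\nabla_\theta(as)=a\nabla_\theta(s)+\theta(a)s$. *Claim.* Let $\rho:T_S(\log\Delta)\to f_*S^2T_{X/S}(\log Y)$ be an $\mathcal O_S$-linear map such that 1. $\mu_{\mathcal L}\circ\rho+\kappa_{X/S}=0$, and 2. $\cup[\mathcal L]:f_*T_{X/S}(\log Y)\to R^1f_*\mathcal O_X$ is an isomorphism. Then there is a unique projective logarithmic heat operator $\widetilde H:T_S(\log\Delta)\to f_*\mathcal W_{X/S}(\mathcal L)/\mathcal O_S$ with $\rho_{\widetilde H}=\rho$. Moreover, through the action of $f_*\mathcal W_{X/S}(\mathcal L)$ on $f_*\mathcal L$, it induces a projective logarithmic connection on $f_*\mathcal L$. -/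

import Mathlib

open CategoryTheory Limits Opposite AlgebraicGeometry TopologicalSpace

noncomputable section

namespace LogHeat

section Derived

variable {C D : Type*} [Category* C] [Category* D] [Abelian C] [Abelian D]

/-- The augmentation `A ⟶ I⁰` of an injective resolution. -/
def resι {A : C} (I : InjectiveResolution A) : A ⟶ I.cocomplex.X 0 := I.ι.f 0

/-- The map `X₃ ⟶ I¹` determined by a short exact sequence `0 ⟶ X₁ ⟶ X₂ ⟶ X₃ ⟶ 0` and an
injective resolution `I` of `X₁`: extend `X₁ ⟶ I⁰` to `X₂` and apply the differential. -/
def toResolution {S : ShortComplex C} (h : S.ShortExact) (I : InjectiveResolution S.X₁) :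
    S.X₃ ⟶ I.cocomplex.X 1 :=
  have := h.mono_f
  have := h.epi_g
  h.exact.desc (Injective.factorThru (resι I) S.f ≫ I.cocomplex.d 0 1) (by
    rw [← Category.assoc, Injective.comp_factorThru]
    exact I.ι_f_zero_comp_complex_d)

lemma toResolution_d {S : ShortComplex C} (h : S.ShortExact) (I : InjectiveResolution S.X₁) :
    toResolution h I ≫ I.cocomplex.d 1 2 = 0 := by
  have : Mono S.f := h.mono_f
  have : Epi S.g := h.epi_g
  rw [← cancel_epi S.g, toResolution, ← Category.assoc, h.exact.g_desc]
  simp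

variable [HasInjectiveResolutions C]

/-- The connecting morphism `F X₃ ⟶ R¹F X₁` of a short exact sequence, computed with an
injective resolution of `X₁`. -/
def connectingHom (F : C ⥤ D) [F.Additive] {S : ShortComplex C} (h : S.ShortExact) :
    F.obj S.X₃ ⟶ (F.rightDerived 1).obj S.X₁ :=
  let I := injectiveResolution S.X₁
  let K := (F.mapHomologicalComplex (ComplexShape.up ℕ)).obj I.cocomplex
  K.liftCycles (i := 1) (F.map (toResolution h I)) 2 (by simp) (by
      change F.map _ ≫ F.map _ = 0
      rw [← F.map_comp, toResolution_d, F.map_zero]) ≫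
    K.homologyπ 1 ≫ (I.isoRightDerivedObj F 1).inv

open Classical in
/-- Let `i : A ⟶ B` be a kernel of `p : B ⟶ E`, and let `c : C₀ ⟶ E` be a subobject contained in
the image of `p`. Then `0 ⟶ A ⟶ p⁻¹(C₀) ⟶ C₀ ⟶ 0` is exact, where `p⁻¹(C₀)` is the fibre product
(so `p⁻¹(C₀) = B` if `C₀` is the image of `p`), and this is its connecting morphism
`F C₀ ⟶ R¹F A`. (If the sequence is not exact, the value is `0` by convention.) -/
def connecting (F : C ⥤ D) [F.Additive] {A B E C₀ : C} (i : A ⟶ B) (p : B ⟶ E) (w : i ≫ p = 0)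
    (c : C₀ ⟶ E) : F.obj C₀ ⟶ (F.rightDerived 1).obj A :=
  if h : (ShortComplex.mk (pullback.lift i (0 : A ⟶ C₀) (by rw [w, zero_comp]) : A ⟶ pullback p c)
      (pullback.snd p c) (pullback.lift_snd _ _ _)).ShortExact
  then connectingHom F h else 0

end Derived

section Modules

variable {X : Scheme.{0}}

/-- The structure sheaf as a sheaf of modules. Its sections over `U` are `Γ(X, U)`. -/
def OX (X : Scheme.{0}) : X.Modules := SheafOfModules.unit X.ringCatSheaf

/-- The abelian sheaf underlying a sheaf of modules. -/
def toAb (X : Scheme.{0}) : X.Modules ⥤ TopCat.Sheaf AddCommGrpCat.{0} X :=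
  SheafOfModules.toSheaf X.ringCatSheaf

/-- Restriction of sections of a module. -/
def res (M : X.Modules) {U V : X.Opens} (h : V ≤ U) : Γ(M, U) →+ Γ(M, V) :=
  (M.presheaf.map (homOfLE h).op).hom

/-- Restriction of functions. -/
def resO {U V : X.Opens} (h : V ≤ U) : Γ(X, U) →+* Γ(X, V) :=
  (X.presheaf.map (homOfLE h).op).hom

@[simp] lemma res_res (M : X.Modules) {U V W : X.Opens} (h : V ≤ U) (h' : W ≤ V) (s : Γ(M, U)) :
    res M h' (res M h s) = res M (h'.trans h) s :=
  (ConcreteCategory.congr_hom (M.presheaf.map_comp (homOfLE h).op (homOfLE h').op) s).symm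

@[simp] lemma res_self (M : X.Modules) {U : X.Opens} (h : U ≤ U) (s : Γ(M, U)) :
    res M h s = s :=
  ConcreteCategory.congr_hom (M.presheaf.map_id (op U)) s

@[simp] lemma resO_resO {U V W : X.Opens} (h : V ≤ U) (h' : W ≤ V) (s : Γ(X, U)) :
    resO h' (resO h s) = resO (h'.trans h) s :=
  (ConcreteCategory.congr_hom (X.presheaf.map_comp (homOfLE h).op (homOfLE h').op) s).symm

@[simp] lemma resO_self {U : X.Opens} (h : U ≤ U) (s : Γ(X, U)) : resO h s = s :=
  ConcreteCategory.congr_hom (X.presheaf.map_id (op U)) s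

@[simp] lemma res_smul (M : X.Modules) {U V : X.Opens} (h : V ≤ U) (a : Γ(X, U)) (s : Γ(M, U)) :
    res M h (a • s) = resO h a • res M h s :=
  Scheme.Modules.map_smul M (homOfLE h) a s

lemma eq_of_res (M : X.Modules) {U : X.Opens} (s t : Γ(M, U))
    (h : ∀ x ∈ U, ∃ V : X.Opens, x ∈ V ∧ ∃ hV : V ≤ U, res M hV s = res M hV t) : s = t := by
  choose V hx hV e using fun x : U => h x x.2
  refine TopCat.Sheaf.eq_of_locally_eq' (⟨M.presheaf, M.isSheaf⟩ : TopCat.Sheaf _ _) V U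
    (fun x => homOfLE (hV x)) ?_ s t e
  intro x hx'
  exact Opens.mem_iSup.2 ⟨⟨x, hx'⟩, hx _⟩

lemma exists_glue (M : X.Modules) {U : X.Opens} {ι : Type} (V : ι → X.Opens) (hV : ∀ i, V i ≤ U)
    (hc : U ≤ iSup V) (s : ∀ i, Γ(M, V i))
    (h : ∀ i j, res M (inf_le_left : V i ⊓ V j ≤ V i) (s i) = res M inf_le_right (s j)) :
    ∃ t : Γ(M, U), ∀ i, res M (hV i) t = s i :=
  (TopCat.Sheaf.existsUnique_gluing' (⟨M.presheaf, M.isSheaf⟩ : TopCat.Sheaf _ _) V U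
    (fun i => homOfLE (hV i)) hc s h).exists

/-- A morphism of modules from its components on sections. -/
def mkHom {M N : X.Modules} (φ : ∀ U : X.Opens, Γ(M, U) →+ Γ(N, U))
    (nat : ∀ (U V : X.Opens) (h : V ≤ U) (s : Γ(M, U)), φ V (res M h s) = res N h (φ U s))
    (lin : ∀ (U : X.Opens) (a : Γ(X, U)) (s : Γ(M, U)), φ U (a • s) = a • φ U s) : M ⟶ N :=
  ⟨PresheafOfModules.homMk
    { app U := AddCommGrpCat.ofHom (φ U.unop)
      naturality U V i := by
        ext s
        exact nat U.unop V.unop i.unop.le s }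
    (fun U r m => lin U.unop r m)⟩

lemma mkHom_app {M N : X.Modules} (φ nat lin) (U : X.Opens) (s : Γ(M, U)) :
    (mkHom (N := N) φ nat lin).app U s = φ U s := rfl

/-! ### Sheaves of maps -/

/-- The maps, compatible with restrictions, from a presheaf of sets `P` on `U` to a module `M`
on `U`: the sections over `U` of the sheaf `ℋom(P, M)`. -/
def LocMap (P : X.Opensᵒᵖ ⥤ Type) (M : X.Modules) (U : X.Opens) :
    AddSubgroup (∀ W : {W : X.Opens // W ≤ U}, P.obj (op W.1) → Γ(M, W.1)) where
  carrier := {φ | ∀ (W W' : X.Opens) (hW : W ≤ U) (h : W' ≤ W) (z : P.obj (op W)),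
    φ ⟨W', h.trans hW⟩ (P.map (homOfLE h).op z) = res M h (φ ⟨W, hW⟩ z)}
  add_mem' {φ ψ} hφ hψ W W' hW h z := by simp [hφ W W' hW h z, hψ W W' hW h z]
  zero_mem' W W' hW h z := by simp
  neg_mem' {φ} hφ W W' hW h z := by simp [hφ W W' hW h z]

namespace LocMap

variable {P : X.Opensᵒᵖ ⥤ Type} {M : X.Modules} {U : X.Opens}

instance : Module Γ(X, U) (LocMap P M U) where
  smul a φ := ⟨fun W z => resO W.2 a • φ.1 W z, fun W W' hW h z => by
    simp [φ.2 W W' hW h z]⟩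
  one_smul φ := by
    apply Subtype.ext; funext W z
    exact (congrArg (· • _) (map_one (resO W.2))).trans (one_smul _ _)
  mul_smul a b φ := by
    apply Subtype.ext; funext W z
    exact (congrArg (· • _) (map_mul (resO W.2) a b)).trans (mul_smul _ _ _)
  smul_zero a := by apply Subtype.ext; funext W z; exact smul_zero _
  smul_add a φ ψ := by apply Subtype.ext; funext W z; exact smul_add _ _ _
  add_smul a b φ := by
    apply Subtype.ext; funext W z
    exact (congrArg (· • _) (map_add (resO W.2) a b)).trans (add_smul _ _ _)
  zero_smul φ := by
    apply Subtype.ext; funext W z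
    exact (congrArg (· • _) (map_zero (resO W.2))).trans (zero_smul _ _)

@[simp] lemma add_apply (φ ψ : LocMap P M U) (W z) :
    (φ + ψ).1 W z = φ.1 W z + ψ.1 W z := rfl

@[simp] lemma smul_apply (a : Γ(X, U)) (φ : LocMap P M U) (W z) :
    (a • φ).1 W z = resO W.2 a • φ.1 W z := rfl

/-- Restriction to a smaller open set. -/
def restrict {V : X.Opens} (h : V ≤ U) : LocMap P M U →+ LocMap P M V where
  toFun φ := ⟨fun W z => φ.1 ⟨W.1, W.2.trans h⟩ z, fun W W' hW h' z => φ.2 W W' (hW.trans h) h' z⟩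
  map_zero' := rfl
  map_add' _ _ := rfl

@[simp] lemma restrict_apply {V : X.Opens} (h : V ≤ U) (φ : LocMap P M U) (W z) :
    (restrict h φ).1 W z = φ.1 ⟨W.1, W.2.trans h⟩ z := rfl

end LocMap

/-- The presheaf of abelian groups `U ↦ ℋom(P, M)(U)`. -/
def locMapPresheaf (P : X.Opensᵒᵖ ⥤ Type) (M : X.Modules) : X.Opensᵒᵖ ⥤ Ab.{0} where
  obj U := AddCommGrpCat.of (LocMap P M U.unop)
  map i := AddCommGrpCat.ofHom (LocMap.restrict i.unop.le)

instance (P : X.Opensᵒᵖ ⥤ Type) (M : X.Modules) (U : X.Opensᵒᵖ) :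
    Module (X.ringCatSheaf.obj.obj U) ((locMapPresheaf P M).obj U) :=
  inferInstanceAs (Module Γ(X, U.unop) (LocMap P M U.unop))

lemma locMap_isSheaf (P : X.Opensᵒᵖ ⥤ Type) (M : X.Modules) :
    TopCat.Presheaf.IsSheaf (X := X) (locMapPresheaf P M) := by
  have Pc : ∀ {U V W : X.Opens} (h : V ≤ U) (h' : W ≤ V) (z : P.obj (op U)),
      P.map (homOfLE h').op (P.map (homOfLE h).op z) = P.map (homOfLE (h'.trans h)).op z := by
    intro U V W h h' z
    exact (ConcreteCategory.congr_hom (P.map_comp (homOfLE h).op (homOfLE h').op) z).symm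
  rw [TopCat.Presheaf.isSheaf_iff_isSheafUniqueGluing]
  intro ι V sf hsf
  let φ : ∀ i, LocMap P M (V i) := sf
  have hφ : ∀ i j (W : X.Opens) (h : W ≤ V i) (h' : W ≤ V j) (z : P.obj (op W)),
      (φ i).1 ⟨W, h⟩ z = (φ j).1 ⟨W, h'⟩ z := by
    intro i j W h h' z
    have := congrArg (fun t : LocMap P M (V i ⊓ V j) => t.1 ⟨W, le_inf h h'⟩ z) (hsf i j)
    exact this
  have key : ∀ (W : X.Opens) (h : W ≤ iSup V) (z : P.obj (op W)), ∃ t : Γ(M, W),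
      ∀ i, res M (inf_le_left : W ⊓ V i ≤ W) t
        = (φ i).1 ⟨W ⊓ V i, inf_le_right⟩ (P.map (homOfLE inf_le_left).op z) := by
    intro W h z
    refine exists_glue M (fun i => W ⊓ V i) (fun i => inf_le_left) ?_ _ ?_
    · rw [← inf_iSup_eq]; exact le_inf le_rfl h
    · intro i j
      rw [← (φ i).2, ← (φ j).2, Pc, Pc]
      exact hφ i j _ _ _ _
  choose t ht using key
  have loc : ∀ (W : X.Opens) (h : W ≤ iSup V) (s s' : Γ(M, W)),
      (∀ i, res M (inf_le_left : W ⊓ V i ≤ W) s = res M inf_le_left s') → s = s' := by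
    intro W h s s' e
    refine eq_of_res M s s' fun x hx => ?_
    obtain ⟨i, hi⟩ := Opens.mem_iSup.1 (h hx)
    exact ⟨W ⊓ V i, ⟨hx, hi⟩, inf_le_left, e i⟩
  have ht' : ∀ i (W : X.Opens) (h : W ≤ V i) z,
      t W (h.trans (le_iSup V i)) z = (φ i).1 ⟨W, h⟩ z := by
    intro i W h z
    refine loc W (h.trans (le_iSup V i)) _ _ fun j => ?_
    rw [ht, ← (φ i).2]
    exact hφ _ _ _ _ _ _
  refine ⟨(⟨fun W z => t W.1 W.2 z, ?_⟩ : LocMap P M (iSup V)), ?_, ?_⟩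
  · intro W W' hW h z
    refine loc W' (h.trans hW) _ _ fun i => ?_
    rw [ht, res_res, ← res_res M (inf_le_left : W ⊓ V i ≤ W) (inf_le_inf_right _ h), ht,
      ← (φ i).2, Pc, Pc]
  · intro i
    apply Subtype.ext
    funext W z
    exact ht' i W.1 W.2 z
  · intro s hs
    apply Subtype.ext
    funext W z
    refine loc W.1 W.2 _ _ fun i => ?_
    rw [ht, ← show _ = φ i from hs i]
    exact (Subtype.prop (show LocMap P M (iSup V) from s) W.1 (W.1 ⊓ V i) W.2 inf_le_left z).symm

/-- The sheaf of modules `ℋom(P, M)` of maps from a presheaf of sets `P` to a module `M`. -/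
def locMap (P : X.Opensᵒᵖ ⥤ Type) (M : X.Modules) : X.Modules :=
  ⟨PresheafOfModules.ofPresheaf (R := X.ringCatSheaf.obj) (locMapPresheaf P M) (by
    intro U V i r φ
    refine Subtype.ext (a1 := (show LocMap P M V.unop from _)) (a2 := (show LocMap P M V.unop from _)) ?_
    funext W z
    exact congrArg (· • _) (resO_resO i.unop.le W.2 r).symm), locMap_isSheaf P M⟩

/-- Sections of the subsheaf of `M` defined locally by submodules `N U` of `Γ(M, U)`: a section
over `U` belongs to it if every point of `U` has a neighbourhood `V` such that the section restricts
into `N W` for every open `W ⊆ V`. -/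
def LocSub (M : X.Modules) (N : ∀ U : X.Opens, Submodule Γ(X, U) Γ(M, U)) (U : X.Opens) :
    Submodule Γ(X, U) Γ(M, U) where
  carrier := {m | ∀ x ∈ U, ∃ V : X.Opens, x ∈ V ∧ ∃ hV : V ≤ U, ∀ (W : X.Opens) (h : W ≤ V),
    res M (h.trans hV) m ∈ N W}
  add_mem' {m m'} hm hm' x hx := by
    obtain ⟨V, hxV, hV, h⟩ := hm x hx
    obtain ⟨V', hxV', hV', h'⟩ := hm' x hx
    refine ⟨V ⊓ V', ⟨hxV, hxV'⟩, inf_le_left.trans hV, fun W hW => ?_⟩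
    rw [map_add]
    exact add_mem (h W (hW.trans inf_le_left)) (h' W (hW.trans inf_le_right))
  zero_mem' x hx := ⟨U, hx, le_rfl, fun W h => by rw [map_zero]; exact zero_mem _⟩
  smul_mem' a m hm x hx := by
    obtain ⟨V, hxV, hV, h⟩ := hm x hx
    refine ⟨V, hxV, hV, fun W hW => ?_⟩
    rw [res_smul]
    exact Submodule.smul_mem _ _ (h W hW)

variable {M : X.Modules} (N : ∀ U : X.Opens, Submodule Γ(X, U) Γ(M, U))

lemma LocSub.res_mem {U V : X.Opens} (h : V ≤ U) {m : Γ(M, U)} (hm : m ∈ LocSub M N U) :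
    res M h m ∈ LocSub M N V := by
  intro x hx
  obtain ⟨V', hxV, hV, h'⟩ := hm x (h hx)
  refine ⟨V ⊓ V', ⟨hx, hxV⟩, inf_le_left, fun W hW => ?_⟩
  rw [res_res]
  exact h' W (hW.trans inf_le_right)

lemma LocSub.mem_of_cover {U : X.Opens} {m : Γ(M, U)} (hm : ∀ x ∈ U, ∃ V : X.Opens, x ∈ V ∧
    ∃ hV : V ≤ U, res M hV m ∈ LocSub M N V) : m ∈ LocSub M N U := by
  intro x hx
  obtain ⟨V, hxV, hV, h⟩ := hm x hx
  obtain ⟨V', hxV', hV', h'⟩ := h x hxV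
  refine ⟨V', hxV', hV'.trans hV, fun W hW => ?_⟩
  have := h' W hW
  rwa [res_res] at this

/-- The presheaf underlying the subsheaf generated by `N`. -/
def locSubPresheaf : X.Opensᵒᵖ ⥤ Ab.{0} where
  obj U := AddCommGrpCat.of (LocSub M N U.unop)
  map {U V} i := AddCommGrpCat.ofHom (((res M i.unop.le).comp
    (LocSub M N U.unop).subtype.toAddMonoidHom).codRestrict (LocSub M N V.unop)
      fun m => LocSub.res_mem N i.unop.le m.2)
  map_id U := by
    ext m
    exact res_self M le_rfl (Subtype.val (p := fun z => z ∈ LocSub M N U.unop) m)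
  map_comp {U V W} i j := by
    ext m
    exact (res_res M i.unop.le j.unop.le
      (Subtype.val (p := fun z => z ∈ LocSub M N U.unop) m)).symm

instance (U : X.Opensᵒᵖ) : Module (X.ringCatSheaf.obj.obj U) ((locSubPresheaf N).obj U) :=
  inferInstanceAs (Module Γ(X, U.unop) (LocSub M N U.unop))

lemma locSub_isSheaf : TopCat.Presheaf.IsSheaf (X := X) (locSubPresheaf N) := by
  rw [TopCat.Presheaf.isSheaf_iff_isSheafUniqueGluing]
  intro ι V sf hsf
  let φ : ∀ i, LocSub M N (V i) := sf
  obtain ⟨t, ht⟩ := exists_glue M V (le_iSup V) le_rfl (fun i => (φ i).1)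
    (fun i j => congrArg Subtype.val (hsf i j))
  refine ⟨(⟨t, ?_⟩ : LocSub M N (iSup V)), ?_, ?_⟩
  · refine LocSub.mem_of_cover N fun x hx => ?_
    obtain ⟨i, hi⟩ := Opens.mem_iSup.1 hx
    exact ⟨V i, hi, le_iSup V i, by rw [ht i]; exact (φ i).2⟩
  · intro i
    exact Subtype.ext (ht i)
  · intro s hs
    apply Subtype.ext
    refine eq_of_res M _ _ fun x hx => ?_
    obtain ⟨i, hi⟩ := Opens.mem_iSup.1 hx
    exact ⟨V i, hi, le_iSup V i, (congrArg Subtype.val (hs i)).trans (ht i).symm⟩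

/-- The subsheaf of modules of `M` whose sections belong locally to `N`. -/
def locSub : X.Modules :=
  ⟨PresheafOfModules.ofPresheaf (R := X.ringCatSheaf.obj) (locSubPresheaf N) (by
    intro U V i r m
    exact Subtype.ext (res_smul M i.unop.le r m.1)), locSub_isSheaf N⟩

/-- The inclusion of the subsheaf. -/
def locSubι : locSub N ⟶ M :=
  mkHom (fun U => (LocSub M N U).subtype.toAddMonoidHom) (fun _ _ _ _ => rfl) (fun _ _ _ => rfl)

/-- A morphism into `M` whose values lie in the subsheaf factors through it. -/
def locSubLift {K : X.Modules} (φ : K ⟶ M)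
    (h : ∀ (U : X.Opens) (s : Γ(K, U)), φ.app U s ∈ LocSub M N U) : K ⟶ locSub N :=
  mkHom (fun U => ((φ.app U).hom).codRestrict (LocSub M N U) (h U))
    (fun _ _ hV s => Subtype.ext
      (ConcreteCategory.congr_hom (φ.mapPresheaf.naturality (homOfLE hV).op) s))
    (fun _ a s => Subtype.ext (Scheme.Modules.Hom.app_smul φ a s))

lemma locSubLift_ι {K : X.Modules} (φ : K ⟶ M) (h) : locSubLift N φ h ≫ locSubι N = φ := rfl

end Modules

section Operators

variable {X : Scheme.{0}}

/-- Functions, as a presheaf of sets. -/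
def inO (X : Scheme.{0}) : X.Opensᵒᵖ ⥤ Type := X.presheaf ⋙ forget CommRingCat

/-- Sections of a module, as a presheaf of sets. -/
def inM (M : X.Modules) : X.Opensᵒᵖ ⥤ Type := M.presheaf ⋙ forget Ab

/-- The product of two presheaves of sets. -/
def inProd (P Q : X.Opensᵒᵖ ⥤ Type) : X.Opensᵒᵖ ⥤ Type where
  obj W := P.obj W × Q.obj W
  map i := ↾ fun z => (P.map i z.1, Q.map i z.2)

/-- The presheaf of sets `f⁻¹𝒪_S` (before sheafification and before identifying sections): its
elements over `W` are the functions `a` on open sets `V` of `S` with `W ⊆ f⁻¹(V)`. -/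
def inPull {S : Scheme.{0}} (f : X ⟶ S) : X.Opensᵒᵖ ⥤ Type where
  obj W := {p : Σ V : S.Opens, Γ(S, V) // W.unop ≤ f ⁻¹ᵁ p.1}
  map i := ↾ fun p => ⟨p.1, i.unop.le.trans p.2⟩

/-- Operators (maps of sheaves of sets) on the structure sheaf over `U`. -/
abbrev OpO (X : Scheme.{0}) (U : X.Opens) : Type := LocMap (inO X) (OX X) U

/-- The value of an operator on a function. -/
def OpO.ev {U W : X.Opens} (P : OpO X U) (h : W ≤ U) (a : Γ(X, W)) : Γ(X, W) := P.1 ⟨W, h⟩ a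

/-- Restriction of an operator on functions. -/
def OpO.restrict {U V : X.Opens} (P : OpO X U) (h : V ≤ U) : OpO X V := LocMap.restrict h P

/-- Construct an operator on functions. -/
def OpO.mk {U : X.Opens} (P : ∀ W : X.Opens, W ≤ U → Γ(X, W) → Γ(X, W))
    (nat : ∀ (W W' : X.Opens) (hW : W ≤ U) (h : W' ≤ W) (a : Γ(X, W)),
      P W' (h.trans hW) (resO h a) = resO h (P W hW a)) : OpO X U :=
  ⟨fun W a => P W.1 W.2 a, nat⟩

namespace OpO

variable {U V W W' : X.Opens}

@[simp] lemma mk_ev (P nat) (h : W ≤ U) (a : Γ(X, W)) : (OpO.mk (U := U) P nat).ev h a = P W h a := rfl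

lemma ev_resO (P : OpO X U) (hW : W ≤ U) (h : W' ≤ W) (a : Γ(X, W)) :
    P.ev (h.trans hW) (resO h a) = resO h (P.ev hW a) := P.2 W W' hW h a

@[simp] lemma restrict_ev (P : OpO X U) (h : V ≤ U) (hW : W ≤ V) (a : Γ(X, W)) :
    (P.restrict h).ev hW a = P.ev (hW.trans h) a := rfl

@[simp] lemma add_ev (P Q : OpO X U) (h : W ≤ U) (a : Γ(X, W)) :
    (P + Q).ev h a = P.ev h a + Q.ev h a := rfl

@[simp] lemma sub_ev (P Q : OpO X U) (h : W ≤ U) (a : Γ(X, W)) :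
    (P - Q).ev h a = P.ev h a - Q.ev h a := rfl

@[simp] lemma zero_ev (h : W ≤ U) (a : Γ(X, W)) : (0 : OpO X U).ev h a = 0 := rfl

@[simp] lemma smul_ev (b : Γ(X, U)) (P : OpO X U) (h : W ≤ U) (a : Γ(X, W)) :
    (b • P).ev h a = resO h b * P.ev h a := rfl

lemma ext {P Q : OpO X U} (e : ∀ (W : X.Opens) (h : W ≤ U) (a : Γ(X, W)), P.ev h a = Q.ev h a) :
    P = Q := Subtype.ext (funext fun W => funext fun a => e W.1 W.2 a)

/-- Multiplication by a function. -/
def mul (c : Γ(X, U)) : OpO X U := .mk (fun _ h a => resO h c * a) (by intros; simp)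

@[simp] lemma mul_ev (c : Γ(X, U)) (h : W ≤ U) (a : Γ(X, W)) : (mul c).ev h a = resO h c * a := rfl

/-- Composition of operators. -/
def comp (P Q : OpO X U) : OpO X U := .mk (fun _ h a => P.ev h (Q.ev h a)) (by
  intro W W' hW h a; rw [ev_resO Q hW h, ev_resO P hW h])

@[simp] lemma comp_ev (P Q : OpO X U) (h : W ≤ U) (a : Γ(X, W)) :
    (comp P Q).ev h a = P.ev h (Q.ev h a) := rfl

/-- The commutator `[P, c] = P ∘ c - c ∘ P` of an operator with a function. -/
def comm (P : OpO X U) (c : Γ(X, U)) : OpO X U := comp P (mul c) - comp (mul c) P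

@[simp] lemma comm_ev (P : OpO X U) (c : Γ(X, U)) (h : W ≤ U) (a : Γ(X, W)) :
    (comm P c).ev h a = P.ev h (resO h c * a) - resO h c * P.ev h a := rfl

end OpO

/-! ### Logarithmic derivations

Let `q : X ⟶ B` be a morphism and `Z` a closed subset of `X`. The logarithmic structure of `Z` is
the monoid of functions which are invertible outside `Z`. -/

/-- The function `g` on `W` is invertible outside `Z`. -/
def InvertibleOff (Z : Set X) {W : X.Opens} (g : Γ(X, W)) : Prop :=
  ∀ x ∈ W, x ∉ Z → x ∈ X.basicOpen g

variable {B : Scheme.{0}} (q : X ⟶ B) (Z : Set X)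

/-- The logarithmic derivations over `U`: the `q⁻¹𝒪_B`-linear derivations `δ` of `𝒪_X` such that
`δ(g) = g θ(g)` with a function `θ(g)`, for all `g` in the logarithmic structure. (When such `g`
are non-zero-divisors, `θ` is unique, hence a homomorphism to the additive group; and `θ` vanishes
on functions coming from `B`, as `δ` does: so `δ` factors through the relative logarithmic
differentials.) -/
def logDer (U : X.Opens) : Submodule Γ(X, U) (OpO X U) where
  carrier := {δ |
    (∀ (W : X.Opens) (h : W ≤ U) (a b : Γ(X, W)), δ.ev h (a + b) = δ.ev h a + δ.ev h b) ∧
    (∀ (W : X.Opens) (h : W ≤ U) (a b : Γ(X, W)), δ.ev h (a * b) = a * δ.ev h b + b * δ.ev h a) ∧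
    (∀ (W : X.Opens) (h : W ≤ U) (V : B.Opens) (hV : W ≤ q ⁻¹ᵁ V) (b : Γ(B, V)),
      δ.ev h (resO hV (q.app V b)) = 0) ∧
    (∀ (W : X.Opens) (h : W ≤ U) (g : Γ(X, W)), InvertibleOff Z g → g ∣ δ.ev h g)}
  add_mem' {δ δ'} hδ hδ' := by
    refine ⟨fun W h a b => ?_, fun W h a b => ?_, fun W h V hV b => ?_, fun W h g hg => ?_⟩
    · simp only [OpO.add_ev, hδ.1 W h a b, hδ'.1 W h a b]; ring
    · simp only [OpO.add_ev, hδ.2.1 W h a b, hδ'.2.1 W h a b]; ring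
    · simp only [OpO.add_ev, hδ.2.2.1 W h V hV b, hδ'.2.2.1 W h V hV b, add_zero]
    · rw [OpO.add_ev]; exact dvd_add (hδ.2.2.2 W h g hg) (hδ'.2.2.2 W h g hg)
  zero_mem' := ⟨by simp, by simp, by simp, by simp⟩
  smul_mem' c δ hδ := by
    refine ⟨fun W h a b => ?_, fun W h a b => ?_, fun W h V hV b => ?_, fun W h g hg => ?_⟩
    · simp only [OpO.smul_ev, hδ.1 W h a b]; ring
    · simp only [OpO.smul_ev, hδ.2.1 W h a b]; ring
    · simp only [OpO.smul_ev, hδ.2.2.1 W h V hV b, mul_zero]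
    · exact Dvd.dvd.mul_left (hδ.2.2.2 W h g hg) _

lemma logDer_restrict {U V : X.Opens} (h : V ≤ U) {δ : OpO X U} (hδ : δ ∈ logDer q Z U) :
    δ.restrict h ∈ logDer q Z V :=
  ⟨fun W hW => hδ.1 W (hW.trans h), fun W hW => hδ.2.1 W (hW.trans h),
    fun W hW => hδ.2.2.1 W (hW.trans h), fun W hW => hδ.2.2.2 W (hW.trans h)⟩

/-- The sheaf `T_{X/B}(log Z)` of logarithmic derivations. -/
def logT : X.Modules := locSub (M := locMap (inO X) (OX X)) (logDer q Z)

/-- The inclusion of the logarithmic derivations in all operators on functions. -/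
def logTι : logT q Z ⟶ locMap (inO X) (OX X) := locSubι (M := locMap (inO X) (OX X)) (logDer q Z)

/-- The underlying operator of a logarithmic derivation. -/
def logT.toOp {U : X.Opens} (δ : Γ(logT q Z, U)) : OpO X U := (logTι q Z).app U δ

/-! ### Logarithmic differential operators -/

/-- The subring of operators on functions over `U` which is generated by the functions and the
logarithmic derivations. -/
inductive Gen (U : X.Opens) : OpO X U → Prop
  | mul (c : Γ(X, U)) : Gen U (.mul c)
  | der (δ : OpO X U) (h : δ ∈ logDer q Z U) : Gen U δ
  | add (P Q : OpO X U) (hP : Gen U P) (hQ : Gen U Q) : Gen U (P + Q)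
  | comp (P Q : OpO X U) (hP : Gen U P) (hQ : Gen U Q) : Gen U (P.comp Q)

/-- Sections of the sheaf `𝒟` of subrings of operators generated by functions and logarithmic
derivations. -/
def InD (U : X.Opens) (P : OpO X U) : Prop :=
  ∀ x ∈ U, ∃ V : X.Opens, x ∈ V ∧ ∃ hV : V ≤ U, Gen q Z V (P.restrict hV)

/-- Sections of the sheaf `𝒟ᵏ` of logarithmic differential operators of order `≤ k` on `𝒪_X`:
`𝒟⁰ = 𝒪_X`, and `𝒟ᵏ⁺¹` consists of the `P` in `𝒟` with `[P, a] ∈ 𝒟ᵏ` for all local functions `a`. -/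
def IsDO : ℕ → ∀ U : X.Opens, OpO X U → Prop
  | 0, U, P => ∃ c : Γ(X, U), P = .mul c
  | k + 1, U, P => InD q Z U P ∧
      ∀ (W : X.Opens) (h : W ≤ U) (a : Γ(X, W)), IsDO k W ((P.restrict h).comm a)

section lemmas

variable {q Z}

lemma Gen.restrict {U V : X.Opens} (h : V ≤ U) {P : OpO X U} (hP : Gen q Z U P) :
    Gen q Z V (P.restrict h) := by
  induction hP with
  | mul c =>
    have : (OpO.mul c).restrict h = .mul (resO h c) := OpO.ext fun W hW a => by simp
    rw [this]; exact .mul _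
  | der δ hδ => exact .der _ (logDer_restrict q Z h hδ)
  | add P Q _ _ ihP ihQ => exact .add _ _ ihP ihQ
  | comp P Q _ _ ihP ihQ => exact .comp _ _ ihP ihQ

lemma Gen.map_add {U : X.Opens} {P : OpO X U} (hP : Gen q Z U P) {W : X.Opens} (h : W ≤ U)
    (a b : Γ(X, W)) : P.ev h (a + b) = P.ev h a + P.ev h b := by
  induction hP generalizing a b with
  | mul c => simp [mul_add]
  | der δ hδ => exact hδ.1 W h a b
  | add P Q _ _ ihP ihQ => simp only [OpO.add_ev, ihP, ihQ]; ring
  | comp P Q _ _ ihP ihQ => simp only [OpO.comp_ev, ihP, ihQ]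

lemma Gen.map_base {U : X.Opens} {P : OpO X U} (hP : Gen q Z U P) {W : X.Opens} (h : W ≤ U)
    {V : B.Opens} (hV : W ≤ q ⁻¹ᵁ V) (b : Γ(B, V)) (a : Γ(X, W)) :
    P.ev h (resO hV (q.app V b) * a) = resO hV (q.app V b) * P.ev h a := by
  induction hP generalizing a with
  | mul c => rw [OpO.mul_ev, OpO.mul_ev]; ring
  | der δ hδ => rw [hδ.2.1, hδ.2.2.1, mul_zero, add_zero]
  | add P Q _ _ ihP ihQ => simp only [OpO.add_ev, ihP, ihQ]; ring
  | comp P Q _ _ ihP ihQ => simp only [OpO.comp_ev, ihP, ihQ]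

lemma Gen.dvd {U : X.Opens} {P : OpO X U} (hP : Gen q Z U P) {W : X.Opens} (h : W ≤ U)
    {g : Γ(X, W)} (hg : InvertibleOff Z g) (a : Γ(X, W)) : g ∣ P.ev h (g * a) := by
  induction hP generalizing a with
  | mul c => exact ⟨resO h c * a, by rw [OpO.mul_ev]; ring⟩
  | der δ hδ =>
    rw [hδ.2.1]
    exact dvd_add (dvd_mul_right _ _) ((hδ.2.2.2 W h g hg).mul_left _)
  | add P Q _ _ ihP ihQ => rw [OpO.add_ev]; exact dvd_add (ihP a) (ihQ a)
  | comp P Q _ _ ihP ihQ =>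
    obtain ⟨c, hc⟩ := ihQ a
    rw [OpO.comp_ev, hc]
    exact ihP c

lemma InD.add {U : X.Opens} {P Q : OpO X U} (hP : InD q Z U P) (hQ : InD q Z U Q) :
    InD q Z U (P + Q) := by
  intro x hx
  obtain ⟨V, hxV, hV, h⟩ := hP x hx
  obtain ⟨V', hxV', hV', h'⟩ := hQ x hx
  exact ⟨V ⊓ V', ⟨hxV, hxV'⟩, inf_le_left.trans hV,
    .add _ _ (h.restrict inf_le_left) (h'.restrict inf_le_right)⟩

lemma InD.mul {U : X.Opens} (c : Γ(X, U)) : InD q Z U (.mul c) :=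
  fun _ hx => ⟨U, hx, le_rfl, (Gen.mul c).restrict le_rfl⟩

lemma InD.smul {U : X.Opens} (c : Γ(X, U)) {P : OpO X U} (hP : InD q Z U P) :
    InD q Z U (c • P) := by
  intro x hx
  obtain ⟨V, hxV, hV, h⟩ := hP x hx
  exact ⟨V, hxV, hV, .comp _ _ ((Gen.mul c).restrict hV) h⟩

lemma IsDO.add {k : ℕ} : ∀ {U : X.Opens} {P Q : OpO X U}, IsDO q Z k U P → IsDO q Z k U Q →
    IsDO q Z k U (P + Q) := by
  induction k with
  | zero =>
    rintro U P Q ⟨c, rfl⟩ ⟨d, rfl⟩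
    exact ⟨c + d, OpO.ext fun W h a => by simp [add_mul]⟩
  | succ k ih =>
    intro U P Q hP hQ
    refine ⟨hP.1.add hQ.1, fun W h a => ?_⟩
    convert ih (hP.2 W h a) (hQ.2 W h a) using 1
    refine OpO.ext fun W' h' b => ?_
    simp only [OpO.comm_ev, OpO.restrict_ev, OpO.add_ev]
    ring

lemma IsDO.smul {k : ℕ} : ∀ {U : X.Opens} (c : Γ(X, U)) {P : OpO X U}, IsDO q Z k U P →
    IsDO q Z k U (c • P) := by
  induction k with
  | zero =>
    rintro U c P ⟨d, rfl⟩
    exact ⟨c * d, OpO.ext fun W h a => by simp [mul_assoc]⟩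
  | succ k ih =>
    intro U c P hP
    refine ⟨hP.1.smul c, fun W h a => ?_⟩
    convert ih (resO h c) (hP.2 W h a) using 1
    refine OpO.ext fun W' h' b => ?_
    simp only [OpO.comm_ev, OpO.restrict_ev, OpO.smul_ev, resO_resO]
    ring

lemma IsDO.mul (k : ℕ) : ∀ {U : X.Opens} (c : Γ(X, U)), IsDO q Z k U (.mul c) := by
  induction k with
  | zero => exact fun c => ⟨c, rfl⟩
  | succ k ih =>
    intro U c
    refine ⟨.mul c, fun W h a => ?_⟩
    convert ih (0 : Γ(X, W)) using 1
    refine OpO.ext fun W' h' b => ?_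
    simp only [OpO.comm_ev, OpO.restrict_ev, OpO.mul_ev, map_zero]
    ring

lemma IsDO.inD {k : ℕ} {U : X.Opens} {P : OpO X U} (hP : IsDO q Z k U P) : InD q Z U P := by
  cases k with
  | zero => obtain ⟨c, rfl⟩ := hP; exact .mul c
  | succ k => exact hP.1

lemma IsDO.restrict {k : ℕ} {U V : X.Opens} (h : V ≤ U) {P : OpO X U} (hP : IsDO q Z k U P) :
    IsDO q Z k V (P.restrict h) := by
  cases k with
  | zero =>
    obtain ⟨c, rfl⟩ := hP
    exact ⟨resO h c, OpO.ext fun W hW a => by simp⟩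
  | succ k =>
    refine ⟨fun x hx => ?_, fun W hW a => hP.2 W (hW.trans h) a⟩
    obtain ⟨V', hxV, hV, h'⟩ := hP.1 x (h hx)
    exact ⟨V ⊓ V', ⟨hx, hxV⟩, inf_le_left, h'.restrict inf_le_right⟩

lemma IsDO.succ {k : ℕ} : ∀ {U : X.Opens} {P : OpO X U}, IsDO q Z k U P →
    IsDO q Z (k + 1) U P := by
  induction k with
  | zero => rintro U P ⟨c, rfl⟩; exact .mul 1 c
  | succ k ih => exact fun hP => ⟨hP.1, fun W h a => ih (hP.2 W h a)⟩

end lemmas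

/-! ### Logarithmic differential operators on a line bundle -/

/-- The section `s` over `W` is a free generator of `L` on `W`. -/
def IsGenerator (L : X.Modules) {W : X.Opens} (s : Γ(L, W)) : Prop :=
  ∀ (W' : X.Opens) (h : W' ≤ W), Function.Bijective fun a : Γ(X, W') => a • res L h s

/-- `L` is a line bundle: it is locally free of rank one. -/
def IsLineBundle (L : X.Modules) : Prop :=
  ∀ x : X, ∃ W : X.Opens, x ∈ W ∧ ∃ s : Γ(L, W), IsGenerator L s

lemma IsGenerator.res {L : X.Modules} {W V : X.Opens} {s : Γ(L, W)} (hs : IsGenerator L s)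
    (h : V ≤ W) : IsGenerator L (res L h s) := by
  intro W' h'
  simp only [res_res]
  exact hs W' _

/-- Operators on `L` over `U`. -/
abbrev Op (L : X.Modules) (U : X.Opens) : Type := LocMap (inM L) L U

/-- The sheaf of operators on `L`. -/
abbrev opSheaf (L : X.Modules) : X.Modules := locMap (inM L) L

/-- The value of an operator on a section. -/
def Op.ev {L : X.Modules} {U W : X.Opens} (D : Op L U) (h : W ≤ U) (s : Γ(L, W)) : Γ(L, W) :=
  D.1 ⟨W, h⟩ s

lemma Op.ev_res {L : X.Modules} {U W W' : X.Opens} (D : Op L U) (hW : W ≤ U) (h : W' ≤ W)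
    (s : Γ(L, W)) : D.ev (h.trans hW) (res L h s) = res L h (D.ev hW s) := D.2 W W' hW h s

lemma Op.ext {L : X.Modules} {U : X.Opens} {D E : Op L U}
    (e : ∀ (W : X.Opens) (h : W ≤ U) (s : Γ(L, W)), D.ev h s = E.ev h s) : D = E :=
  Subtype.ext (funext fun W => funext fun a => e W.1 W.2 a)

/-- The operator `D` on the line bundle `L` corresponds to the operator `P` on functions under the
trivialisation given by `s`, that is, `D = s ⊗ P ⊗ s⁻¹`. -/
def Corresponds {L : X.Modules} {U W : X.Opens} (D : Op L U) (h : W ≤ U) (s : Γ(L, W))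
    (P : OpO X W) : Prop :=
  ∀ (W' : X.Opens) (h' : W' ≤ W) (g : Γ(X, W')),
    D.ev (h'.trans h) (g • res L h' s) = P.ev h' g • res L h' s

/-- Logarithmic differential operators of order `≤ k` on `L` over `U`: the sections of
`L ⊗ 𝒟ᵏ ⊗ L⁻¹`, that is, the operators on `L` which correspond to sections of `𝒟ᵏ` in every local
trivialisation. -/
def logDO (L : X.Modules) (k : ℕ) (U : X.Opens) : Submodule Γ(X, U) (Op L U) where
  carrier := {D | ∀ (W : X.Opens) (h : W ≤ U) (s : Γ(L, W)), IsGenerator L s →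
    ∃ P : OpO X W, IsDO q Z k W P ∧ Corresponds D h s P}
  add_mem' {D E} hD hE W h s hs := by
    obtain ⟨P, hP, hP'⟩ := hD W h s hs
    obtain ⟨Q, hQ, hQ'⟩ := hE W h s hs
    refine ⟨P + Q, hP.add hQ, fun W' h' g => ?_⟩
    rw [OpO.add_ev, add_smul, ← hP' W' h' g, ← hQ' W' h' g]
    rfl
  zero_mem' W h s hs := ⟨.mul 0, .mul k 0, fun W' h' g => by
    rw [OpO.mul_ev, map_zero, zero_mul, zero_smul]; rfl⟩
  smul_mem' c D hD W h s hs := by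
    obtain ⟨P, hP, hP'⟩ := hD W h s hs
    refine ⟨resO h c • P, hP.smul _, fun W' h' g => ?_⟩
    rw [OpO.smul_ev, mul_smul, ← hP' W' h' g, resO_resO]
    rfl

/-- The sheaf `𝒟ᵏ(L)` of logarithmic differential operators of order `≤ k` on `L`. -/
def logD (L : X.Modules) (k : ℕ) : X.Modules := locSub (M := opSheaf L) (logDO q Z L k)

/-- The inclusion of the logarithmic differential operators in all operators. -/
def logDι (L : X.Modules) (k : ℕ) : logD q Z L k ⟶ opSheaf L :=
  locSubι (M := opSheaf L) (logDO q Z L k)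

/-- The action of functions on `L`, as a morphism `𝒪_X ⟶ ℋom(L, L)`. -/
def mulOp (L : X.Modules) : OX X ⟶ opSheaf L :=
  mkHom (M := OX X) (N := opSheaf L)
    (fun U =>
      { toFun := fun (c : Γ(X, U)) => (⟨fun W (s : Γ(L, W.1)) => resO W.2 c • s, fun W W' hW h (s : Γ(L, W)) => by
          exact ((res_smul L h _ _).trans (congrArg (· • _) (resO_resO hW h c))).symm⟩ : Op L U)
        map_zero' := Op.ext fun W h s => (congrArg (· • s) (map_zero (resO h))).trans (zero_smul _ s)
        map_add' := fun c d => Op.ext fun W h s =>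
          (congrArg (· • s) (map_add (resO h) c d)).trans (add_smul _ _ s) })
    (fun U V h c => Op.ext fun W hW s => congrArg (· • s) (resO_resO h hW c))
    (fun U c d => Op.ext fun W h s =>
      (congrArg (· • s) (map_mul (resO h) c d)).trans (mul_smul _ _ s))

lemma mulOp_ev (L : X.Modules) {U W : X.Opens} (c : Γ(X, U)) (h : W ≤ U) (s : Γ(L, W)) :
    Op.ev ((mulOp L).app U c) h s = resO h c • s := rfl

lemma mulOp_mem (L : X.Modules) (k : ℕ) (U : X.Opens) (c : Γ(X, U)) :
    (mulOp L).app U c ∈ logDO q Z L k U := fun W h s _ =>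
  ⟨.mul (resO h c), .mul k _, fun W' h' g => by
    rw [mulOp_ev, OpO.mul_ev, mul_smul, resO_resO]⟩

end Operators

section Symbols

variable {X S : Scheme.{0}}

lemma app_resO (f : X ⟶ S) {V V' : S.Opens} (h : V' ≤ V) {W : X.Opens} (hW : W ≤ f ⁻¹ᵁ V')
    (b : Γ(S, V)) : resO hW (f.app V' (resO h b)) = resO (hW.trans fun _ hx => h hx) (f.app V b) := by
  have := ConcreteCategory.congr_hom (f.naturality (homOfLE h).op) b
  refine (congrArg (resO hW) this).trans ?_
  exact resO_resO (U := f ⁻¹ᵁ V) (V := f ⁻¹ᵁ V') (W := W) (fun _ hx => h hx) hW (f.app V b)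

lemma hom_ext_app {M N : X.Modules} {φ ψ : M ⟶ N}
    (h : ∀ (U : X.Opens) (s : Γ(M, U)), φ.app U s = ψ.app U s) : φ = ψ := by
  refine Scheme.Modules.hom_ext _ _ fun U => ?_
  ext s
  exact h U s

lemma app_res {M N : X.Modules} (φ : M ⟶ N) {U V : X.Opens} (h : V ≤ U) (s : Γ(M, U)) :
    φ.app V (res M h s) = res N h (φ.app U s) :=
  ConcreteCategory.congr_hom (φ.mapPresheaf.naturality (homOfLE h).op) s

lemma locSubι_mem {M : X.Modules} (N : ∀ U : X.Opens, Submodule Γ(X, U) Γ(M, U)) {U : X.Opens}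
    (s : Γ(locSub N, U)) : (locSubι N).app U s ∈ LocSub M N U :=
  Subtype.prop (show LocSub M N U from s)

lemma locSub_comp_eq_zero {M K : X.Modules} (N : ∀ U : X.Opens, Submodule Γ(X, U) Γ(M, U))
    (φ : M ⟶ K) (h : ∀ (U : X.Opens), ∀ m ∈ N U, φ.app U m = 0) : locSubι N ≫ φ = 0 := by
  refine hom_ext_app fun U s => ?_
  refine eq_of_res K _ _ fun x hx => ?_
  obtain ⟨V, hxV, hV, h'⟩ := locSubι_mem N s x hx
  refine ⟨V, hxV, hV, ?_⟩
  have := h V _ (h' V le_rfl)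
  rw [app_res] at this
  exact this.trans (map_zero (res K hV)).symm

/-- The inclusion of one subsheaf in another one. -/
def locSubMap {M : X.Modules} {N N' : ∀ U : X.Opens, Submodule Γ(X, U) Γ(M, U)}
    (h : ∀ U, N U ≤ N' U) : locSub N ⟶ locSub N' :=
  locSubLift N' (locSubι N) fun U s x hx => by
    obtain ⟨V, hxV, hV, h'⟩ := locSubι_mem N s x hx
    exact ⟨V, hxV, hV, fun W hW => h W (h' W hW)⟩

lemma locSubMap_ι {M : X.Modules} {N N' : ∀ U : X.Opens, Submodule Γ(X, U) Γ(M, U)}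
    (h : ∀ U, N U ≤ N' U) : locSubMap h ≫ locSubι N' = locSubι N := rfl

/-- A morphism `p : K ⟶ E` whose local sections are locally in the image of an injective morphism
`c : C ⟶ E` factors through `c`. -/
lemma exists_lift {K C E : X.Modules} (p : K ⟶ E) (c : C ⟶ E)
    (hc : ∀ U, Function.Injective (c.app U))
    (h : ∀ (U : X.Opens) (s : Γ(K, U)), ∀ x ∈ U, ∃ V : X.Opens, x ∈ V ∧ ∃ hV : V ≤ U,
      ∃ t : Γ(C, V), c.app V t = p.app V (res K hV s)) : ∃ φ : K ⟶ C, φ ≫ c = p := by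
  have key : ∀ (U : X.Opens) (s : Γ(K, U)), ∃ t : Γ(C, U), c.app U t = p.app U s := by
    intro U s
    choose V hx hV t ht using fun x : U => h U s x x.2
    obtain ⟨t', ht'⟩ := exists_glue C V hV (fun x hx' => Opens.mem_iSup.2 ⟨⟨x, hx'⟩, hx _⟩) t (by
      intro i j
      apply hc
      rw [app_res, app_res, ht, ht, ← app_res, ← app_res, res_res, res_res])
    refine ⟨t', eq_of_res E _ _ fun x hx' => ⟨V ⟨x, hx'⟩, hx _, hV _, ?_⟩⟩
    rw [← app_res, ← app_res, ht', ht]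
  choose φ hφ using key
  refine ⟨mkHom (fun U => { toFun := φ U, map_zero' := ?_, map_add' := ?_ }) ?_ ?_, ?_⟩
  · apply hc; rw [hφ, map_zero, map_zero]
  · intro s s'; apply hc; rw [hφ, map_add, map_add, hφ, hφ]
  · intro U V hV s; apply hc; change c.app V (φ V _) = _
    rw [hφ, app_res, app_res]; exact congrArg (res E hV) (hφ U s).symm
  · intro U a s; apply hc; change c.app U (φ U _) = c.app U (a • φ U s)
    rw [hφ, Scheme.Modules.Hom.app_smul, Scheme.Modules.Hom.app_smul, hφ]
  · exact hom_ext_app fun U s => hφ U s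

/-- The product of two maps `z ↦ φ(z)` and `s ↦ s`: the local map `(z, s) ↦ φ(z) s`. -/
def actOn (P : X.Opensᵒᵖ ⥤ Type) (L : X.Modules) :
    locMap P (OX X) ⟶ locMap (inProd P (inM L)) L :=
  mkHom (M := locMap P (OX X)) (N := locMap (inProd P (inM L)) L)
    (fun U =>
      { toFun := fun (φ : LocMap P (OX X) U) =>
          (⟨fun W z => (show Γ(X, W.1) from φ.1 W z.1) • (show Γ(L, W.1) from z.2),
            fun W W' hW h z => by
              refine ((res_smul L h _ _).trans (congrArg (· • _) ?_)).symm
              exact (φ.2 W W' hW h z.1).symm⟩ : LocMap (inProd P (inM L)) L U)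
        map_zero' := Subtype.ext (funext fun W => funext fun z => zero_smul Γ(X, W.1) _)
        map_add' := fun _ _ => Subtype.ext (funext fun W => funext fun z =>
          add_smul (R := Γ(X, W.1)) _ _ _) })
    (fun _ _ _ _ => rfl)
    (fun _ _ _ => Subtype.ext (funext fun W => funext fun z => mul_smul (α := Γ(X, W.1)) _ _ _))

lemma actOn_apply (P : X.Opensᵒᵖ ⥤ Type) (L : X.Modules) {U : X.Opens} (φ : LocMap P (OX X) U)
    (W : {W : X.Opens // W ≤ U}) (z : P.obj (op W.1)) (s : Γ(L, W.1)) :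
    (show LocMap (inProd P (inM L)) L U from (actOn P L).app U φ).1 W (z, s)
      = (show Γ(X, W.1) from φ.1 W z) • s := rfl

/-- The action of sections of `ℋom(P, 𝒪_X)` on a line bundle is faithful. -/
lemma actOn_injective (P : X.Opensᵒᵖ ⥤ Type) {L : X.Modules} (hL : IsLineBundle L) (U : X.Opens) :
    Function.Injective ((actOn P L).app U) := by
  intro φ ψ e
  change LocMap P (OX X) U at φ ψ
  refine Subtype.ext (funext fun W => funext fun z => ?_)
  refine eq_of_res (OX X) _ _ fun x hx => ?_
  obtain ⟨W', hxW', s, hs⟩ := hL x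
  refine ⟨W.1 ⊓ W', ⟨hx, hxW'⟩, inf_le_left, ?_⟩
  rw [← φ.2 W.1 _ W.2, ← ψ.2 W.1 _ W.2]
  refine (hs (W.1 ⊓ W') inf_le_right).1 ?_
  exact congrArg (fun t : LocMap (inProd P (inM L)) L U =>
    t.1 ⟨W.1 ⊓ W', inf_le_left.trans W.2⟩ (P.map (homOfLE inf_le_left).op z, res L inf_le_right s)) e

/-! ### The symbols of operators on a module -/

/-- First order symbol: `D ↦ ((a, s) ↦ D(as) - a D(s))`. -/
def symb1 (L : X.Modules) : opSheaf L ⟶ locMap (inProd (inO X) (inM L)) L :=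
  mkHom (M := opSheaf L) (N := locMap (inProd (inO X) (inM L)) L)
    (fun U =>
      { toFun := fun (D : Op L U) =>
          (⟨fun W z =>
            let a : Γ(X, W.1) := z.1
            let s : Γ(L, W.1) := z.2
            D.ev W.2 (a • s) - a • D.ev W.2 s,
            fun W W' hW h z => by
              let a : Γ(X, W) := z.1
              let s : Γ(L, W) := z.2
              change D.ev (h.trans hW) (resO h a • res L h s) - resO h a • D.ev (h.trans hW) (res L h s)
                = res L h (D.ev hW (a • s) - a • D.ev hW s)
              rw [← res_smul, D.ev_res hW h, D.ev_res hW h, map_sub, res_smul]⟩ :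
            LocMap (inProd (inO X) (inM L)) L U)
        map_zero' := Subtype.ext (funext fun W => funext fun z => by
          change (0 : Γ(L, W.1)) - (show Γ(X, W.1) from z.1) • (0 : Γ(L, W.1)) = 0
          rw [smul_zero, sub_zero])
        map_add' := fun (D E : Op L U) => Subtype.ext (funext fun W => funext fun z => by
          let a : Γ(X, W.1) := z.1
          let s : Γ(L, W.1) := z.2
          change (D.ev W.2 (a • s) + E.ev W.2 (a • s)) - a • (D.ev W.2 s + E.ev W.2 s)
            = (D.ev W.2 (a • s) - a • D.ev W.2 s) + (E.ev W.2 (a • s) - a • E.ev W.2 s)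
          rw [smul_add]; abel) })
    (fun _ _ _ _ => rfl)
    (fun U c (D : Op L U) => Subtype.ext (funext fun W => funext fun z => by
      let a : Γ(X, W.1) := z.1
      let s : Γ(L, W.1) := z.2
      change resO W.2 c • D.ev W.2 (a • s) - a • (resO W.2 c • D.ev W.2 s)
        = resO W.2 c • (D.ev W.2 (a • s) - a • D.ev W.2 s)
      rw [smul_sub, smul_comm a]))

/-- Second order symbol: `D ↦ ((a, b, s) ↦ D(abs) - a D(bs) - b D(as) + ab D(s))`. -/
def symb2 (L : X.Modules) :
    opSheaf L ⟶ locMap (inProd (inProd (inO X) (inO X)) (inM L)) L :=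
  mkHom (M := opSheaf L) (N := locMap (inProd (inProd (inO X) (inO X)) (inM L)) L)
    (fun U =>
      { toFun := fun (D : Op L U) =>
          (⟨fun W z =>
            let a : Γ(X, W.1) := z.1.1
            let b : Γ(X, W.1) := z.1.2
            let s : Γ(L, W.1) := z.2
            D.ev W.2 ((a * b) • s) - a • D.ev W.2 (b • s) - b • D.ev W.2 (a • s)
              + (a * b) • D.ev W.2 s,
            fun W W' hW h z => by
              let a : Γ(X, W) := z.1.1
              let b : Γ(X, W) := z.1.2
              let s : Γ(L, W) := z.2
              change D.ev (h.trans hW) ((resO h a * resO h b) • res L h s)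
                  - resO h a • D.ev (h.trans hW) (resO h b • res L h s)
                  - resO h b • D.ev (h.trans hW) (resO h a • res L h s)
                  + (resO h a * resO h b) • D.ev (h.trans hW) (res L h s)
                = res L h (D.ev hW ((a * b) • s) - a • D.ev hW (b • s) - b • D.ev hW (a • s)
                  + (a * b) • D.ev hW s)
              rw [← map_mul, ← res_smul, ← res_smul, ← res_smul, D.ev_res hW h, D.ev_res hW h,
                D.ev_res hW h, D.ev_res hW h, map_add, map_sub, map_sub, res_smul, res_smul,
                res_smul]⟩ :
            LocMap (inProd (inProd (inO X) (inO X)) (inM L)) L U)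
        map_zero' := Subtype.ext (funext fun W => funext fun z => by
          let a : Γ(X, W.1) := z.1.1
          let b : Γ(X, W.1) := z.1.2
          change (0 : Γ(L, W.1)) - a • (0 : Γ(L, W.1)) - b • (0 : Γ(L, W.1))
            + (a * b) • (0 : Γ(L, W.1)) = 0
          rw [smul_zero, smul_zero, smul_zero, sub_zero, sub_zero, add_zero])
        map_add' := fun (D E : Op L U) => Subtype.ext (funext fun W => funext fun z => by
          let a : Γ(X, W.1) := z.1.1
          let b : Γ(X, W.1) := z.1.2
          let s : Γ(L, W.1) := z.2
          change (D.ev W.2 ((a * b) • s) + E.ev W.2 ((a * b) • s))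
              - a • (D.ev W.2 (b • s) + E.ev W.2 (b • s))
              - b • (D.ev W.2 (a • s) + E.ev W.2 (a • s)) + (a * b) • (D.ev W.2 s + E.ev W.2 s)
            = (D.ev W.2 ((a * b) • s) - a • D.ev W.2 (b • s) - b • D.ev W.2 (a • s)
                + (a * b) • D.ev W.2 s)
              + (E.ev W.2 ((a * b) • s) - a • E.ev W.2 (b • s) - b • E.ev W.2 (a • s)
                + (a * b) • E.ev W.2 s)
          rw [smul_add, smul_add, smul_add]; abel) })
    (fun _ _ _ _ => rfl)
    (fun U c (D : Op L U) => Subtype.ext (funext fun W => funext fun z => by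
      let a : Γ(X, W.1) := z.1.1
      let b : Γ(X, W.1) := z.1.2
      let s : Γ(L, W.1) := z.2
      change resO W.2 c • D.ev W.2 ((a * b) • s) - a • (resO W.2 c • D.ev W.2 (b • s))
          - b • (resO W.2 c • D.ev W.2 (a • s)) + (a * b) • (resO W.2 c • D.ev W.2 s)
        = resO W.2 c • (D.ev W.2 ((a * b) • s) - a • D.ev W.2 (b • s) - b • D.ev W.2 (a • s)
          + (a * b) • D.ev W.2 s)
      rw [smul_add, smul_sub, smul_sub, smul_comm a, smul_comm b, smul_comm (a * b)]))

/-- The part of the first order symbol in the direction of the base of `f : X ⟶ S`: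
`D ↦ ((a, s) ↦ D(f^*(a) s) - f^*(a) D(s))` for functions `a` on open sets of `S`. -/
def symbBase (f : X ⟶ S) (L : X.Modules) :
    opSheaf L ⟶ locMap (inProd (inPull f) (inM L)) L :=
  mkHom (M := opSheaf L) (N := locMap (inProd (inPull f) (inM L)) L)
    (fun U =>
      { toFun := fun (D : Op L U) =>
          (⟨fun W z =>
            let a : Γ(X, W.1) := resO z.1.2 (f.app z.1.1.1 z.1.1.2)
            let s : Γ(L, W.1) := z.2
            D.ev W.2 (a • s) - a • D.ev W.2 s,
            fun W W' hW h z => by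
              let a : Γ(X, W) := resO z.1.2 (f.app z.1.1.1 z.1.1.2)
              let s : Γ(L, W) := z.2
              change D.ev (h.trans hW) (resO (h.trans z.1.2) (f.app z.1.1.1 z.1.1.2) • res L h s)
                  - resO (h.trans z.1.2) (f.app z.1.1.1 z.1.1.2) • D.ev (h.trans hW) (res L h s)
                = res L h (D.ev hW (a • s) - a • D.ev hW s)
              have e : resO (h.trans z.1.2) (f.app z.1.1.1 z.1.1.2) = resO h a :=
                (resO_resO z.1.2 h _).symm
              rw [e, ← res_smul, D.ev_res hW h, D.ev_res hW h, map_sub, res_smul]⟩ :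
            LocMap (inProd (inPull f) (inM L)) L U)
        map_zero' := Subtype.ext (funext fun W => funext fun z => by
          change (0 : Γ(L, W.1)) - resO z.1.2 (f.app z.1.1.1 z.1.1.2) • (0 : Γ(L, W.1)) = 0
          rw [smul_zero, sub_zero])
        map_add' := fun (D E : Op L U) => Subtype.ext (funext fun W => funext fun z => by
          let a : Γ(X, W.1) := resO z.1.2 (f.app z.1.1.1 z.1.1.2)
          let s : Γ(L, W.1) := z.2
          change (D.ev W.2 (a • s) + E.ev W.2 (a • s)) - a • (D.ev W.2 s + E.ev W.2 s)
            = (D.ev W.2 (a • s) - a • D.ev W.2 s) + (E.ev W.2 (a • s) - a • E.ev W.2 s)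
          rw [smul_add]; abel) })
    (fun _ _ _ _ => rfl)
    (fun U c (D : Op L U) => Subtype.ext (funext fun W => funext fun z => by
      let a : Γ(X, W.1) := resO z.1.2 (f.app z.1.1.1 z.1.1.2)
      let s : Γ(L, W.1) := z.2
      change resO W.2 c • D.ev W.2 (a • s) - a • (resO W.2 c • D.ev W.2 s)
        = resO W.2 c • (D.ev W.2 (a • s) - a • D.ev W.2 s)
      rw [smul_sub, smul_comm a]))

lemma mulOp_symb1 (L : X.Modules) : mulOp L ≫ symb1 L = 0 :=
  hom_ext_app fun U c => Subtype.ext (funext fun W => funext fun z => by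
    let a : Γ(X, W.1) := z.1
    let s : Γ(L, W.1) := z.2
    change resO W.2 c • (a • s) - a • (resO W.2 c • s) = 0
    rw [smul_comm, sub_self])

lemma mulOp_symb2 (L : X.Modules) : mulOp L ≫ symb2 L = 0 :=
  hom_ext_app fun U c => Subtype.ext (funext fun W => funext fun z => by
    let a : Γ(X, W.1) := z.1.1
    let b : Γ(X, W.1) := z.1.2
    let s : Γ(L, W.1) := z.2
    change resO W.2 c • ((a * b) • s) - a • (resO W.2 c • (b • s)) - b • (resO W.2 c • (a • s))
      + (a * b) • (resO W.2 c • s) = 0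
    simp only [← mul_smul, ← sub_smul, ← add_smul]
    rw [show resO W.2 c * (a * b) - a * (resO W.2 c * b) - b * (resO W.2 c * a)
      + a * b * resO W.2 c = 0 by ring, zero_smul])

lemma mulOp_symbBase (f : X ⟶ S) (L : X.Modules) : mulOp L ≫ symbBase f L = 0 :=
  hom_ext_app fun U c => Subtype.ext (funext fun W => funext fun z => by
    let a : Γ(X, W.1) := resO z.1.2 (f.app z.1.1.1 z.1.1.2)
    let s : Γ(L, W.1) := z.2
    change resO W.2 c • (a • s) - a • (resO W.2 c • s) = 0
    rw [smul_comm, sub_self])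

end Symbols

section Heat

variable {X S : Scheme.{0}}

/-! ### The sheaves `S²T_{X/S}(log Y)` and `f^*T_S(log Δ)` -/

/-- The sheaf of maps `𝒪_X × 𝒪_X ⟶ 𝒪_X`. -/
abbrev biOp (X : Scheme.{0}) : X.Modules := locMap (inProd (inO X) (inO X)) (OX X)

/-- The symmetric product `δ · δ'`, as the map `(a, b) ↦ δ(a) δ'(b) + δ'(a) δ(b)`. -/
def symProd {U : X.Opens} (δ δ' : OpO X U) : LocMap (inProd (inO X) (inO X)) (OX X) U :=
  ⟨fun W z => δ.ev W.2 z.1 * δ'.ev W.2 z.2 + δ'.ev W.2 z.1 * δ.ev W.2 z.2,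
    fun W W' hW h z => by
      let a : Γ(X, W) := z.1
      let b : Γ(X, W) := z.2
      change δ.ev (h.trans hW) (resO h a) * δ'.ev (h.trans hW) (resO h b)
          + δ'.ev (h.trans hW) (resO h a) * δ.ev (h.trans hW) (resO h b)
        = resO h (δ.ev hW a * δ'.ev hW b + δ'.ev hW a * δ.ev hW b)
      rw [δ.ev_resO hW h, δ.ev_resO hW h, δ'.ev_resO hW h, δ'.ev_resO hW h, map_add, map_mul,
        map_mul]⟩

/-- Linear combinations over `U` of symmetric products of logarithmic derivations over `U`. -/
def symSpan (f : X ⟶ S) (Y : Set X) (U : X.Opens) : Submodule Γ(X, U) Γ(biOp X, U) :=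
  Submodule.span Γ(X, U) {φ | ∃ δ ∈ logDer f Y U, ∃ δ' ∈ logDer f Y U, φ = symProd δ δ'}

/-- The symmetric square `S²T_{X/S}(log Y)`, realised as a sheaf of symmetric biderivations: the
subsheaf of `ℋom(𝒪_X × 𝒪_X, 𝒪_X)` generated by the symmetric products of two logarithmic
derivations. -/
def symT (f : X ⟶ S) (Y : Set X) : X.Modules := locSub (M := biOp X) (symSpan f Y)

/-- The inclusion of the symmetric square in all maps `𝒪_X × 𝒪_X ⟶ 𝒪_X`. -/
def symTι (f : X ⟶ S) (Y : Set X) : symT f Y ⟶ biOp X := locSubι (M := biOp X) (symSpan f Y)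

/-- The sheaf of maps `f⁻¹𝒪_S ⟶ 𝒪_X`. -/
abbrev baseOp (f : X ⟶ S) : X.Modules := locMap (inPull f) (OX X)

/-- An operator `θ` on functions over `V ⊆ S`, followed by the pull-back of functions from `S` to
`X`: this is the section `1 ⊗ θ` over `U ⊆ f⁻¹(V)`. -/
def pullOp (f : X ⟶ S) {V : S.Opens} {U : X.Opens} (hU : U ≤ f ⁻¹ᵁ V) (θ : OpO S V) :
    LocMap (inPull f) (OX X) U :=
  ⟨fun W z => resO (show W.1 ≤ f ⁻¹ᵁ (V ⊓ z.1.1) from le_inf (W.2.trans hU) z.2)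
      (f.app (V ⊓ z.1.1) (θ.ev inf_le_left (resO inf_le_right z.1.2))),
    fun _ _ _ h _ => (resO_resO _ h _).symm⟩

lemma pullOp_restrict (f : X ⟶ S) {V V' : S.Opens} (hV : V' ≤ V) {U : X.Opens}
    (hU : U ≤ f ⁻¹ᵁ V') (θ : OpO S V) :
    pullOp f hU (θ.restrict hV) = pullOp f (hU.trans fun _ hx => hV hx) θ := by
  refine Subtype.ext (funext fun W => funext fun z => ?_)
  have h : V' ⊓ z.1.1 ≤ V ⊓ z.1.1 := inf_le_inf_right _ hV
  have e := θ.ev_resO (inf_le_left : V ⊓ z.1.1 ≤ V) h (resO inf_le_right z.1.2)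
  rw [resO_resO] at e
  refine Eq.trans ?_ (app_resO f h (show W.1 ≤ f ⁻¹ᵁ (V' ⊓ z.1.1) from
    le_inf (W.2.trans hU) z.2) (θ.ev inf_le_left (resO inf_le_right z.1.2)))
  rw [← e]
  rfl

/-- Linear combinations over `U` of the sections `1 ⊗ θ`, for logarithmic derivations `θ` of `S`. -/
def pullSpan (f : X ⟶ S) {B : Scheme.{0}} (pS : S ⟶ B) (Δ : Set S) (U : X.Opens) :
    Submodule Γ(X, U) Γ(baseOp f, U) :=
  Submodule.span Γ(X, U)
    {φ | ∃ (V : S.Opens) (hU : U ≤ f ⁻¹ᵁ V), ∃ θ ∈ logDer pS Δ V, φ = pullOp f hU θ}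

/-- The pull-back `f^*T_S(log Δ)`, realised as a sheaf of derivations `f⁻¹𝒪_S ⟶ 𝒪_X`: the
subsheaf generated by the logarithmic derivations of `S`. -/
def pullT (f : X ⟶ S) {B : Scheme.{0}} (pS : S ⟶ B) (Δ : Set S) : X.Modules :=
  locSub (M := baseOp f) (pullSpan f pS Δ)

/-- The inclusion of `f^*T_S(log Δ)` in the maps `f⁻¹𝒪_S ⟶ 𝒪_X`. -/
def pullTι (f : X ⟶ S) {B : Scheme.{0}} (pS : S ⟶ B) (Δ : Set S) : pullT f pS Δ ⟶ baseOp f :=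
  locSubι (M := baseOp f) (pullSpan f pS Δ)

/-- The canonical map `T_S(log Δ) ⟶ f_* f^*T_S(log Δ)`, followed by the inclusion in the sheaf of
maps `f⁻¹𝒪_S ⟶ 𝒪_X`. -/
def pullMap (f : X ⟶ S) :
    locMap (inO S) (OX S) ⟶ (Scheme.Modules.pushforward f).obj (baseOp f) :=
  mkHom (M := locMap (inO S) (OX S)) (N := (Scheme.Modules.pushforward f).obj (baseOp f))
    (fun V =>
      { toFun := fun (θ : OpO S V) => (pullOp f (le_refl (f ⁻¹ᵁ V)) θ :)
        map_zero' := Subtype.ext (funext fun W => funext fun z => by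
          change resO _ (f.app (V ⊓ z.1.1) 0) = 0
          rw [map_zero, map_zero])
        map_add' := fun (θ θ' : OpO S V) => Subtype.ext (funext fun W => funext fun z => by
          change resO _ (f.app (V ⊓ z.1.1) (θ.ev inf_le_left (resO inf_le_right z.1.2)
              + θ'.ev inf_le_left (resO inf_le_right z.1.2)))
            = resO _ (f.app (V ⊓ z.1.1) (θ.ev inf_le_left (resO inf_le_right z.1.2)))
              + resO _ (f.app (V ⊓ z.1.1) (θ'.ev inf_le_left (resO inf_le_right z.1.2)))
          rw [map_add, map_add]) })
    (fun V V' h (θ : OpO S V) => pullOp_restrict f h (le_refl (f ⁻¹ᵁ V')) θ)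
    (fun V c (θ : OpO S V) => Subtype.ext (funext fun W => funext fun z => by
      obtain ⟨⟨V', a⟩, hz⟩ := z
      have hW : W.1 ≤ f ⁻¹ᵁ (V ⊓ V') := le_inf W.2 hz
      have e : ∀ u v : Γ(S, V ⊓ V'), resO hW (f.app (V ⊓ V') (u * v))
          = resO hW (f.app (V ⊓ V') u) * resO hW (f.app (V ⊓ V') v) := by
        intro u v; rw [map_mul, map_mul]
      exact (e (resO inf_le_left c) (θ.ev inf_le_left (resO inf_le_right a))).trans
        (congrArg (· * _) (app_resO f inf_le_left hW c))))

/-- The canonical map `T_S(log Δ) ⟶ f_* f^*T_S(log Δ)`. -/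
def canon (f : X ⟶ S) {B : Scheme.{0}} (pS : S ⟶ B) (Δ : Set S) :
    logT pS Δ ⟶ (Scheme.Modules.pushforward f).obj (pullT f pS Δ) :=
  mkHom (M := logT pS Δ) (N := (Scheme.Modules.pushforward f).obj (pullT f pS Δ))
    (fun V => ((((logTι pS Δ ≫ pullMap f).app V).hom.codRestrict
      (LocSub (baseOp f) (pullSpan f pS Δ) (f ⁻¹ᵁ V)) fun θ x hx => by
        obtain ⟨V', hxV, hV, h⟩ := locSubι_mem (M := locMap (inO S) (OX S)) (logDer pS Δ) θ
          (f x) hx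
        refine ⟨f ⁻¹ᵁ V', hxV, fun _ hy => hV hy, fun W hW => Submodule.subset_span
          ⟨V', hW, _, h V' le_rfl, ?_⟩⟩
        exact (pullOp_restrict f hV hW (logT.toOp pS Δ θ)).symm) :
      Γ(logT pS Δ, V) →+ LocSub (baseOp f) (pullSpan f pS Δ) (f ⁻¹ᵁ V)))
    (fun V V' h θ => Subtype.ext (app_res (logTι pS Δ ≫ pullMap f) h θ))
    (fun V c θ => Subtype.ext (Scheme.Modules.Hom.app_smul (logTι pS Δ ≫ pullMap f) c θ))

lemma canon_ι (f : X ⟶ S) {B : Scheme.{0}} (pS : S ⟶ B) (Δ : Set S) :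
    canon f pS Δ ≫ (Scheme.Modules.pushforward f).map (pullTι f pS Δ)
      = logTι pS Δ ≫ pullMap f := rfl

/-! ### Cohomology classes -/

instance : (toAb X).Additive := ⟨fun {_ _ _ _} => rfl⟩

/-- Direct image of abelian sheaves. -/
abbrev fstar (f : X ⟶ S) :
    TopCat.Sheaf AddCommGrpCat.{0} X ⥤ TopCat.Sheaf AddCommGrpCat.{0} S :=
  TopCat.Sheaf.pushforward AddCommGrpCat.{0} f.base

instance (f : X ⟶ S) : (fstar f).Additive := ⟨fun {_ _ _ _} => rfl⟩

/-- The first higher direct image `R¹f_*M` of a sheaf of modules, as an abelian sheaf. -/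
abbrev R1 (f : X ⟶ S) (M : X.Modules) : TopCat.Sheaf AddCommGrpCat.{0} S :=
  ((fstar f).rightDerived 1).obj ((toAb X).obj M)

lemma logDer_comp_le (f : X ⟶ S) {B : Scheme.{0}} (pS : S ⟶ B) (Y : Set X) (U : X.Opens) :
    logDer f Y U ≤ logDer (f ≫ pS) Y U := by
  rintro δ ⟨h1, h2, h3, h4⟩
  refine ⟨h1, h2, fun W h V hV b => ?_, h4⟩
  have := h3 W h (pS ⁻¹ᵁ V) hV (pS.app V b)
  rw [Scheme.Hom.comp_app]
  exact this

/-- The inclusion `T_{X/S}(log Y) ⟶ T_X(log Y)`. -/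
def relT (f : X ⟶ S) {B : Scheme.{0}} (pS : S ⟶ B) (Y : Set X) :
    logT f Y ⟶ logT (f ≫ pS) Y :=
  locSubMap (M := locMap (inO X) (OX X)) (logDer_comp_le f pS Y)

/-- Restriction of operators on `𝒪_X` to functions which come from `S`. -/
def toBase (f : X ⟶ S) : locMap (inO X) (OX X) ⟶ baseOp f :=
  mkHom (M := locMap (inO X) (OX X)) (N := baseOp f)
    (fun U =>
      { toFun := fun (P : OpO X U) =>
          (⟨fun W z => P.ev W.2 (resO z.2 (f.app z.1.1 z.1.2)),
            fun W W' hW h z => by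
              refine Eq.trans ?_ (P.ev_resO hW h _)
              rw [resO_resO]
              rfl⟩ : LocMap (inPull f) (OX X) U)
        map_zero' := rfl
        map_add' := fun _ _ => rfl })
    (fun _ _ _ _ => rfl) (fun _ _ _ => rfl)

lemma relT_toBase (f : X ⟶ S) {B : Scheme.{0}} (pS : S ⟶ B) (Y : Set X) :
    relT f pS Y ≫ logTι (f ≫ pS) Y ≫ toBase f = 0 :=
  locSub_comp_eq_zero (M := locMap (inO X) (OX X)) (logDer f Y) (toBase f) fun _ _ hδ =>
    Subtype.ext (funext fun W => funext fun z => hδ.2.2.1 W.1 W.2 _ z.2 z.1.2)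

/-- The Kodaira-Spencer map `κ_{X/S} : T_S(log Δ) ⟶ R¹f_*T_{X/S}(log Y)`: the connecting map of
`0 ⟶ T_{X/S}(log Y) ⟶ T_X(log Y) ⟶ f^*T_S(log Δ) ⟶ 0` on `T_S(log Δ) ⟶ f_*f^*T_S(log Δ)`. -/
def kodairaSpencer (f : X ⟶ S) {B : Scheme.{0}} (pS : S ⟶ B) (Δ : Set S) (Y : Set X) :
    (toAb S).obj (logT pS Δ) ⟶ R1 f (logT f Y) :=
  (toAb S).map (canon f pS Δ) ≫
    connecting (fstar f) ((toAb X).map (relT f pS Y))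
      ((toAb X).map (logTι (f ≫ pS) Y ≫ toBase f))
      (by rw [← Functor.map_comp, relT_toBase, Functor.map_zero])
      ((toAb X).map (pullTι f pS Δ))

/-- The multiplication by functions, as a map `𝒪_X ⟶ 𝒟¹_{X/S}(L)`. -/
def mulD (f : X ⟶ S) (Y : Set X) (L : X.Modules) : OX X ⟶ logD f Y L 1 :=
  locSubLift (M := opSheaf L) (logDO f Y L 1) (mulOp L) fun U c x hx =>
    ⟨U, hx, le_rfl, fun W hW => by rw [← app_res]; exact mulOp_mem f Y L 1 W _⟩

/-- The inclusion `𝒟¹_{X/S}(L) ⟶ 𝒟²_{X/S}(L)`. -/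
def incD (f : X ⟶ S) (Y : Set X) (L : X.Modules) : logD f Y L 1 ⟶ logD f Y L 2 :=
  locSubMap (M := opSheaf L) fun U D hD W h s hs => by
    obtain ⟨P, hP, hP'⟩ := hD W h s hs
    exact ⟨P, hP.succ, hP'⟩

variable {B : Scheme.{0}} {q : X ⟶ B} {Z : Set X}

/-- The symbol of a first order operator on functions is a logarithmic derivation. -/
lemma exists_logDer {U : X.Opens} {P : OpO X U} (hP : IsDO q Z 1 U P) (hG : Gen q Z U P) :
    ∃ δ ∈ logDer q Z U, ∀ (W : X.Opens) (h : W ≤ U) (a b : Γ(X, W)),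
      P.ev h (a * b) - a * P.ev h b = δ.ev h a * b := by
  let δ : OpO X U := .mk (fun W h a => P.ev h a - a * P.ev h 1) (by
    intro W W' hW h a
    rw [P.ev_resO hW h, map_sub, map_mul, ← P.ev_resO hW h 1, map_one])
  have hδ : ∀ (W : X.Opens) (h : W ≤ U) (a : Γ(X, W)), δ.ev h a = P.ev h a - a * P.ev h 1 :=
    fun _ _ _ => rfl
  have key : ∀ (W : X.Opens) (h : W ≤ U) (a b : Γ(X, W)),
      P.ev h (a * b) - a * P.ev h b = δ.ev h a * b := by
    intro W h a b
    obtain ⟨c, hc⟩ := hP.2 W h a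
    have hc' : ∀ b : Γ(X, W), P.ev h (a * b) - a * P.ev h b = c * b := by
      intro b
      have := congrArg (fun Q : OpO X W => Q.ev le_rfl b) hc
      simpa only [OpO.comm_ev, OpO.restrict_ev, OpO.mul_ev, resO_self] using this
    have := hc' 1
    rw [mul_one, mul_one] at this
    rw [hc', hδ, this]
  refine ⟨δ, ⟨fun W h a b => ?_, fun W h a b => ?_, fun W h V hV b => ?_, fun W h g hg => ?_⟩, key⟩
  · rw [hδ, hδ, hδ, hG.map_add]; ring
  · have := key W h a b
    rw [hδ W h (a * b), sub_eq_iff_eq_add.1 this, hδ W h b]; ring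
  · have := hG.map_base h hV b 1
    rw [mul_one] at this
    rw [hδ, this, sub_self]
  · have := hG.dvd h hg 1
    rw [mul_one] at this
    rw [hδ]
    exact dvd_sub this (dvd_mul_right _ _)

/-- Near each point, an operator in `𝒟ᵏ(L)` is given by an operator in `𝒟ᵏ` which is a
composition of functions and logarithmic derivations. -/
lemma exists_local {L : X.Modules} (hL : IsLineBundle L) {k : ℕ} {U : X.Opens} {D : Op L U}
    (hD : D ∈ LocSub (opSheaf L) (logDO q Z L k) U) (x : X) (hx : x ∈ U) :
    ∃ V : X.Opens, x ∈ V ∧ ∃ hV : V ≤ U, ∃ s : Γ(L, V), IsGenerator L s ∧ ∃ P : OpO X V,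
      Gen q Z V P ∧ IsDO q Z k V P ∧ Corresponds D hV s P := by
  obtain ⟨V, hxV, hV, h⟩ := hD x hx
  obtain ⟨V', hxV', s, hs⟩ := hL x
  obtain ⟨P, hP, hPD⟩ := h V le_rfl (V ⊓ V') inf_le_left (res L inf_le_right s) (hs.res inf_le_right)
  obtain ⟨V'', hxV'', hV'', hG⟩ := hP.inD x ⟨hxV, hxV'⟩
  refine ⟨V'', hxV'', hV''.trans (inf_le_left.trans hV), _, (hs.res inf_le_right).res hV'',
    P.restrict hV'', hG, ?_, fun W' h' g => ?_⟩
  · exact IsDO.restrict hV'' hP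
  · have := hPD W' (h'.trans hV'') g
    rw [res_res] at this ⊢
    rw [res_res]
    exact this

end Heat

section HeatOperators

variable {X S B : Scheme.{0}}

lemma logTι_actOn_injective (q : X ⟶ B) (Z : Set X) {L : X.Modules} (hL : IsLineBundle L)
    (U : X.Opens) : Function.Injective ((logTι q Z ≫ actOn (inO X) L).app U) := by
  intro δ δ' e
  exact Subtype.ext (actOn_injective (inO X) hL U e)

lemma exists_sigma1 (f : X ⟶ S) (Y : Set X) {L : X.Modules} (hL : IsLineBundle L) :
    ∃ φ : logD f Y L 1 ⟶ logT f Y, φ ≫ logTι f Y ≫ actOn (inO X) L = logDι f Y L 1 ≫ symb1 L := by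
  refine exists_lift _ _ (logTι_actOn_injective f Y hL) fun U D x hx => ?_
  obtain ⟨V, hxV, hV, s, hs, P, hG, hP, hc⟩ :=
    exists_local hL (locSubι_mem (M := opSheaf L) (logDO f Y L 1) D) x hx
  obtain ⟨δ, hδ, hδP⟩ := exists_logDer hP hG
  refine ⟨V, hxV, hV, (⟨δ, fun x hx => ⟨V, hx, le_rfl, fun W hW => logDer_restrict f Y hW hδ⟩⟩ :
    LocSub (locMap (inO X) (OX X)) (logDer f Y) V), Subtype.ext (funext fun W => funext fun z => ?_)⟩
  obtain ⟨a, u⟩ := z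
  change Γ(X, W.1) at a
  change Γ(L, W.1) at u
  obtain ⟨g, rfl⟩ := (hs W.1 W.2).2 u
  let D' : Op L U := (logDι f Y L 1).app U D
  change Corresponds D' hV s P at hc
  change δ.ev W.2 a • (g • res L W.2 s)
    = D'.ev (W.2.trans hV) (a • (g • res L W.2 s)) - a • D'.ev (W.2.trans hV) (g • res L W.2 s)
  rw [← mul_smul, ← mul_smul, hc W.1 W.2 (a * g), hc W.1 W.2 g, ← mul_smul, ← sub_smul, hδP]

/-- The symbol map `σ₁ : 𝒟¹_{X/S}(L) ⟶ T_{X/S}(log Y)`: it is determined by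
`σ₁(D)(a) s = D(as) - a D(s)`. -/
def sigma1 (f : X ⟶ S) (Y : Set X) {L : X.Modules} (hL : IsLineBundle L) :
    logD f Y L 1 ⟶ logT f Y :=
  (exists_sigma1 f Y hL).choose

lemma sigma1_spec (f : X ⟶ S) (Y : Set X) {L : X.Modules} (hL : IsLineBundle L) :
    sigma1 f Y hL ≫ logTι f Y ≫ actOn (inO X) L = logDι f Y L 1 ≫ symb1 L :=
  (exists_sigma1 f Y hL).choose_spec

lemma mulD_sigma1 (f : X ⟶ S) (Y : Set X) {L : X.Modules} (hL : IsLineBundle L) :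
    mulD f Y L ≫ sigma1 f Y hL = 0 := by
  have h : (mulD f Y L ≫ sigma1 f Y hL) ≫ logTι f Y ≫ actOn (inO X) L = 0 := by
    rw [Category.assoc, sigma1_spec]
    exact mulOp_symb1 L
  refine hom_ext_app fun U c => logTι_actOn_injective f Y hL U ?_
  have := congrArg (fun φ : OX X ⟶ locMap (inProd (inO X) (inM L)) L => φ.app U c) h
  exact this.trans (map_zero ((logTι f Y ≫ actOn (inO X) L).app U).hom).symm

lemma incD_symb2 (f : X ⟶ S) (Y : Set X) {L : X.Modules} (hL : IsLineBundle L) :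
    incD f Y L ≫ logDι f Y L 2 ≫ symb2 L = 0 := by
  refine hom_ext_app fun U D => Subtype.ext (funext fun W => funext fun z => ?_)
  obtain ⟨⟨a, b⟩, u⟩ := z
  change Γ(X, W.1) at a b
  change Γ(L, W.1) at u
  let D' : Op L U := (logDι f Y L 1).app U D
  change D'.ev W.2 ((a * b) • u) - a • D'.ev W.2 (b • u) - b • D'.ev W.2 (a • u)
    + (a * b) • D'.ev W.2 u = 0
  refine eq_of_res L _ _ fun x hx => ?_
  obtain ⟨V, hxV, hV, s, hs, P, hG, hP, hc⟩ :=
    exists_local hL (locSubι_mem (M := opSheaf L) (logDO f Y L 1) D) x (W.2 hx)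
  change Corresponds D' hV s P at hc
  refine ⟨W.1 ⊓ V, ⟨hx, hxV⟩, inf_le_left, ?_⟩
  obtain ⟨g, hg⟩ := (hs (W.1 ⊓ V) inf_le_right).2 (res L inf_le_left u)
  obtain ⟨δ, hδ, hδP⟩ := exists_logDer hP hG
  have hh : W.1 ⊓ V ≤ W.1 := inf_le_left
  rw [map_zero, map_add, map_sub, map_sub, res_smul, res_smul, res_smul, ← D'.ev_res W.2 hh,
    ← D'.ev_res W.2 hh, ← D'.ev_res W.2 hh, ← D'.ev_res W.2 hh, res_smul, res_smul, res_smul, ← hg,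
    map_mul]
  generalize resO hh a = a'
  generalize resO hh b = b'
  change D'.ev (inf_le_right.trans hV) ((a' * b') • g • res L inf_le_right s)
    - a' • D'.ev (inf_le_right.trans hV) (b' • g • res L inf_le_right s)
    - b' • D'.ev (inf_le_right.trans hV) (a' • g • res L inf_le_right s)
    + (a' * b') • D'.ev (inf_le_right.trans hV) (g • res L inf_le_right s) = 0
  rw [← mul_smul, ← mul_smul, ← mul_smul, hc _ inf_le_right, hc _ inf_le_right,
    hc _ inf_le_right, hc _ inf_le_right, ← mul_smul, ← mul_smul, ← mul_smul, ← sub_smul,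
    ← sub_smul, ← add_smul]
  have e1 := hδP _ inf_le_right a' (b' * g)
  have e2 := hδP _ inf_le_right a' g
  rw [sub_eq_iff_eq_add] at e1 e2
  rw [mul_assoc a' b' g, e1, e2]
  have : ∀ d p r : Γ(X, W.1 ⊓ V), d * (b' * g) + a' * p - a' * p - b' * (d * g + a' * r)
    + a' * b' * r = 0 := by intros; ring
  rw [this, zero_smul]

/-- The cup product `∪[L] : f_*T_{X/S}(log Y) ⟶ R¹f_*𝒪_X`: the connecting map of
`0 ⟶ 𝒪_X ⟶ 𝒟¹_{X/S}(L) ⟶ T_{X/S}(log Y) ⟶ 0`. -/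
def cupClass (f : X ⟶ S) (Y : Set X) {L : X.Modules} (hL : IsLineBundle L) :
    (fstar f).obj ((toAb X).obj (logT f Y)) ⟶ R1 f (OX X) :=
  connecting (fstar f) ((toAb X).map (mulD f Y L)) ((toAb X).map (sigma1 f Y hL))
    (by rw [← Functor.map_comp, mulD_sigma1, Functor.map_zero]) (𝟙 _)

/-- The map `μ_L : f_*S²T_{X/S}(log Y) ⟶ R¹f_*T_{X/S}(log Y)`: the connecting map of
`0 ⟶ 𝒟¹_{X/S}(L) ⟶ 𝒟²_{X/S}(L) ⟶ S²T_{X/S}(log Y) ⟶ 0`, followed by `R¹f_*σ₁`. -/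
def muClass (f : X ⟶ S) (Y : Set X) {L : X.Modules} (hL : IsLineBundle L) :
    (fstar f).obj ((toAb X).obj (symT f Y)) ⟶ R1 f (logT f Y) :=
  connecting (fstar f) ((toAb X).map (incD f Y L)) ((toAb X).map (logDι f Y L 2 ≫ symb2 L))
      (by rw [← Functor.map_comp, incD_symb2 f Y hL, Functor.map_zero])
      ((toAb X).map (symTι f Y ≫ actOn (inProd (inO X) (inO X)) L)) ≫
    ((fstar f).rightDerived 1).map ((toAb X).map (sigma1 f Y hL))

/-! ### Heat operators -/

/-- The sections over `U` of the sum `𝒟¹_X(L) + 𝒟²_{X/S}(L)`. -/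
def heatSum (f : X ⟶ S) (pS : S ⟶ B) (Y : Set X) (L : X.Modules) (U : X.Opens) :
    Submodule Γ(X, U) Γ(opSheaf L, U) :=
  LocSub (opSheaf L) (logDO (f ≫ pS) Y L 1) U ⊔ LocSub (opSheaf L) (logDO f Y L 2) U

/-- The sheaf `𝒲_{X/S}(L) = 𝒟¹_X(L) + 𝒟²_{X/S}(L)`. -/
def heatSheaf (f : X ⟶ S) (pS : S ⟶ B) (Y : Set X) (L : X.Modules) : X.Modules :=
  locSub (M := opSheaf L) (heatSum f pS Y L)

/-- The inclusion of `𝒲_{X/S}(L)` in all operators. -/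
def heatι (f : X ⟶ S) (pS : S ⟶ B) (Y : Set X) (L : X.Modules) :
    heatSheaf f pS Y L ⟶ opSheaf L :=
  locSubι (M := opSheaf L) (heatSum f pS Y L)

/-- The map `𝒪_X ⟶ 𝒲_{X/S}(L)`. -/
def mulHeat (f : X ⟶ S) (pS : S ⟶ B) (Y : Set X) (L : X.Modules) :
    OX X ⟶ heatSheaf f pS Y L :=
  locSubLift (M := opSheaf L) (heatSum f pS Y L) (mulOp L) fun U c x hx =>
    ⟨U, hx, le_rfl, fun W hW => by
      rw [← app_res]
      refine Submodule.mem_sup_left fun x hx => ⟨W, hx, le_rfl, fun W' hW' => ?_⟩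
      rw [← app_res]
      exact mulOp_mem _ Y L 1 W' _⟩

/-- The map `𝒪_S ⟶ f_*𝒪_X`. -/
def structMap (f : X ⟶ S) : OX S ⟶ (Scheme.Modules.pushforward f).obj (OX X) :=
  mkHom (M := OX S) (N := (Scheme.Modules.pushforward f).obj (OX X))
    (fun V => ((f.app V).hom.toAddMonoidHom : Γ(S, V) →+ Γ(X, f ⁻¹ᵁ V)))
    (fun _ _ h s => ConcreteCategory.congr_hom (f.naturality (homOfLE h).op) s)
    (fun V a s => map_mul (f.app V).hom a s)

/-- The map `𝒪_S ⟶ f_*𝒲_{X/S}(L)`. -/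
def baseHeat (f : X ⟶ S) (pS : S ⟶ B) (Y : Set X) (L : X.Modules) :
    OX S ⟶ (Scheme.Modules.pushforward f).obj (heatSheaf f pS Y L) :=
  structMap f ≫ (Scheme.Modules.pushforward f).map (mulHeat f pS Y L)

/-- The sheaf `f_*𝒲_{X/S}(L) / 𝒪_S`. -/
def projHeat (f : X ⟶ S) (pS : S ⟶ B) (Y : Set X) (L : X.Modules) : S.Modules :=
  cokernel (baseHeat f pS Y L)

/-- The component of an operator in `f_*𝒲_{X/S}(L) / 𝒪_S` in the direction of `S`. -/
def heatSymbBase (f : X ⟶ S) (pS : S ⟶ B) (Y : Set X) (L : X.Modules) :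
    projHeat f pS Y L ⟶
      (Scheme.Modules.pushforward f).obj (locMap (inProd (inPull f) (inM L)) L) :=
  cokernel.desc _ ((Scheme.Modules.pushforward f).map (heatι f pS Y L ≫ symbBase f L)) (by
    rw [baseHeat, Category.assoc, ← Functor.map_comp]
    have : mulHeat f pS Y L ≫ heatι f pS Y L ≫ symbBase f L = 0 := mulOp_symbBase f L
    rw [this, Functor.map_zero, comp_zero])

/-- The second order symbol of an operator in `f_*𝒲_{X/S}(L) / 𝒪_S`. -/
def heatSymb2 (f : X ⟶ S) (pS : S ⟶ B) (Y : Set X) (L : X.Modules) :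
    projHeat f pS Y L ⟶ (Scheme.Modules.pushforward f).obj
      (locMap (inProd (inProd (inO X) (inO X)) (inM L)) L) :=
  cokernel.desc _ ((Scheme.Modules.pushforward f).map (heatι f pS Y L ≫ symb2 L)) (by
    rw [baseHeat, Category.assoc, ← Functor.map_comp]
    have : mulHeat f pS Y L ≫ heatι f pS Y L ≫ symb2 L = 0 := mulOp_symb2 L
    rw [this, Functor.map_zero, comp_zero])

/-- `H : T_S(log Δ) ⟶ f_*𝒲_{X/S}(L) / 𝒪_S` is a projective logarithmic heat operator: the
composite of `H` with `ε : f_*𝒲_{X/S}(L) / 𝒪_S ⟶ f_*f^*T_S(log Δ)` is the canonical map. Here `ε`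
is characterised by `D(f^*(a) s) - f^*(a) D(s) = ε(D)(a) s`, and the equality is stated in the
sheaf of maps `(a, s) ↦ ε(a) s`, in which `f^*T_S(log Δ)` is a subsheaf. -/
def IsProjHeat (f : X ⟶ S) (pS : S ⟶ B) (Δ : Set S) (Y : Set X) (L : X.Modules)
    (H : logT pS Δ ⟶ projHeat f pS Y L) : Prop :=
  H ≫ heatSymbBase f pS Y L = canon f pS Δ ≫
    (Scheme.Modules.pushforward f).map (pullTι f pS Δ ≫ actOn (inPull f) L)

/-- The projective heat operator `H` has the symbol `ρ : T_S(log Δ) ⟶ f_*S²T_{X/S}(log Y)`: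
`D(abs) - a D(bs) - b D(as) + ab D(s) = ρ(θ)(a, b) s` for local representatives `D` of `H(θ)`. -/
def HasSymbol (f : X ⟶ S) (pS : S ⟶ B) (Δ : Set S) (Y : Set X) (L : X.Modules)
    (H : logT pS Δ ⟶ projHeat f pS Y L)
    (ρ : logT pS Δ ⟶ (Scheme.Modules.pushforward f).obj (symT f Y)) : Prop :=
  H ≫ heatSymb2 f pS Y L = ρ ≫
    (Scheme.Modules.pushforward f).map (symTι f Y ≫ actOn (inProd (inO X) (inO X)) L)

/-! ### Projective connections -/

/-- Operators on a module `M` over `U` which are additive and `q⁻¹𝒪_B`-linear. -/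
def linOps (q : X ⟶ B) (M : X.Modules) (U : X.Opens) : Submodule Γ(X, U) (Op M U) where
  carrier := {D |
    (∀ (W : X.Opens) (h : W ≤ U) (s t : Γ(M, W)), D.ev h (s + t) = D.ev h s + D.ev h t) ∧
    (∀ (W : X.Opens) (h : W ≤ U) (V : B.Opens) (hV : W ≤ q ⁻¹ᵁ V) (b : Γ(B, V)) (s : Γ(M, W)),
      D.ev h (resO hV (q.app V b) • s) = resO hV (q.app V b) • D.ev h s)}
  add_mem' {D E} hD hE := by
    refine ⟨fun W h s t => ?_, fun W h V hV b s => ?_⟩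
    · change D.ev h (s + t) + E.ev h (s + t) = (D.ev h s + E.ev h s) + (D.ev h t + E.ev h t)
      rw [hD.1, hE.1]; abel
    · change D.ev h (resO hV (q.app V b) • s) + E.ev h (resO hV (q.app V b) • s)
        = resO hV (q.app V b) • (D.ev h s + E.ev h s)
      rw [hD.2, hE.2, smul_add]
  zero_mem' := by
    refine ⟨fun W h s t => ?_, fun W h V hV b s => ?_⟩
    · exact (add_zero (0 : Γ(M, W))).symm
    · exact (smul_zero (A := Γ(M, W)) _).symm
  smul_mem' c D hD := by
    refine ⟨fun W h s t => ?_, fun W h V hV b s => ?_⟩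
    · change resO h c • D.ev h (s + t) = resO h c • D.ev h s + resO h c • D.ev h t
      rw [hD.1, smul_add]
    · change resO h c • D.ev h (resO hV (q.app V b) • s)
        = resO hV (q.app V b) • (resO h c • D.ev h s)
      rw [hD.2, smul_comm]

/-- The sheaf `ℰnd_B(M)` of `q⁻¹𝒪_B`-linear endomorphisms of the abelian sheaf `M`. -/
def endSheaf (q : X ⟶ B) (M : X.Modules) : X.Modules := locSub (M := opSheaf M) (linOps q M)

/-- The inclusion of the linear operators in all operators. -/
def endι (q : X ⟶ B) (M : X.Modules) : endSheaf q M ⟶ opSheaf M :=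
  locSubι (M := opSheaf M) (linOps q M)

/-- The map `𝒪_X ⟶ ℰnd_B(M)`. -/
def mulEnd (q : X ⟶ B) (M : X.Modules) : OX X ⟶ endSheaf q M :=
  locSubLift (M := opSheaf M) (linOps q M) (mulOp M) fun U c x hx =>
    ⟨U, hx, le_rfl, fun W hW => by
      rw [← app_res]
      exact ⟨fun W' h s t => smul_add _ s t, fun W' h V hV b s => smul_comm _ _ s⟩⟩

/-- The sheaf `ℰnd_B(M) / 𝒪_X`. -/
def projEnd (q : X ⟶ B) (M : X.Modules) : X.Modules := cokernel (mulEnd q M)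

/-- The first order symbol on `ℰnd_B(M) / 𝒪_X`. -/
def endSymb1 (q : X ⟶ B) (M : X.Modules) :
    projEnd q M ⟶ locMap (inProd (inO X) (inM M)) M :=
  cokernel.desc _ (endι q M ≫ symb1 M) (mulOp_symb1 M)

/-- `∇ : T_S(log Δ) ⟶ ℰnd(M) / 𝒪_S` is a projective logarithmic connection on `M`: local
representatives `∇_θ` satisfy the Leibniz rule `∇_θ(a s) = a ∇_θ(s) + θ(a) s`. -/
def IsProjConnection (pS : S ⟶ B) (Δ : Set S) (M : S.Modules)
    (nabla : logT pS Δ ⟶ projEnd pS M) : Prop :=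
  nabla ≫ endSymb1 pS M = logTι pS Δ ≫ actOn (inO S) M

lemma logDO_lin {q : X ⟶ B} {Z : Set X} {L : X.Modules} (hL : IsLineBundle L) {k : ℕ} {U : X.Opens}
    {D : Op L U} (hD : D ∈ LocSub (opSheaf L) (logDO q Z L k) U) : D ∈ linOps q L U := by
  refine ⟨fun W h s t => ?_, fun W h V hV b s => ?_⟩
  · refine eq_of_res L _ _ fun x hx => ?_
    obtain ⟨V, hxV, hV, e, he, P, hG, -, hc⟩ := exists_local hL hD x (h hx)
    refine ⟨W ⊓ V, ⟨hx, hxV⟩, inf_le_left, ?_⟩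
    have hh : W ⊓ V ≤ W := inf_le_left
    obtain ⟨g, hg⟩ := (he (W ⊓ V) inf_le_right).2 (res L hh s)
    obtain ⟨g', hg'⟩ := (he (W ⊓ V) inf_le_right).2 (res L hh t)
    rw [map_add, ← D.ev_res h hh, ← D.ev_res h hh, ← D.ev_res h hh, map_add, ← hg, ← hg']
    change D.ev (inf_le_right.trans hV) (g • res L inf_le_right e + g' • res L inf_le_right e)
      = D.ev (inf_le_right.trans hV) (g • res L inf_le_right e)
        + D.ev (inf_le_right.trans hV) (g' • res L inf_le_right e)
    rw [← add_smul, hc _ inf_le_right, hc _ inf_le_right, hc _ inf_le_right, hG.map_add, add_smul]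
  · refine eq_of_res L _ _ fun x hx => ?_
    obtain ⟨V', hxV, hV', e, he, P, hG, -, hc⟩ := exists_local hL hD x (h hx)
    refine ⟨W ⊓ V', ⟨hx, hxV⟩, inf_le_left, ?_⟩
    have hh : W ⊓ V' ≤ W := inf_le_left
    obtain ⟨g, hg⟩ := (he (W ⊓ V') inf_le_right).2 (res L hh s)
    rw [res_smul, ← D.ev_res h hh, ← D.ev_res h hh, res_smul, ← hg, resO_resO]
    change D.ev (inf_le_right.trans hV') (resO (hh.trans hV) (q.app V b) • g • res L inf_le_right e)
      = resO (hh.trans hV) (q.app V b) • D.ev (inf_le_right.trans hV') (g • res L inf_le_right e)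
    rw [← mul_smul, hc _ inf_le_right, hc _ inf_le_right, hG.map_base inf_le_right, mul_smul]

lemma linOps_comp_le (f : X ⟶ S) (pS : S ⟶ B) (M : X.Modules) (U : X.Opens) :
    linOps f M U ≤ linOps (f ≫ pS) M U := by
  rintro D ⟨h1, h2⟩
  refine ⟨h1, fun W h V hV b s => ?_⟩
  have := h2 W h (pS ⁻¹ᵁ V) hV (pS.app V b) s
  rw [Scheme.Hom.comp_app]
  exact this

lemma linOps_local {q : X ⟶ B} {M : X.Modules} {U : X.Opens} {D : Op M U}
    (hD : D ∈ LocSub (opSheaf M) (linOps q M) U) : D ∈ linOps q M U := by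
  refine ⟨fun W h s t => ?_, fun W h V hV b s => ?_⟩
  · refine eq_of_res M _ _ fun x hx => ?_
    obtain ⟨V, hxV, hV, hl⟩ := hD x (h hx)
    have hh : W ⊓ V ≤ W := inf_le_left
    refine ⟨W ⊓ V, ⟨hx, hxV⟩, hh, ?_⟩
    rw [map_add, ← D.ev_res h hh, ← D.ev_res h hh, ← D.ev_res h hh, map_add]
    exact (hl V le_rfl).1 (W ⊓ V) inf_le_right (res M hh s) (res M hh t)
  · refine eq_of_res M _ _ fun x hx => ?_
    obtain ⟨V', hxV, hV', hl⟩ := hD x (h hx)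
    have hh : W ⊓ V' ≤ W := inf_le_left
    refine ⟨W ⊓ V', ⟨hx, hxV⟩, hh, ?_⟩
    rw [res_smul, ← D.ev_res h hh, ← D.ev_res h hh, res_smul, resO_resO]
    exact (hl V' le_rfl).2 (W ⊓ V') inf_le_right V (hh.trans hV) b (res M hh s)

lemma heat_lin (f : X ⟶ S) (pS : S ⟶ B) (Y : Set X) {L : X.Modules} (hL : IsLineBundle L)
    (U : X.Opens) (D : Γ(heatSheaf f pS Y L, U)) :
    (heatι f pS Y L).app U D ∈ linOps (f ≫ pS) L U := by
  have key : ∀ V : X.Opens, heatSum f pS Y L V ≤ linOps (f ≫ pS) L V := fun V =>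
    sup_le (fun _ h => logDO_lin hL h) (fun _ h => linOps_comp_le f pS L V (logDO_lin hL h))
  refine linOps_local fun x hx => ?_
  obtain ⟨V, hxV, hV, h⟩ := locSubι_mem (M := opSheaf L) (heatSum f pS Y L) D x hx
  exact ⟨V, hxV, hV, fun W hW => key W (h W hW)⟩

/-- An operator on `L` over `f⁻¹(V)`, as an operator on `f_*L` over `V`. -/
def pushOp (f : X ⟶ S) (L : X.Modules) :
    (Scheme.Modules.pushforward f).obj (opSheaf L) ⟶
      opSheaf ((Scheme.Modules.pushforward f).obj L) :=
  mkHom (M := (Scheme.Modules.pushforward f).obj (opSheaf L))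
    (N := opSheaf ((Scheme.Modules.pushforward f).obj L))
    (fun V =>
      { toFun := fun (D : Op L (f ⁻¹ᵁ V)) =>
          (⟨fun W (s : Γ(L, f ⁻¹ᵁ W.1)) => D.ev (fun _ hx => W.2 hx) s,
            fun W W' hW h s =>
              D.ev_res (W := f ⁻¹ᵁ W) (W' := f ⁻¹ᵁ W') (fun _ hx => hW hx) (fun _ hx => h hx) s⟩ :
            Op ((Scheme.Modules.pushforward f).obj L) V)
        map_zero' := rfl
        map_add' := fun _ _ => rfl })
    (fun _ _ _ _ => rfl)
    (fun V c (D : Op L (f ⁻¹ᵁ V)) => Subtype.ext (funext fun W => funext fun s =>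
      congrArg (· • (D.ev (fun _ hx => W.2 hx) s : Γ(L, f ⁻¹ᵁ W.1)))
        (ConcreteCategory.congr_hom (f.naturality (homOfLE W.2).op) c).symm))

/-- The action of the operators in `f_*𝒲_{X/S}(L)` on `f_*L`. -/
def heatAct (f : X ⟶ S) (pS : S ⟶ B) (Y : Set X) {L : X.Modules} (hL : IsLineBundle L) :
    (Scheme.Modules.pushforward f).obj (heatSheaf f pS Y L) ⟶
      endSheaf pS ((Scheme.Modules.pushforward f).obj L) :=
  locSubLift (M := opSheaf ((Scheme.Modules.pushforward f).obj L))
    (linOps pS ((Scheme.Modules.pushforward f).obj L))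
    ((Scheme.Modules.pushforward f).map (heatι f pS Y L) ≫ pushOp f L) fun V D x hx =>
    ⟨V, hx, le_rfl, fun W hW => by
      rw [← app_res]
      obtain ⟨h1, h2⟩ := heat_lin f pS Y hL (f ⁻¹ᵁ W)
        (res ((Scheme.Modules.pushforward f).obj (heatSheaf f pS Y L)) (hW.trans le_rfl) D)
      refine ⟨fun W' h s t => h1 (f ⁻¹ᵁ W') (fun _ hx => h hx) s t, fun W' h V' hV b s => ?_⟩
      have e := h2 (f ⁻¹ᵁ W') (fun _ hx => h hx) V' (fun _ hx => hV hx) b s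
      have e' : f.app W' (resO hV (pS.app V' b))
          = resO (fun _ hx => hV hx : f ⁻¹ᵁ W' ≤ (f ≫ pS) ⁻¹ᵁ V') ((f ≫ pS).app V' b) := by
        rw [Scheme.Hom.comp_app]
        exact ConcreteCategory.congr_hom (f.naturality (homOfLE hV).op) _
      rw [← e'] at e
      exact e⟩

lemma baseHeat_heatAct (f : X ⟶ S) (pS : S ⟶ B) (Y : Set X) {L : X.Modules}
    (hL : IsLineBundle L) : baseHeat f pS Y L ≫ heatAct f pS Y hL = mulEnd pS _ := by
  refine hom_ext_app fun V c => Subtype.ext (Subtype.ext (funext fun W => funext fun s => ?_))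
  change resO _ (f.app V c) • (show Γ(L, f ⁻¹ᵁ W.1) from s) = f.app W.1 (resO W.2 c) • (show Γ(L, f ⁻¹ᵁ W.1) from s)
  rw [show f.app W.1 (resO W.2 c) = resO (fun _ hx => W.2 hx : f ⁻¹ᵁ W.1 ≤ f ⁻¹ᵁ V) (f.app V c) from
    ConcreteCategory.congr_hom (f.naturality (homOfLE W.2).op) c]

/-- The action `f_*𝒲_{X/S}(L) / 𝒪_S ⟶ ℰnd(f_*L) / 𝒪_S`. -/
def projHeatAct (f : X ⟶ S) (pS : S ⟶ B) (Y : Set X) {L : X.Modules} (hL : IsLineBundle L) :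
    projHeat f pS Y L ⟶ projEnd pS ((Scheme.Modules.pushforward f).obj L) :=
  cokernel.desc _ (heatAct f pS Y hL ≫ cokernel.π (mulEnd pS _))
    ((Category.assoc _ _ _).symm.trans
      ((congrArg (· ≫ _) (baseHeat_heatAct f pS Y hL)).trans (cokernel.condition _)))

end HeatOperators

section Geometry

/-- A normal crossing variety of dimension `d`: a reduced scheme such that the completed local
rings at the closed points are isomorphic to `ℂ⟦x₀, …, x_d⟧ / (x₀ ⋯ x_r)` with some `0 ≤ r ≤ d`. -/
def IsNCVariety (d : ℕ) (Z : Scheme.{0}) : Prop :=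
  IsReduced Z ∧ ∀ z : Z, IsClosed {z} → ∃ r : Fin (d + 1), Nonempty
    (AdicCompletion (IsLocalRing.maximalIdeal (Z.presheaf.stalk z)) (Z.presheaf.stalk z) ≃+*
      MvPowerSeries (Fin (d + 1)) ℂ ⧸
        Ideal.span {∏ i ∈ Finset.Iic r, (MvPowerSeries.X i : MvPowerSeries (Fin (d + 1)) ℂ)})

/-- The closed subset `D` of a regular scheme `X` is a (reduced) normal crossing divisor: étale
locally at each point it is the zero locus of `z₁ ⋯ z_k`, where `z₁, …, z_k` is part of a regular
system of parameters (`k = 0` at the points outside `D`). -/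
def IsNCDivisor (X : Scheme.{0}) (D : Closeds X) : Prop :=
  ∀ x : X, ∃ (U : Scheme.{0}) (φ : U ⟶ X) (_ : Etale φ) (u : U) (k : ℕ) (z : Fin k → Γ(U, ⊤)),
    φ u = x ∧
    (∃ hz : ∀ i, U.presheaf.germ ⊤ u trivial (z i) ∈
        IsLocalRing.maximalIdeal (U.presheaf.stalk u),
      LinearIndependent (IsLocalRing.ResidueField (U.presheaf.stalk u)) fun i =>
        (IsLocalRing.maximalIdeal (U.presheaf.stalk u)).toCotangent ⟨_, hz i⟩) ∧
    ∀ v : U, φ v ∈ D ↔ ∃ i, v ∉ U.basicOpen (z i)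

/-- The homomorphism `β : P → Γ(V, 𝒪)` is a chart of the logarithmic structure on `V` consisting
of the functions which are invertible outside `D`: the logarithmic structure (on the étale site)
associated with `P` is the given one. -/
structure IsLogChart {V : Scheme.{0}} (D : Set V) {P : Type} [CommMonoid P]
    (β : P →* Γ(V, ⊤)) : Prop where
  /-- The values of `β` belong to the logarithmic structure. -/
  invertible (p : P) : InvertibleOff D (β p)
  /-- Étale locally, any element of the logarithmic structure is a unit times a value of `β`. -/
  surj (W : Scheme.{0}) (e : W ⟶ V) (_ : Etale e) (w : W) (g : Γ(W, ⊤))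
    (hg : InvertibleOff (e ⁻¹' D) g) : ∃ (W' : W.Opens) (_ : w ∈ W') (p : P) (c : Γ(W, W')),
      IsUnit c ∧ resO (le_top : W' ≤ ⊤) g = c * resO (le_top : W' ≤ ⊤) (e.appTop (β p))
  /-- If two values of `β` differ by a unit at `v`, then the two elements of `P` differ by elements
  whose values are units at `v`. -/
  inj (v : V) (p q : P) (W : V.Opens) (hv : v ∈ W) (c : Γ(V, W)) (hc : IsUnit c)
    (h : resO (le_top : W ≤ ⊤) (β p) = c * resO (le_top : W ≤ ⊤) (β q)) :
    ∃ a b : P, v ∈ V.basicOpen (β a) ∧ v ∈ V.basicOpen (β b) ∧ p * a = q * b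

/-- The morphism `V ⟶ Spec ℤ[P]` given by a homomorphism `β : P → Γ(V, 𝒪)`. -/
def toMonoidSpec {V : Scheme.{0}} {P : Type} [CommMonoid P] (β : P →* Γ(V, ⊤)) :
    V ⟶ Spec (CommRingCat.of (MonoidAlgebra ℤ P)) :=
  V.toSpecΓ ≫ Spec.map (CommRingCat.ofHom (MonoidAlgebra.lift ℤ Γ(V, ⊤) P β).toRingHom)

/-- `f : (X, log Y) ⟶ (S, log Δ)` is logarithmically smooth (by the chart criterion, in
characteristic zero): étale locally on `X` and `S`, there is a chart of `f` by a homomorphism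
`h : P → Q` of fine monoids such that the kernel of `h` on groups is finite and the induced
morphism `U ⟶ V ×_{Spec ℤ[P]} Spec ℤ[Q]` is smooth. -/
def IsLogSmooth {X S : Scheme.{0}} (f : X ⟶ S) (Δ : Set S) (Y : Set X) : Prop :=
  ∀ x : X, ∃ (U V : Scheme.{0}) (a : U ⟶ X) (_ : Etale a) (u : U) (b : V ⟶ S) (_ : Etale b)
    (g : U ⟶ V) (P Q : Type) (_ : CancelCommMonoid P) (_ : CancelCommMonoid Q)
    (_ : Monoid.FG P) (_ : Monoid.FG Q)
    (β : P →* Γ(V, ⊤)) (γ : Q →* Γ(U, ⊤)) (h : P →* Q)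
    (c : U ⟶ pullback (toMonoidSpec β)
      (Spec.map (CommRingCat.ofHom (MonoidAlgebra.mapDomainRingHom ℤ h)))),
    a u = x ∧ g ≫ b = a ≫ f ∧
    IsLogChart (b ⁻¹' Δ) β ∧ IsLogChart (a ⁻¹' Y) γ ∧
    (∀ p, g.appTop (β p) = γ (h p)) ∧
    (∀ p q, h p = h q → ∃ n > 0, p ^ n = q ^ n) ∧
    c ≫ pullback.fst _ _ = g ∧ c ≫ pullback.snd _ _ = toMonoidSpec γ ∧
    Smooth c

/-- `f : X ⟶ S` is a flat family of normal crossing varieties of dimension `d`, the complex schemes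
`X` and `S` are smooth, `Δ ⊆ S` and `Y = f⁻¹(Δ) ⊆ X` are normal crossing divisors, `f` is smooth
outside `Y`, and `(X, log Y) ⟶ (S, log Δ)` is logarithmically smooth. -/
structure IsLogSmoothFamily {X S : Scheme.{0}} (f : X ⟶ S) (pS : S ⟶ Spec (CommRingCat.of ℂ))
    (Δ : Closeds S) (Y : Closeds X) (d : ℕ) : Prop where
  smooth_base : Smooth pS
  smooth_total : Smooth (f ≫ pS)
  flat : Flat f
  fibre (s : S) : IsClosed {s} → IsNCVariety d (f.fiber s)
  preimage : (Y : Set X) = f ⁻¹' Δ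
  nc_base : IsNCDivisor S Δ
  nc_total : IsNCDivisor X Y
  smooth_compl : Smooth (f ∣_ Δ.compl)
  log_smooth : IsLogSmooth f Δ Y

end Geometry

end LogHeat

end

/-!
A heat operator over a logarithmic vector field `θ` of the base is a section of `f_*𝒲_{X/S}(L)`
with two prescribed symbols: `f^*θ` in the direction of the base and `ρ(θ)` in
`S²T_{X/S}(log Y)`. Everything follows from exact sequences which describe `𝒲_{X/S}(L)` through
these two symbols, and from chasing their connecting morphisms.

*The exact sequences.* An operator of `𝒲_{X/S}(L)` both of whose symbols vanish is a first order
operator relative to `S` (`mem_of_symbols_eq_zero`). On a trivialisation of `L` every logarithmic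
derivation, and every product of two of them, is the symbol of an operator, so that `𝒟¹_{X/S}(L)` is
an extension of `T_{X/S}(log Y)` by `𝒪_X` (`sigma1_shortExact`) and `𝒟²_{X/S}(L)` is an extension
of `S²T_{X/S}(log Y)` by `𝒟¹_{X/S}(L)` (`symb2_shortExact`). The geometry is contained in the
surjectivity of `T_X(log Y) ⟶ f^*T_S(log Δ)` (`toBase_shortExact`, `symbBase_shortExact`), that is,
in the local lifting of logarithmic derivations of `S` to `X` (`exists_lift_logDer`).

*Lifting logarithmic derivations.* Work in the local ring at a point, with a logarithmically smooth
chart given by `P → Q`. The logarithmic derivatives of `θ` form a character of the monoid `P`; as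
the kernel of `P → Q` is torsion and the local rings are vector spaces over `ℚ`, it extends to `Q`
(`exists_character_extension`). This datum is a point of `V ×_{Spec ℤ[P]} Spec ℤ[Q]` with values in
the dual numbers of the local ring, and the smoothness of `U ⟶ V ×_{Spec ℤ[P]} Spec ℤ[Q]` gives the
derivation (`exists_derivation_lift`). It descends along the étale map `U ⟶ X`, because a local
ring is a direct summand of the finitely generated submodules of a flat local extension which
contain it (`exists_derivation_retraction`), and it extends from the stalk to a neighbourhood
(`exists_extension`).

That the result is logarithmic has to be checked against all functions which are invertible outside
the divisor. It suffices to check it on one local equation (`dvd_of_invertible_off`): étale locally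
the divisor is cut out by finitely many primes `zᵢ`, a function invertible outside the divisor
divides a power of `∏ zᵢ`, and in characteristic zero a derivation for which one equation is logarithmic
is logarithmic for each `zᵢ`. Such equations exist on `X` itself (`exists_equation`), by étale descent
of the vanishing ideal in the local ring. The stalks of smooth schemes are domains
(`isDomain_of_formallySmooth`), so divisibility of functions may be tested on germs.

*Existence and uniqueness.* The obstruction to lifting `(f^*θ, ρ(θ))` to `f_*𝒲_{X/S}(L)` lies in
`R¹f_*𝒟¹_{X/S}(L)`, and its image in `R¹f_*T_{X/S}(log Y)` is `κ(θ) + μ(ρ(θ)) = 0`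
(`connecting_symbBase`). Thus there is a local lift to `f_*(𝒲_{X/S}(L) / 𝒪_X)`. The remaining
obstruction in `R¹f_*𝒪_X` is removed by a section of `f_*T_{X/S}(log Y)`, since `∪[L]` is surjective
(`exists_lift_of_obstruction_eq_zero`, `exists_local_heat`). As `∪[L]` is injective, no nonzero
section of `f_*T_{X/S}(log Y)` lifts to an operator on `L`; with `f_*𝒪_X = 𝒪_S`, the operators with
zero symbols are the functions on the base (`exists_baseHeat_eq`). So local lifts are unique modulo
`𝒪_S` and glue (`eq_zero_of_heatSymb`, `exists_lift_pair`). The Leibniz rule for the action on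
`f_*L` is the condition on the symbol in the direction of the base
(`isProjConnection_of_isProjHeat`).
-/

noncomputable section

namespace LogHeat

/-! ### Local rings of smooth algebras -/

section SmoothLocal

open scoped TensorProduct

/-- A local ring which is a localization of an étale algebra over an integrally closed domain is a
domain: the idempotents of the étale algebra over the fraction field are integral, so they are
already defined over the étale algebra. -/
lemma isDomain_of_etale_of_isLocalization {P S B : Type} [CommRing P] [IsDomain P]
    [IsIntegrallyClosed P] [CommRing S] [Algebra P S] [Algebra.Etale P S] [CommRing B]
    [IsLocalRing B] [Algebra S B] (M : Submonoid S) [IsLocalization M B] : IsDomain B := by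
  classical
  -- Over the fraction field `K` of `P`, the étale algebra `S` becomes a product of fields `L i`,
  -- and `S` embeds into this product by flatness.
  let K := FractionRing P
  let T := S ⊗[P] K
  let e0 : K ⊗[P] S ≃ₐ[P] T := Algebra.TensorProduct.comm P K S
  let : Algebra K T := Algebra.TensorProduct.rightAlgebra
  obtain ⟨I, _, L, _, _, e, -⟩ := (Algebra.Etale.iff_exists_algEquiv_prod K (K ⊗[P] S)).1
    inferInstance
  let ψ : T ≃+* Π i, L i := e0.symm.toRingEquiv.trans e.toRingEquiv
  let j : S →+* Π i, L i := ψ.toRingHom.comp (algebraMap S T)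
  have hj : Function.Injective j := by
    refine ψ.injective.comp ?_
    exact Algebra.TensorProduct.includeLeft_injective (S := P)
      (FaithfulSMul.algebraMap_injective P K)
  -- `S` is integrally closed in `T`, as `P` is integrally closed in `K` and `S` is smooth over `P`.
  have hint : ∀ x : T, IsIntegral S x → ∃ s : S, algebraMap S T s = x := by
    intro x hx
    obtain ⟨y, hy⟩ := (TensorProduct.toIntegralClosure_bijective_of_smooth (R := P) (S := S)
      (B := K)).2 ⟨x, hx⟩
    have hy' : Algebra.TensorProduct.map (.id S S) (integralClosure P K).val y = x :=
      congrArg Subtype.val hy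
    rw [← hy']
    clear hy hy' hx
    induction y with
    | zero => exact ⟨0, by simp⟩
    | add y z hy hz =>
      obtain ⟨s, hs⟩ := hy
      obtain ⟨t, ht⟩ := hz
      exact ⟨s + t, by rw [map_add, map_add, hs, ht]⟩
    | tmul s y =>
      obtain ⟨p, hp⟩ := IsIntegrallyClosed.isIntegral_iff.1 (show IsIntegral P (y : K) from y.2)
      refine ⟨p • s, ?_⟩
      rw [Algebra.TensorProduct.map_tmul]
      have h1 : (algebraMap P K p) = p • (1 : K) := Algebra.algebraMap_eq_smul_one p
      simp only [AlgHom.coe_id, id_eq, Subalgebra.coe_val, ← hp, h1]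
      exact TensorProduct.smul_tmul p s (1 : K)
  -- The idempotents of the product are integral, hence they come from `S`.
  have hE : ∀ i, ∃ s : S, j s = Pi.single i 1 := by
    intro i
    obtain ⟨s, hs⟩ := hint (ψ.symm (Pi.single i 1)) (by
      refine ⟨Polynomial.X * (Polynomial.X - 1), ?_, ?_⟩
      · exact Polynomial.monic_X.mul (Polynomial.monic_X_sub_C 1)
      · rw [Polynomial.eval₂_mul, Polynomial.eval₂_sub, Polynomial.eval₂_X, Polynomial.eval₂_one,
          mul_sub, ← map_mul, ← Pi.single_mul]
        simp)
    exact ⟨s, by simp [j, hs]⟩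
  choose E hE using hE
  have := Fintype.ofFinite I
  have hone : ∑ i, E i = 1 := by
    apply hj
    rw [map_sum, map_one]
    simp only [hE]
    exact Finset.univ_sum_single (1 : Π i, L i)
  -- The idempotents have sum one, so one of them is a unit in the local ring `B`; then an element
  -- of `S` vanishes in `B` if and only if its component in the corresponding field `L i` vanishes.
  obtain ⟨i, hi⟩ : ∃ i, IsUnit (algebraMap S B (E i)) := by
    by_contra! hcon
    have h1 : algebraMap S B (∑ i, E i) ∈ IsLocalRing.maximalIdeal B := by
      rw [map_sum]
      exact Ideal.sum_mem _ fun i _ => (IsLocalRing.mem_maximalIdeal _).2 (hcon i)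
    rw [hone, map_one] at h1
    exact (Ideal.ne_top_iff_one _).1 (IsLocalRing.maximalIdeal.isMaximal B).ne_top h1
  have hzero : ∀ s : S, j s i = 0 → algebraMap S B s = 0 := by
    intro s hs
    have : E i * s = 0 := by
      apply hj
      rw [map_mul, map_zero, hE]
      ext k
      by_cases hk : k = i
      · subst hk; simp [hs]
      · simp [hk]
    have := congrArg (algebraMap S B) this
    rw [map_mul, map_zero] at this
    exact (hi.mul_right_eq_zero).1 this
  have hnon : ∀ s : S, algebraMap S B s = 0 → j s i = 0 := by
    intro s hs
    obtain ⟨m, hm⟩ := (IsLocalization.map_eq_zero_iff M B s).1 hs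
    have hmi : j m i ≠ 0 := fun h =>
      (IsLocalization.map_units B m).ne_zero (hzero _ h)
    have := congrFun (congrArg j hm) i
    rw [map_mul, map_zero, Pi.mul_apply, Pi.zero_apply] at this
    exact (mul_eq_zero.1 this).resolve_left hmi
  have : NoZeroDivisors B := by
    refine ⟨fun {a b} hab => ?_⟩
    obtain ⟨a, m, rfl⟩ := IsLocalization.exists_mk'_eq M a
    obtain ⟨b, n, rfl⟩ := IsLocalization.exists_mk'_eq M b
    simp only [← IsLocalization.mk'_mul, IsLocalization.mk'_eq_zero_iff] at hab ⊢
    obtain ⟨c, hc⟩ := hab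
    have := hnon (a * b) ((IsLocalization.map_eq_zero_iff M B _).2 ⟨c, hc⟩)
    rw [map_mul, Pi.mul_apply, mul_eq_zero] at this
    exact this.imp (fun h => (IsLocalization.map_eq_zero_iff M B _).1 (hzero _ h))
      (fun h => (IsLocalization.map_eq_zero_iff M B _).1 (hzero _ h))
  exact IsDomain.mk

/-- The local rings of smooth schemes over a field are domains. -/
theorem isDomain_of_formallySmooth (K : Type) {B : Type} [Field K] [CommRing B] [IsLocalRing B]
    [Algebra K B] [Algebra.EssFiniteType K B] [Algebra.FormallySmooth K B] : IsDomain B := by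
  let A := Algebra.EssFiniteType.subalgebra K B
  let p : Ideal A := (IsLocalRing.maximalIdeal B).comap (algebraMap A B)
  have hp : Algebra.EssFiniteType.submonoid K B = p.primeCompl := by
    ext a
    change IsUnit (algebraMap A B a) ↔ ¬ (algebraMap A B a ∈ IsLocalRing.maximalIdeal B)
    simp
  have hloc : IsLocalization.AtPrime B p := by
    have := Algebra.EssFiniteType.isLocalization K B
    rw [hp] at this
    exact this
  have : Algebra.FinitePresentation K A := Algebra.FinitePresentation.of_finiteType.1 inferInstance
  have : Algebra.IsSmoothAt K p :=
    Algebra.FormallySmooth.of_equiv ((IsLocalization.algEquiv p.primeCompl B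
      (Localization.AtPrime p)).restrictScalars K)
  -- Near a point, a smooth algebra is étale over a polynomial ring, which is integrally closed.
  obtain ⟨f, hf, n, _, _, _⟩ := Algebra.IsSmoothAt.exists_isStandardEtale_mvPolynomial
    (R := K) (p := p)
  let S := Localization.Away f
  have hfu : IsUnit (algebraMap A B f) := by
    by_contra h
    exact hf ((IsLocalRing.mem_maximalIdeal _).2 h)
  let : Algebra S B := (IsLocalization.Away.lift f hfu).toAlgebra
  have : IsScalarTower A S B := IsScalarTower.of_algebraMap_eq fun a =>
    (IsLocalization.Away.lift_eq f hfu a).symm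
  have := IsLocalization.isLocalization_of_submonoid_le S B (.powers f) p.primeCompl (by
    rw [Submonoid.powers_le]; exact hf)
  exact isDomain_of_etale_of_isLocalization (P := MvPolynomial (Fin n) K) (S := S)
    (p.primeCompl.map (algebraMap A S))

end SmoothLocal

/-! ### Derivations and normal crossing equations in smooth local rings -/

section Frames

open scoped TensorProduct

/-- Functions `z` in the maximal ideal of a smooth local ring over a perfect field whose classes in
the cotangent space are linearly independent admit dual derivations modulo the maximal ideal. -/
lemma exists_dual_derivation (K : Type) {B : Type} [Field K] [PerfectField K] [CommRing B]
    [IsLocalRing B] [Algebra K B] [Algebra.EssFiniteType K B] [Algebra.FormallySmooth K B]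
    {ι : Type} [DecidableEq ι] (z : ι → B) (hz : ∀ i, z i ∈ IsLocalRing.maximalIdeal B)
    (hlin : LinearIndependent (IsLocalRing.ResidueField B) fun i =>
      (IsLocalRing.maximalIdeal B).toCotangent ⟨z i, hz i⟩) (i : ι) :
    ∃ d : Derivation K B B, ∀ j, d (z j) - (if i = j then 1 else 0) ∈
      IsLocalRing.maximalIdeal B := by
  classical
  let κ := IsLocalRing.ResidueField B
  let m := IsLocalRing.maximalIdeal B
  have : Algebra.EssFiniteType K κ := .comp K B κ
  have : Algebra.FormallySmooth K κ := inferInstance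
  -- The residue field is smooth over the perfect field `K`, so `m / m²` is a direct summand of
  -- `κ ⊗ Ω`.
  obtain ⟨l, hl⟩ := (Algebra.FormallySmooth.iff_split_injection (R := K) (P := B) (A := κ)
    IsLocalRing.residue_surjective).1 inferInstance
  have hle : RingHom.ker (algebraMap B κ) ≤ m.comap (AlgHom.id B B) := by
    exact (IsLocalRing.ker_residue (R := B)).le
  let e := Ideal.mapCotangent (RingHom.ker (algebraMap B κ)) m (AlgHom.id B B) hle
  -- A functional on the cotangent space which is dual to the classes of the `z j`.
  obtain ⟨φ, hφ⟩ : ∃ φ : m.Cotangent →ₗ[κ] κ, ∀ j, φ (m.toCotangent ⟨z j, hz j⟩)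
      = if i = j then 1 else 0 := by
    obtain ⟨g, hg⟩ := LinearMap.exists_extend (p := Submodule.span κ (Set.range fun j =>
      m.toCotangent ⟨z j, hz j⟩)) ((Finsupp.lapply i) ∘ₗ hlin.repr)
    refine ⟨g, fun j => ?_⟩
    have := LinearMap.congr_fun hg ⟨m.toCotangent ⟨z j, hz j⟩, Submodule.subset_span ⟨j, rfl⟩⟩
    refine this.trans ?_
    have h2 := hlin.repr_eq_single j ⟨m.toCotangent ⟨z j, hz j⟩, Submodule.subset_span ⟨j, rfl⟩⟩ rfl
    change hlin.repr _ i = _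
    rw [h2, Finsupp.single_apply]
    simp [eq_comm]
  let ψ : Ω[B⁄K] →ₗ[B] κ := (φ.restrictScalars B) ∘ₗ e ∘ₗ l ∘ₗ (TensorProduct.mk B κ Ω[B⁄K] 1)
  -- It extends to `Ω`, with values in `κ`, and lifts to values in `B` as `Ω` is projective.
  obtain ⟨χ, hχ⟩ := Module.projective_lifting_property
    ((Algebra.linearMap B κ)) ψ IsLocalRing.residue_surjective
  refine ⟨χ.compDer (KaehlerDifferential.D K B), fun j => ?_⟩
  rw [← IsLocalRing.residue_eq_zero_iff, map_sub, sub_eq_zero]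
  have h1 : IsLocalRing.residue B (χ (KaehlerDifferential.D K B (z j)))
      = ψ (KaehlerDifferential.D K B (z j)) := LinearMap.congr_fun hχ _
  refine h1.trans ?_
  have hzk : z j ∈ RingHom.ker (algebraMap B κ) := by
    change IsLocalRing.residue B (z j) = 0
    exact (IsLocalRing.residue_eq_zero_iff _).2 (hz j)
  have h2 : l (1 ⊗ₜ KaehlerDifferential.D K B (z j))
      = (RingHom.ker (algebraMap B κ)).toCotangent ⟨z j, hzk⟩ :=
    LinearMap.congr_fun hl ((RingHom.ker (algebraMap B κ)).toCotangent ⟨z j, hzk⟩)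
  change φ (e (l (1 ⊗ₜ KaehlerDifferential.D K B (z j)))) = _
  rw [h2]
  refine (hφ j).trans ?_
  split_ifs <;> simp

/-- In a smooth local ring, a function in the maximal ideal with a unit derivative is prime: the
quotient is smooth. -/
lemma prime_of_derivation (K : Type) {B : Type} [Field K] [CommRing B]
    [IsLocalRing B] [Algebra K B] [Algebra.EssFiniteType K B] [Algebra.FormallySmooth K B]
    {z : B} (hz : z ∈ IsLocalRing.maximalIdeal B) (d : Derivation K B B) (hd : IsUnit (d z)) :
    Prime z := by
  have hz0 : z ≠ 0 := by
    rintro rfl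
    rw [map_zero] at hd
    exact not_isUnit_zero hd
  let I := Ideal.span {z}
  have hI : I ≠ ⊤ := fun h => by
    rw [Ideal.span_singleton_eq_top] at h
    exact (IsLocalRing.mem_maximalIdeal _).1 hz h
  have : Nontrivial (B ⧸ I) := Ideal.Quotient.nontrivial_iff.2 hI
  have : IsLocalRing (B ⧸ I) := .of_surjective' _ Ideal.Quotient.mk_surjective
  have hker : RingHom.ker (algebraMap B (B ⧸ I)) = I := Ideal.mk_ker
  have hzk : z ∈ RingHom.ker (algebraMap B (B ⧸ I)) := by
    rw [hker]; exact Ideal.mem_span_singleton_self z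
  obtain ⟨u, hu⟩ := hd
  let c := (RingHom.ker (algebraMap B (B ⧸ I))).toCotangent ⟨z, hzk⟩
  have hzc : ∀ a : B, (a * z) • c = 0 := by
    intro a
    rw [← LinearMap.map_smul, Ideal.toCotangent_eq_zero]
    rw [pow_two]
    exact Ideal.mul_mem_mul (Ideal.mul_mem_left _ _ hzk) hzk
  let t : (B ⧸ I) →ₗ[B] (RingHom.ker (algebraMap B (B ⧸ I))).Cotangent :=
    Submodule.liftQ I (LinearMap.toSpanSingleton B _ c) (by
      intro x hx
      obtain ⟨a, rfl⟩ := Ideal.mem_span_singleton'.1 hx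
      exact hzc a)
  -- The derivation `u⁻¹ d`, with `u = d z`, gives a left inverse of the conormal map
  -- `(z) / (z²) → (B / z) ⊗ Ω`.
  let lam : Ω[B⁄K] →ₗ[B] B := ((↑u⁻¹ : B) • d).liftKaehlerDifferential
  let l : (B ⧸ I) ⊗[B] Ω[B⁄K] →ₗ[B] (RingHom.ker (algebraMap B (B ⧸ I))).Cotangent :=
    t ∘ₗ (TensorProduct.rid B (B ⧸ I)).toLinearMap ∘ₗ lam.lTensor (B ⧸ I)
  have : Algebra.FormallySmooth K (B ⧸ I) := by
    refine (Algebra.FormallySmooth.iff_split_injection (R := K) (P := B) (A := B ⧸ I)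
      Ideal.Quotient.mk_surjective).2 ⟨l, ?_⟩
    ext x
    obtain ⟨⟨x, hx⟩, rfl⟩ := Ideal.toCotangent_surjective _ x
    obtain ⟨a, rfl⟩ := Ideal.mem_span_singleton'.1 (hker ▸ hx)
    have h1 : KaehlerDifferential.kerCotangentToTensor K B (B ⧸ I)
        (Ideal.toCotangent _ ⟨a * z, hx⟩) = 1 ⊗ₜ KaehlerDifferential.D K B (a * z) := rfl
    rw [LinearMap.comp_apply, h1, LinearMap.id_apply]
    change t (TensorProduct.rid B (B ⧸ I)
      ((1 : B ⧸ I) ⊗ₜ lam (KaehlerDifferential.D K B (a * z)))) = _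
    rw [TensorProduct.rid_tmul]
    have h2 : lam (KaehlerDifferential.D K B (a * z)) = a + (↑u⁻¹ * d a) * z := by
      change ((↑u⁻¹ : B) • d).liftKaehlerDifferential _ = _
      rw [Derivation.liftKaehlerDifferential_comp_D, Derivation.smul_apply, d.leibniz, ← hu]
      simp only [smul_eq_mul, mul_add]
      rw [mul_left_comm, Units.inv_mul]
      ring
    rw [h2, LinearMap.map_smul]
    have h3 : t 1 = c := one_smul B c
    rw [h3, add_smul, hzc, add_zero, ← LinearMap.map_smul]
    rfl
  have : IsDomain (B ⧸ I) := isDomain_of_formallySmooth K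
  exact (Ideal.span_singleton_prime hz0).1 ((Ideal.Quotient.isDomain_iff_prime I).1 this)

/-- If a derivation `D` satisfies `h ∣ D h`, then also `z ∣ D z` for each prime divisor `z` of
`h`, in characteristic zero. -/
lemma prime_dvd_derivation {B : Type} [CommRing B] [IsDomain B] [IsNoetherianRing B] [Algebra ℚ B]
    (D : Derivation ℤ B B) {z h : B} (hz : Prime z) (h0 : h ≠ 0) (hzh : z ∣ h) (hD : h ∣ D h) :
    z ∣ D z := by
  -- With `h = zⁿ r` and `z` prime to `r`, the term `n zⁿ⁻¹ r D z` of `D h` is divisible by `zⁿ`.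
  obtain ⟨r, hr, hzr⟩ := (FiniteMultiplicity.of_prime_left hz h0).exists_eq_pow_mul_and_not_dvd
  set n := multiplicity z h with hn
  have hn0 : n ≠ 0 := by
    intro h0
    rw [h0, pow_zero, one_mul] at hr
    exact hzr (hr ▸ hzh)
  obtain ⟨k, hk⟩ := Nat.exists_eq_succ_of_ne_zero hn0
  have h1 : z ^ n ∣ D h := (Dvd.intro _ hr.symm).trans hD
  rw [hr, D.leibniz, D.leibniz_pow, hk] at h1
  simp only [smul_eq_mul, Nat.succ_sub_one, Nat.succ_eq_add_one, nsmul_eq_mul] at h1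
  have h2 : z ^ (k + 1) ∣ z ^ k * (((k + 1 : ℕ) : B) * (r * D z)) := by
    have := (dvd_add_right (Dvd.intro (D r) rfl : z ^ (k + 1) ∣ z ^ (k + 1) * D r)).1 h1
    convert! this using 1
    simp; ring
  rw [pow_succ] at h2
  have h3 := (mul_dvd_mul_iff_left (pow_ne_zero k hz.ne_zero)).1 h2
  rcases hz.dvd_mul.1 h3 with h4 | h4
  -- `n = k + 1` is a unit in characteristic zero.
  · have : IsUnit (((k + 1 : ℕ) : B)) := by
      have := (IsUnit.mk0 ((k + 1 : ℕ) : ℚ) (by positivity)).map (algebraMap ℚ B)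
      simpa using this
    exact absurd (isUnit_of_dvd_unit h4 this) hz.not_isUnit
  · exact (hz.dvd_mul.1 h4).resolve_left hzr

/-- If `D` satisfies `z ∣ D z` for finitely many primes `z`, then `g ∣ D g` for each divisor `g` of
a product of powers of these primes. -/
lemma dvd_derivation_of_dvd_prod {B : Type} [CommRing B] [IsDomain B]
    (D : Derivation ℤ B B) {ι : Type} [Fintype ι] (z : ι → B) (hz : ∀ i, Prime (z i))
    (hD : ∀ i, z i ∣ D (z i)) {g : B} {N : ℕ} (hg : g ∣ (∏ i, z i) ^ N) : g ∣ D g := by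
  classical
  have hmul : ∀ a b : B, a ∣ D a → b ∣ D b → a * b ∣ D (a * b) := by
    rintro a b ⟨c, hc⟩ ⟨d, hd⟩
    refine ⟨c + d, ?_⟩
    rw [D.leibniz, hc, hd, smul_eq_mul, smul_eq_mul]
    ring
  obtain ⟨g', hg'⟩ := hg
  have h1 : g * g' = 1 * ∏ p ∈ (Finset.univ : Finset (ι × Fin N)), z p.1 := by
    rw [← hg', one_mul, Fintype.prod_prod_type, ← Finset.prod_pow]
    simp
  obtain ⟨t, u, b, c, -, -, hbc, rfl, -⟩ := mul_eq_mul_prime_prod (fun p _ => hz p.1) h1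
  refine hmul _ _ ((IsUnit.of_mul_eq_one c hbc.symm).dvd) ?_
  refine Finset.prod_induction (fun p : ι × Fin N => z p.1) (fun a => a ∣ D a) hmul (by simp) ?_
  exact fun p _ => hD p.1

end Frames

/-! ### Derivations and étale algebras -/

section Etale

open scoped TensorProduct

/-- A derivation with values in an algebra extends along a formally étale algebra. -/
lemma exists_derivation_extension (K : Type) {R B : Type} [CommRing K] [CommRing R] [CommRing B]
    [Algebra K R] [Algebra K B] [Algebra R B] [IsScalarTower K R B] [Algebra.FormallyEtale R B]
    (D : Derivation K R B) : ∃ D' : Derivation K B B, ∀ r, D' (algebraMap R B r) = D r := by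
  let e := KaehlerDifferential.tensorKaehlerEquivOfFormallyEtale K R B
  let l : B ⊗[R] Ω[R⁄K] →ₗ[B] B := D.liftKaehlerDifferential.liftBaseChange B
  refine ⟨(l ∘ₗ e.symm.toLinearMap).compDer (KaehlerDifferential.D K B), fun r => ?_⟩
  change l (e.symm (KaehlerDifferential.D K B (algebraMap R B r))) = D r
  rw [KaehlerDifferential.tensorKaehlerEquivOfFormallyEtale_symm_D_algebraMap]
  simp [l]

/-- A ring which is étale over a reduced Noetherian ring is reduced. -/
lemma isReduced_of_formallyUnramified (R B : Type) [CommRing R] [CommRing B]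
    [Algebra R B] [IsNoetherianRing R] [IsReduced R] [Module.Flat R B]
    [Algebra.EssFiniteType R B] [Algebra.FormallyUnramified R B] : IsReduced B := by
  classical
  have hprime : ∀ p : minimalPrimes R, p.1.IsPrime := fun p => p.2.1.1
  have := (minimalPrimes.finite_of_isNoetherianRing R).fintype
  let κ : minimalPrimes R → Type := fun p => FractionRing (R ⧸ p.1)
  -- `R` embeds into a product of fields, so that by flatness `B` embeds into a product of étale
  -- algebras over fields.
  let j : R →ₗ[R] Π p, κ p := LinearMap.pi fun p => Algebra.linearMap R (κ p)
  have hj : Function.Injective j := by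
    rw [← LinearMap.ker_eq_bot, eq_bot_iff]
    intro r hr
    have : r ∈ sInf (minimalPrimes R) := by
      rw [Submodule.mem_sInf]
      intro p hp
      have h1 : algebraMap R (κ ⟨p, hp⟩) r = 0 := congrFun hr ⟨p, hp⟩
      rw [IsScalarTower.algebraMap_apply R (R ⧸ p)] at h1
      exact Ideal.Quotient.eq_zero_iff_mem.1
        ((map_eq_zero_iff _ (IsFractionRing.injective (R ⧸ p) (FractionRing (R ⧸ p)))).1 h1)
    rw [show sInf (minimalPrimes R) = nilradical R from Ideal.sInf_minimalPrimes] at this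
    exact (mem_nilradical.1 this).eq_zero
  refine ⟨fun b hb => ?_⟩
  have hinj := (TensorProduct.piRight R R B κ).injective.comp
    ((Module.Flat.lTensor_preserves_injective_linearMap (M := B) j hj).comp
      (TensorProduct.rid R B).symm.injective)
  apply hinj
  ext p
  have h1 : (TensorProduct.piRight R R B κ ∘ (j.lTensor B) ∘ (TensorProduct.rid R B).symm) b p
      = b ⊗ₜ 1 := by
    simp [j]
  have h0 : (TensorProduct.piRight R R B κ ∘ (j.lTensor B) ∘ (TensorProduct.rid R B).symm) 0 p
      = 0 := by simp
  rw [h1, h0]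
  have hp := hprime p
  let : Field (κ p) := inferInstanceAs (Field (FractionRing (R ⧸ p.1)))
  have : IsReduced (κ p ⊗[R] B) :=
    Algebra.FormallyUnramified.isReduced_of_field (κ p) (κ p ⊗[R] B)
  have h2 : IsNilpotent (1 ⊗ₜ b : κ p ⊗[R] B) :=
    hb.map (Algebra.TensorProduct.includeRight (R := R) (A := κ p) (B := B))
  exact (TensorProduct.comm R (κ p) B).symm.injective (by
    rw [TensorProduct.comm_symm_tmul, h2.eq_zero, map_zero])

/-- The extension of a radical ideal to an étale algebra is a radical ideal. -/
lemma isRadical_map_of_formallyUnramified {R B : Type} [CommRing R] [CommRing B]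
    [Algebra R B] [IsNoetherianRing R] [Module.Flat R B]
    [Algebra.EssFiniteType R B] [Algebra.FormallyUnramified R B] {I : Ideal R} (hI : I.IsRadical) :
    (I.map (algebraMap R B)).IsRadical := by
  rw [Ideal.isRadical_iff_quotient_reduced] at hI ⊢
  have := isReduced_of_formallyUnramified (R ⧸ I) ((R ⧸ I) ⊗[R] B)
  exact isReduced_of_injective (Algebra.TensorProduct.quotIdealMapEquivQuotTensor B I).toRingEquiv
    (Algebra.TensorProduct.quotIdealMapEquivQuotTensor B I).toRingEquiv.injective

/-- A radical ideal of a Noetherian local ring is principal if it becomes the radical of a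
principal ideal `(z)`, with `(z)` radical, after a local étale extension to a domain. -/
lemma exists_generator_of_etale {R B : Type} [CommRing R] [CommRing B] [IsLocalRing R]
    [IsLocalRing B] [IsDomain B] [Algebra R B] [IsLocalHom (algebraMap R B)] [IsNoetherianRing R]
    [Module.Flat R B] [Algebra.EssFiniteType R B] [Algebra.FormallyUnramified R B] {I : Ideal R}
    (hI : I.IsRadical) {z : B} (hz : (Ideal.span {z}).IsRadical)
    (h : (I.map (algebraMap R B)).radical = (Ideal.span {z}).radical) (hz0 : z ≠ 0) :
    ∃ a ∈ I, I = Ideal.span {a} := by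
  have hIB : I.map (algebraMap R B) = Ideal.span {z} := by
    rw [← (isRadical_map_of_formallyUnramified (B := B) hI).radical, h, hz.radical]
  have : Module.FaithfullyFlat R B := Module.FaithfullyFlat.of_flat_of_isLocalHom
  -- The quotients `a / z`, for `a` in `I`, generate the unit ideal, so one of them is a unit.
  obtain ⟨a, haI, c, hc, hca⟩ : ∃ a ∈ I, ∃ c : B, IsUnit c ∧ algebraMap R B a = c * z := by
    by_contra! hcon
    have h1 : I.map (algebraMap R B) ≤ IsLocalRing.maximalIdeal B * Ideal.span {z} := by
      rw [Ideal.map_le_iff_le_comap]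
      intro a ha
      have : algebraMap R B a ∈ Ideal.span {z} := hIB ▸ Ideal.mem_map_of_mem _ ha
      obtain ⟨c, hc⟩ := Ideal.mem_span_singleton'.1 this
      rw [Ideal.mem_comap, ← hc]
      refine Ideal.mul_mem_mul ?_ (Ideal.mem_span_singleton_self z)
      exact (IsLocalRing.mem_maximalIdeal _).2 fun hu => hcon a ha c hu hc.symm
    have h2 := h1 (hIB ▸ Ideal.mem_span_singleton_self z : z ∈ I.map (algebraMap R B))
    rw [Ideal.mem_mul_span_singleton] at h2
    obtain ⟨m, hm, hmz⟩ := h2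
    have : m = 1 := mul_right_cancel₀ hz0 (by rw [hmz, one_mul])
    exact (Ideal.ne_top_iff_one _).1 (IsLocalRing.maximalIdeal.isMaximal B).ne_top (this ▸ hm)
  refine ⟨a, haI, ?_⟩
  have h3 : (Ideal.span {a}).map (algebraMap R B) = I.map (algebraMap R B) := by
    rw [hIB, Ideal.map_span, Set.image_singleton, hca]
    exact Ideal.span_singleton_mul_left_unit hc z
  rw [← Ideal.comap_map_eq_self_of_faithfullyFlat (B := B) I, ← h3,
    Ideal.comap_map_eq_self_of_faithfullyFlat]

/-- Divisibility descends along flat local homomorphisms. -/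
lemma dvd_of_algebraMap_dvd {R B : Type} [CommRing R] [CommRing B] [IsLocalRing R]
    [IsLocalRing B] [Algebra R B] [IsLocalHom (algebraMap R B)] [Module.Flat R B] {a b : R}
    (h : algebraMap R B a ∣ algebraMap R B b) : a ∣ b := by
  have : Module.FaithfullyFlat R B := Module.FaithfullyFlat.of_flat_of_isLocalHom
  rw [← Ideal.mem_span_singleton, ← Ideal.comap_map_eq_self_of_faithfullyFlat (B := B)
    (Ideal.span {a}), Ideal.mem_comap, Ideal.map_span, Set.image_singleton]
  exact Ideal.mem_span_singleton.2 h

/-- If `B` is a flat local algebra over a Noetherian local ring `R`, then `R` is a direct summand of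
each finitely generated submodule of `B` which contains it. -/
lemma exists_retraction {R B : Type} [CommRing R] [CommRing B] [IsLocalRing R]
    [IsLocalRing B] [Algebra R B] [IsLocalHom (algebraMap R B)] [IsNoetherianRing R]
    [Module.Flat R B] (M : Submodule R B) (hM : M.FG) (h1 : (1 : B) ∈ M) :
    ∃ π : M →ₗ[R] R, π ⟨1, h1⟩ = 1 := by
  have : Module.Finite R M := Module.Finite.of_fg hM
  have : Module.FinitePresentation R M := Module.finitePresentation_of_finite R M
  -- By flatness, `M → B` factors through a free module of finite rank. Some coordinate of `1` there
  -- is a unit, since otherwise the image of `1` in `B` would lie in the maximal ideal.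
  obtain ⟨k, u, v, huv⟩ := Module.Flat.exists_factorization_of_finitePresentation M.subtype
  obtain ⟨i, hi⟩ : ∃ i, IsUnit (u ⟨1, h1⟩ i) := by
    by_contra! hcon
    have h2 : v (u ⟨1, h1⟩) = 1 := (LinearMap.congr_fun huv ⟨1, h1⟩).symm
    have h3 : v (u ⟨1, h1⟩) ∈ IsLocalRing.maximalIdeal B := by
      rw [← Finsupp.univ_sum_single (u ⟨1, h1⟩), map_sum]
      refine Ideal.sum_mem _ fun i _ => ?_
      rw [← mul_one (u ⟨1, h1⟩ i), ← smul_eq_mul, ← Finsupp.smul_single, map_smul,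
        Algebra.smul_def]
      refine Ideal.mul_mem_right _ _ ?_
      exact (IsLocalRing.mem_maximalIdeal _).2 fun h => hcon i (isUnit_of_map_unit _ _ h)
    rw [h2] at h3
    exact (Ideal.ne_top_iff_one _).1 (IsLocalRing.maximalIdeal.isMaximal B).ne_top h3
  obtain ⟨w, hw⟩ := hi
  refine ⟨(↑w⁻¹ : R) • ((Finsupp.lapply i) ∘ₗ u), ?_⟩
  change (↑w⁻¹ : R) • (u ⟨1, h1⟩ i) = 1
  rw [← hw, smul_eq_mul, Units.inv_mul]

/-- A derivation `D` of a flat local algebra `B` over `R` induces a derivation `D'` of `R`, by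
composing it with a retraction to `R` of a finitely generated submodule of `B`. It keeps the values
of `D` which lie in `R`, and it is logarithmic for `h` if `D` is so with logarithmic
derivative `t`. -/
lemma exists_derivation_retraction (K : Type) {R B : Type} [Field K] [CommRing R] [CommRing B]
    [IsLocalRing R] [IsLocalRing B] [Algebra K R] [Algebra K B] [Algebra R B] [IsScalarTower K R B]
    [IsLocalHom (algebraMap R B)] [IsNoetherianRing R] [Module.Flat R B]
    [Algebra.EssFiniteType K R] (D : Derivation K B B) (t : B) :
    ∃ D' : Derivation K R R,
      (∀ a b : R, D (algebraMap R B a) = algebraMap R B b → D' a = b) ∧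
      ∀ h : R, D (algebraMap R B h) = algebraMap R B h * t → h ∣ D' h := by
  let D0 : Derivation K R B := D.compAlgebraMap R
  have hD0 : ∀ a, D0 a = D (algebraMap R B a) := fun _ => rfl
  let M : Submodule R B := LinearMap.range D0.liftKaehlerDifferential ⊔ Submodule.span R {1, t}
  have hM : M.FG := Submodule.FG.sup
    (LinearMap.range_eq_map D0.liftKaehlerDifferential ▸ Module.Finite.fg_top.map _)
    (Submodule.fg_span (by simp))
  have h1 : (1 : B) ∈ M := Submodule.mem_sup_right (Submodule.subset_span (by simp))
  have ht : t ∈ M := Submodule.mem_sup_right (Submodule.subset_span (by simp))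
  have hDM : ∀ a, D0 a ∈ M := fun a => Submodule.mem_sup_left
    ⟨KaehlerDifferential.D K R a, Derivation.liftKaehlerDifferential_comp_D _ _⟩
  obtain ⟨π, hπ⟩ := exists_retraction M hM h1
  let l : Ω[R⁄K] →ₗ[R] R := π ∘ₗ (LinearMap.codRestrict M D0.liftKaehlerDifferential
    fun x => Submodule.mem_sup_left ⟨x, rfl⟩)
  have hl : ∀ a, (l.compDer (KaehlerDifferential.D K R)) a = π ⟨D0 a, hDM a⟩ := by
    intro a
    change π ⟨_, _⟩ = _
    congr 2
    exact Derivation.liftKaehlerDifferential_comp_D _ _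
  refine ⟨l.compDer (KaehlerDifferential.D K R), fun a b hab => ?_, fun h hh => ?_⟩
  · rw [hl]
    have : (⟨D0 a, hDM a⟩ : M) = b • ⟨1, h1⟩ := Subtype.ext (by
      change D0 a = b • (1 : B)
      rw [hD0, hab, Algebra.algebraMap_eq_smul_one])
    rw [this, map_smul, hπ, smul_eq_mul, mul_one]
  · rw [hl]
    have : (⟨D0 h, hDM h⟩ : M) = h • ⟨t, ht⟩ := Subtype.ext (by
      change D0 h = h • t
      rw [hD0, hh, Algebra.smul_def])
    rw [this, map_smul, smul_eq_mul]
    exact dvd_mul_right _ _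

end Etale

/-! ### Extension of characters of monoids -/

section Monoids

/-- Let `h : P → Q` be a homomorphism of cancellative commutative monoids with torsion kernel on
groups. Then an additive character of `P` in a vector space over `ℚ` extends to `Q`. -/
lemma exists_character_extension {P Q V : Type} [CancelCommMonoid P] [CancelCommMonoid Q]
    [AddCommGroup V] [Module ℚ V] (h : P →* Q)
    (hker : ∀ p q, h p = h q → ∃ n > 0, p ^ n = q ^ n) (τ : P →* Multiplicative V) :
    ∃ τ' : Q →* Multiplicative V, ∀ p, τ' (h p) = τ p := by
  -- `τ` is trivial on the kernel of `h`, which is torsion, as `V` has no torsion.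
  have hτ : ∀ p q, h p = h q → τ p = τ q := by
    intro p q hpq
    obtain ⟨n, hn, e⟩ := hker p q hpq
    have h1 : n • (τ p).toAdd = n • (τ q).toAdd := by
      rw [← toAdd_pow, ← toAdd_pow, ← map_pow, ← map_pow, e]
    rw [← Nat.cast_smul_eq_nsmul ℚ, ← Nat.cast_smul_eq_nsmul ℚ] at h1
    exact Multiplicative.toAdd.injective
      ((smul_right_injective V (Nat.cast_ne_zero.2 hn.ne' : (n : ℚ) ≠ 0)) h1)
  let PG := Algebra.GrothendieckGroup P
  let QG := Algebra.GrothendieckGroup Q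
  let τG : PG →* Multiplicative V := Algebra.GrothendieckGroup.lift τ
  let hG : PG →* QG := Algebra.GrothendieckGroup.lift (Algebra.GrothendieckGroup.of.comp h)
  have hfrac : ∀ x : PG, ∃ p q : P, x = Algebra.GrothendieckGroup.of p /
      Algebra.GrothendieckGroup.of q := by
    intro x
    obtain ⟨⟨p, q⟩, hpq⟩ := (Localization.monoidOf (⊤ : Submonoid P)).surj x
    exact ⟨p, q, eq_div_of_mul_eq' hpq⟩
  have hof : ∀ p, τG (Algebra.GrothendieckGroup.of p) = τ p := fun p =>
    DFunLike.congr_fun (Algebra.GrothendieckGroup.lift.symm_apply_apply τ) p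
  have hof' : ∀ p, hG (Algebra.GrothendieckGroup.of p) = Algebra.GrothendieckGroup.of (h p) :=
    fun p => DFunLike.congr_fun (Algebra.GrothendieckGroup.lift.symm_apply_apply
      (Algebra.GrothendieckGroup.of.comp h)) p
  have hle : hG.ker ≤ τG.ker := by
    intro x hx
    obtain ⟨p, q, rfl⟩ := hfrac x
    rw [MonoidHom.mem_ker, map_div, div_eq_one] at hx ⊢
    rw [hof', hof'] at hx
    rw [hof, hof]
    exact hτ _ _ (Algebra.GrothendieckGroup.of_injective hx)
  let i : Additive (PG ⧸ hG.ker) →+ Additive QG := (QuotientGroup.kerLift hG).toAdditive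
  let g : Additive (PG ⧸ hG.ker) →+ V :=
    MonoidHom.toAdditiveLeft (QuotientGroup.lift hG.ker τG hle)
  -- On the image of `h` the character is defined; it extends to the group of `Q` because the
  -- divisible group `V` is injective.
  let : DivisibleBy V ℤ :=
    { div := fun v n => (n : ℚ)⁻¹ • v
      div_zero := fun v => by simp
      div_cancel := fun {n} v hn => by
        rw [← Int.cast_smul_eq_zsmul ℚ, smul_smul, mul_inv_cancel₀ (Int.cast_ne_zero.2 hn),
          one_smul] }
  obtain ⟨k, hk⟩ := (Module.Baer.of_divisible V).extension_property_addMonoidHom i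
    (QuotientGroup.kerLift_injective hG) g
  refine ⟨(AddMonoidHom.toMultiplicativeRight k).comp Algebra.GrothendieckGroup.of, fun p => ?_⟩
  have h1 := DFunLike.congr_fun hk (Additive.ofMul
    ((Algebra.GrothendieckGroup.of p : PG) : PG ⧸ hG.ker))
  have h2 : i (Additive.ofMul ((Algebra.GrothendieckGroup.of p : PG) : PG ⧸ hG.ker))
      = Additive.ofMul (Algebra.GrothendieckGroup.of (h p)) := by
    change Additive.ofMul (hG (Algebra.GrothendieckGroup.of p)) = _
    rw [hof']
  have h3 : g (Additive.ofMul ((Algebra.GrothendieckGroup.of p : PG) : PG ⧸ hG.ker))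
      = (τ p).toAdd := by
    change (τG (Algebra.GrothendieckGroup.of p)).toAdd = _
    rw [hof]
  rw [AddMonoidHom.comp_apply, h2, h3] at h1
  exact h1

end Monoids

/-! ### Stalks of smooth complex schemes -/

/-- The complex constants in the local ring at a point of a complex scheme. -/
def constHom {X : Scheme.{0}} (q : X ⟶ Spec (CommRingCat.of ℂ)) (x : X) :
    ℂ →+* X.presheaf.stalk x :=
  (q.stalkMap x).hom.comp <| ((Spec (CommRingCat.of ℂ)).presheaf.germ ⊤ (q x) trivial).hom.comp
    (Scheme.ΓSpecIso (CommRingCat.of ℂ)).inv.hom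

lemma constHom_apply {X : Scheme.{0}} (q : X ⟶ Spec (CommRingCat.of ℂ)) (x : X) (c : ℂ) :
    constHom q x c = X.presheaf.germ ⊤ x trivial
      (q.appTop ((Scheme.ΓSpecIso (CommRingCat.of ℂ)).inv c)) :=
  Scheme.Hom.germ_stalkMap_apply q ⊤ x trivial _

lemma stalkMap_constHom {X V : Scheme.{0}} (a : V ⟶ X) (q : X ⟶ Spec (CommRingCat.of ℂ)) (v : V)
    (c : ℂ) : a.stalkMap v (constHom q (a v) c) = constHom (a ≫ q) v c := by
  rw [constHom_apply, constHom_apply, Scheme.Hom.germ_stalkMap_apply a ⊤ v trivial]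
  rfl

lemma germ_ΓSpecIso_formallySmooth_essFiniteType (R : CommRingCat.{0}) (p : Spec R) :
    ((((Spec R).presheaf.germ ⊤ p trivial).hom.comp (Scheme.ΓSpecIso R).inv.hom).FormallySmooth) ∧
    ((((Spec R).presheaf.germ ⊤ p trivial).hom.comp
      (Scheme.ΓSpecIso R).inv.hom).EssFiniteType) := by
  let p' : PrimeSpectrum R := p
  change (algebraMap R ((Spec.structureSheaf R).presheaf.stalk p')).FormallySmooth ∧
    (algebraMap R ((Spec.structureSheaf R).presheaf.stalk p')).EssFiniteType
  exact ⟨RingHom.formallySmooth_algebraMap.2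
    (Algebra.FormallySmooth.of_isLocalization p'.asIdeal.primeCompl),
    RingHom.essFiniteType_algebraMap.2
    (Algebra.EssFiniteType.of_isLocalization _ p'.asIdeal.primeCompl)⟩

lemma stalkMap_formallySmooth {X V : Scheme.{0}} (a : V ⟶ X) [Smooth a] (v : V) :
    (a.stalkMap v).hom.FormallySmooth := by
  rw [← Scheme.Hom.mem_smoothLocus, a.smoothLocus_eq_top]; trivial

lemma constHom_formallySmooth {X : Scheme.{0}} (q : X ⟶ Spec (CommRingCat.of ℂ)) [Smooth q]
    (x : X) : (constHom q x).FormallySmooth :=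
  (germ_ΓSpecIso_formallySmooth_essFiniteType _ (q x)).1.comp (stalkMap_formallySmooth q x)

lemma constHom_essFiniteType {X : Scheme.{0}} (q : X ⟶ Spec (CommRingCat.of ℂ)) [Smooth q]
    (x : X) : (constHom q x).EssFiniteType :=
  (germ_ΓSpecIso_formallySmooth_essFiniteType _ (q x)).2.comp (LocallyOfFiniteType.stalkMap q x)

lemma stalkMap_formallyEtale {X V : Scheme.{0}} (a : V ⟶ X) [Etale a] (v : V) :
    (a.stalkMap v).hom.FormallyEtale := by
  have h1 := stalkMap_formallySmooth a v
  have h2 := FormallyUnramified.stalkMap a v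
  algebraize [(a.stalkMap v).hom]
  exact RingHom.formallyEtale_algebraMap.2
    (Algebra.FormallyEtale.iff_formallyUnramified_and_formallySmooth.2
      ⟨inferInstance, inferInstance⟩)

lemma stalk_isNoetherianRing {X : Scheme.{0}} (q : X ⟶ Spec (CommRingCat.of ℂ)) [Smooth q]
    (x : X) : IsNoetherianRing (X.presheaf.stalk x) := by
  have h := constHom_essFiniteType q x
  algebraize [constHom q x]
  exact Algebra.EssFiniteType.isNoetherianRing ℂ _

lemma stalk_isDomain {X : Scheme.{0}} (q : X ⟶ Spec (CommRingCat.of ℂ)) [Smooth q]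
    (x : X) : IsDomain (X.presheaf.stalk x) := by
  have h := constHom_essFiniteType q x
  have h' := constHom_formallySmooth q x
  algebraize [constHom q x]
  exact isDomain_of_formallySmooth ℂ

/-! ### Local equations of normal crossing divisors -/

lemma fromSpecStalk_mem {T : Scheme.{0}} {t : T} {N : T.Opens} (ht : t ∈ N)
    (p : PrimeSpectrum (T.presheaf.stalk t)) : T.fromSpecStalk t p ∈ N := by
  have h : T.fromSpecStalk t p ∈ Set.range (T.fromSpecStalk t) := ⟨p, rfl⟩
  rw [Scheme.range_fromSpecStalk] at h
  exact Specializes.mem_open h N.2 ht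

lemma fromSpecStalk_mem_basicOpen {T : Scheme.{0}} {t : T} {N : T.Opens} (ht : t ∈ N) (g : Γ(T, N))
    (p : PrimeSpectrum (T.presheaf.stalk t)) :
    T.fromSpecStalk t p ∈ T.basicOpen g ↔ T.presheaf.germ N t ht g ∉ p.asIdeal := by
  have h1 : T.fromSpecStalk t p ∈ T.basicOpen g ↔ p ∈ T.fromSpecStalk t ⁻¹ᵁ T.basicOpen g :=
    Iff.rfl
  rw [h1, Scheme.preimage_basicOpen, Scheme.fromSpecStalk_app ht]
  simp only [CommRingCat.comp_apply]
  rw [Scheme.basicOpen_res, basicOpen_eq_of_affine]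
  exact ⟨fun h => h.2, fun h => ⟨fromSpecStalk_mem ht p, h⟩⟩

/-- A form of the Nullstellensatz for the local ring at a point. -/
lemma exists_germ_pow_mem {T : Scheme.{0}} {t : T} {N : T.Opens} (ht : t ∈ N) (J : Set Γ(T, N))
    (f : Γ(T, N)) (h : ∀ w ∈ N, (∀ j ∈ J, w ∉ T.basicOpen j) → w ∉ T.basicOpen f) :
    ∃ n : ℕ, T.presheaf.germ N t ht f ^ n ∈ Ideal.span (T.presheaf.germ N t ht '' J) := by
  change _ ∈ (Ideal.span (T.presheaf.germ N t ht '' J)).radical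
  rw [Ideal.radical_eq_sInf, Ideal.mem_sInf]
  rintro P ⟨hP, hP'⟩
  let p : PrimeSpectrum (T.presheaf.stalk t) := ⟨P, hP'⟩
  have := h (T.fromSpecStalk t p) (fromSpecStalk_mem ht p) fun j hj => by
    rw [fromSpecStalk_mem_basicOpen ht, not_not]
    exact hP (Ideal.subset_span ⟨j, hj, rfl⟩)
  rwa [fromSpecStalk_mem_basicOpen ht, not_not] at this

/-- In a Noetherian space, a closed set `Z` is contained in a closed set `Z'` near `x` if this holds
for the generizations of `x`. -/
lemma exists_isOpen_inter_subset {α : Type} [TopologicalSpace α] [QuasiSober α] [NoetherianSpace α]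
    {Z Z' : Set α} (hZ : IsClosed Z) (hZ' : IsClosed Z') (x : α)
    (h : ∀ y, y ⤳ x → y ∈ Z → y ∈ Z') : ∃ N : Set α, IsOpen N ∧ x ∈ N ∧ Z ∩ N ⊆ Z' := by
  obtain ⟨S, hSf, hSc, hSi, rfl⟩ :=
    NoetherianSpace.exists_finite_set_isClosed_irreducible hZ
  refine ⟨⋂ C ∈ {C ∈ S | x ∉ C}, Cᶜ, (hSf.subset (Set.sep_subset _ _)).isOpen_biInter
    fun C hC => (hSc C hC.1).isOpen_compl, ?_, ?_⟩
  · simp only [Set.mem_iInter]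
    exact fun C hC => hC.2
  · rintro y ⟨⟨C, hC, hy⟩, hyN⟩
    have hxC : x ∈ C := by
      by_contra hx
      simp only [Set.mem_iInter] at hyN
      exact hyN C ⟨hC, hx⟩ hy
    obtain ⟨η, hη⟩ := QuasiSober.sober (hSi C hC) (hSc C hC)
    have h1 : η ∈ Z' := h η (hη.specializes hxC) ⟨C, hC, hη.mem⟩
    exact (hη.specializes hy).mem_closed hZ' h1

/-- Containment of closed subsets of a locally Noetherian scheme near `x` may be checked on
generizations of `x`. -/
lemma exists_opens_inter_subset {X : Scheme.{0}} [IsLocallyNoetherian X] {Z Z' : Set X}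
    (hZ : IsClosed Z) (hZ' : IsClosed Z') (x : X) (h : ∀ y, y ⤳ x → y ∈ Z → y ∈ Z') :
    ∃ N : X.Opens, x ∈ N ∧ Z ∩ N ⊆ Z' := by
  obtain ⟨_, ⟨W, hW, rfl⟩, hxW, -⟩ :=
    X.isBasis_affineOpens.exists_subset_of_mem_open (Set.mem_univ x) isOpen_univ
  have : IsNoetherianRing Γ(X, W) := IsLocallyNoetherian.component_noetherian ⟨W, hW⟩
  have : NoetherianSpace (W : Set X) := noetherianSpace_of_isAffineOpen W hW
  have : QuasiSober (W : Set X) := W.2.isOpenEmbedding_subtypeVal.quasiSober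
  obtain ⟨N, hN, hxN, hNZ⟩ := exists_isOpen_inter_subset (α := (W : Set X))
    (hZ.preimage continuous_subtype_val) (hZ'.preimage continuous_subtype_val) ⟨x, hxW⟩
    fun y hy => h y.1 (hy.map continuous_subtype_val)
  refine ⟨⟨Subtype.val '' N, W.2.isOpenMap_subtype_val _ hN⟩, ⟨_, hxN, rfl⟩, ?_⟩
  rintro _ ⟨hy, y, hyN, rfl⟩
  exact hNZ ⟨hy, hyN⟩

/-- A product of pairwise non-associated primes divides what each of the primes divides. -/
lemma prod_dvd_of_prime {B ι : Type} [CommRing B] [IsDomain B] {z : ι → B} {y : B} (s : Finset ι)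
    (hz : ∀ i ∈ s, Prime (z i)) (hn : ∀ i ∈ s, ∀ j ∈ s, i ≠ j → ¬ z i ∣ z j)
    (hy : ∀ i ∈ s, z i ∣ y) : ∏ i ∈ s, z i ∣ y := by
  classical
  induction s using Finset.induction_on with
  | empty => exact one_dvd _
  | insert i s hi ih =>
    obtain ⟨c, hc⟩ := ih (fun j hj => hz j (Finset.mem_insert_of_mem hj))
      (fun j hj k hk => hn j (Finset.mem_insert_of_mem hj) k (Finset.mem_insert_of_mem hk))
      fun j hj => hy j (Finset.mem_insert_of_mem hj)
    have h1 := hy i (Finset.mem_insert_self i s)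
    rw [hc] at h1
    rcases (hz i (Finset.mem_insert_self i s)).dvd_or_dvd h1 with h2 | h2
    · obtain ⟨j, hj, hij⟩ := ((hz i (Finset.mem_insert_self i s)).dvd_finsetProd_iff _).1 h2
      exact absurd hij (hn i (Finset.mem_insert_self i s) j (Finset.mem_insert_of_mem hj)
        fun h => hi (h ▸ hj))
    · obtain ⟨d, rfl⟩ := h2
      rw [Finset.prod_insert hi, hc]
      exact ⟨d, by ring⟩

/-- Part of a regular system of parameters becomes, after a local étale extension, a family of
pairwise different primes. -/
lemma prime_of_linearIndependent (K : Type) {R B : Type} [Field K] [PerfectField K] [CommRing R]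
    [CommRing B] [IsLocalRing R] [IsLocalRing B] [Algebra K R] [Algebra K B] [Algebra R B]
    [IsScalarTower K R B] [IsLocalHom (algebraMap R B)] [Algebra.EssFiniteType K R]
    [Algebra.FormallySmooth K R] [Algebra.EssFiniteType K B] [Algebra.FormallySmooth K B]
    [Algebra.FormallyEtale R B] {ι : Type} [DecidableEq ι] (z : ι → R)
    (hz : ∀ i, z i ∈ IsLocalRing.maximalIdeal R)
    (hlin : LinearIndependent (IsLocalRing.ResidueField R) fun i =>
      (IsLocalRing.maximalIdeal R).toCotangent ⟨z i, hz i⟩) :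
    (∀ i, Prime (algebraMap R B (z i))) ∧
      ∀ i j, i ≠ j → ¬ algebraMap R B (z i) ∣ algebraMap R B (z j) := by
  have hmax : ∀ r ∈ IsLocalRing.maximalIdeal R, algebraMap R B r ∈ IsLocalRing.maximalIdeal B :=
    fun r hr => by
      rw [IsLocalRing.mem_maximalIdeal] at hr ⊢
      exact fun h => hr (isUnit_of_map_unit (algebraMap R B) r h)
  have hder : ∀ i, ∃ d : Derivation K B B, ∀ j,
      d (algebraMap R B (z j)) - (if i = j then 1 else 0) ∈ IsLocalRing.maximalIdeal B := by
    intro i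
    obtain ⟨d, hd⟩ := exists_dual_derivation K z hz hlin i
    obtain ⟨d', hd'⟩ := exists_derivation_extension K ((Algebra.linearMap R B).compDer d)
    refine ⟨d', fun j => ?_⟩
    rw [hd']
    have := hmax _ (hd j)
    rw [map_sub, apply_ite (algebraMap R B), map_one, map_zero] at this
    exact this
  choose d hd using hder
  have hunit : ∀ i, IsUnit (d i (algebraMap R B (z i))) := fun i => by
    by_contra h
    have h1 := hd i i
    rw [if_pos rfl] at h1
    have h2 := Ideal.sub_mem _ ((IsLocalRing.mem_maximalIdeal _).2 h) h1
    rw [sub_sub_cancel] at h2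
    exact (IsLocalRing.mem_maximalIdeal _).1 h2 isUnit_one
  refine ⟨fun i => prime_of_derivation K (hmax _ (hz i)) (d i) (hunit i), ?_⟩
  rintro i j hij ⟨c, hc⟩
  have h1 := hd j i
  rw [if_neg hij.symm, sub_zero] at h1
  refine (IsLocalRing.mem_maximalIdeal _).1 ?_ (hunit j)
  rw [hc, Derivation.leibniz, smul_eq_mul, smul_eq_mul]
  exact add_mem (Ideal.mul_mem_right _ _ (hmax _ (hz i))) (Ideal.mul_mem_left _ _ h1)

/-- Near each point, a normal crossing divisor on a smooth complex scheme is given, étale locally,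
by pairwise different primes of the local ring. -/
lemma exists_frame {X V : Scheme.{0}} (q : X ⟶ Spec (CommRingCat.of ℂ)) [Smooth q] {Y : Closeds X}
    (hY : IsNCDivisor X Y) (a : V ⟶ X) [Etale a] (v : V) :
    ∃ (T : Scheme.{0}) (b : T ⟶ V) (_ : Etale b) (t : T) (k : ℕ) (z : Fin k → Γ(T, ⊤)), b t = v ∧
      (∀ i, Prime (T.presheaf.germ ⊤ t trivial (z i))) ∧
      (∀ i j, i ≠ j → ¬ T.presheaf.germ ⊤ t trivial (z i) ∣ T.presheaf.germ ⊤ t trivial (z j)) ∧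
      ∀ w : T, a (b w) ∈ Y ↔ ∃ i, w ∉ T.basicOpen (z i) := by
  obtain ⟨U, φ, hφ, u, k, z, hu, ⟨hz, hlin⟩, hzY⟩ := hY (a v)
  -- The equations are pulled back from the étale neighbourhood `U` of `a v` to `V ×_X U`.
  obtain ⟨t, ht, htu⟩ := Scheme.Pullback.exists_preimage_pullback v u hu.symm
  let T := pullback a φ
  let b : T ⟶ V := pullback.fst a φ
  let c : T ⟶ U := pullback.snd a φ
  have hbc : b ≫ a = c ≫ φ := pullback.condition
  change b t = v at ht
  change c t = u at htu
  subst htu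
  have h1 := constHom_essFiniteType (φ ≫ q) (c t)
  have h2 := constHom_formallySmooth (φ ≫ q) (c t)
  have h3 := constHom_essFiniteType (c ≫ φ ≫ q) t
  have h4 := constHom_formallySmooth (c ≫ φ ≫ q) t
  have h5 := stalkMap_formallyEtale c t
  have h6 : IsLocalHom (c.stalkMap t).hom := inferInstance
  let := (constHom (φ ≫ q) (c t)).toAlgebra
  let := (constHom (c ≫ φ ≫ q) t).toAlgebra
  let := (c.stalkMap t).hom.toAlgebra
  have : IsScalarTower ℂ (U.presheaf.stalk (c t)) (T.presheaf.stalk t) :=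
    .of_algebraMap_eq fun r => (stalkMap_constHom c (φ ≫ q) t r).symm
  have : Algebra.EssFiniteType ℂ (U.presheaf.stalk (c t)) := h1
  have : Algebra.FormallySmooth ℂ (U.presheaf.stalk (c t)) := h2
  have : Algebra.EssFiniteType ℂ (T.presheaf.stalk t) := h3
  have : Algebra.FormallySmooth ℂ (T.presheaf.stalk t) := h4
  have : Algebra.FormallyEtale (U.presheaf.stalk (c t)) (T.presheaf.stalk t) := h5
  have : IsLocalHom (algebraMap (U.presheaf.stalk (c t)) (T.presheaf.stalk t)) := h6
  have hp := prime_of_linearIndependent ℂ (B := T.presheaf.stalk t) _ hz hlin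
  have hgerm : ∀ i, algebraMap (U.presheaf.stalk (c t)) (T.presheaf.stalk t)
      (U.presheaf.germ ⊤ (c t) trivial (z i)) = T.presheaf.germ ⊤ t trivial (c.appTop (z i)) :=
    fun i => Scheme.Hom.germ_stalkMap_apply c ⊤ t trivial (z i)
  simp only [hgerm] at hp
  refine ⟨T, b, inferInstanceAs (Etale (pullback.fst a φ)), t, k, fun i => c.appTop (z i), ht, hp.1,
    hp.2, fun w => ?_⟩
  rw [show a (b w) = φ (c w) from congrArg (fun m : T ⟶ X => m w) hbc, hzY]
  refine exists_congr fun i => not_congr ?_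
  have := Scheme.preimage_basicOpen c (z i)
  exact (show c w ∈ U.basicOpen (z i) ↔ w ∈ c ⁻¹ᵁ U.basicOpen (z i) from Iff.rfl).trans
    (by rw [this]; exact Iff.rfl)

lemma mem_preimage_basicOpen {T V : Scheme.{0}} (b : T ⟶ V) {N : V.Opens} (g : Γ(V, N)) (w : T) :
    w ∈ T.basicOpen (b.app N g) ↔ b w ∈ V.basicOpen g := by
  rw [← Scheme.preimage_basicOpen]; exact Iff.rfl

lemma map_germ {T V : Scheme.{0}} (b : T ⟶ V) (t : T) {N : V.Opens} (hN : b t ∈ N) (g : Γ(V, N)) :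
    b.stalkMap t (V.presheaf.germ N (b t) hN g) = T.presheaf.germ (b ⁻¹ᵁ N) t hN (b.app N g) :=
  Scheme.Hom.germ_stalkMap_apply b N t hN g

lemma germ_resO {T : Scheme.{0}} {t : T} {N N' : T.Opens} (h : N' ≤ N) (ht : t ∈ N')
    (g : Γ(T, N)) : T.presheaf.germ N' t ht (resO h g) = T.presheaf.germ N t (h ht) g :=
  TopCat.Presheaf.germ_res_apply T.presheaf (homOfLE h) t ht g

/-- Let `h` be a local equation of a normal crossing divisor, étale locally. A derivation which is
logarithmic with respect to `h` is logarithmic with respect to all functions which are invertible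
outside the divisor. -/
lemma dvd_of_invertible_off {X V : Scheme.{0}} (q : X ⟶ Spec (CommRingCat.of ℂ)) [Smooth q]
    {Y : Closeds X} (hY : IsNCDivisor X Y) (a : V ⟶ X) [Etale a] {v : V} {N : V.Opens} (hv : v ∈ N)
    {g : Γ(V, N)} (hg : ∀ w ∈ N, a w ∉ Y → w ∈ V.basicOpen g) :
    V.presheaf.germ N v hv g ≠ 0 ∧
    ∀ h : Γ(V, N), (∀ w ∈ N, a w ∈ Y ↔ w ∉ V.basicOpen h) →
      ∀ D : Derivation ℤ (V.presheaf.stalk v) (V.presheaf.stalk v),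
        V.presheaf.germ N v hv h ∣ D (V.presheaf.germ N v hv h) →
        V.presheaf.germ N v hv g ∣ D (V.presheaf.germ N v hv g) := by
  obtain ⟨T, b, hb, t, k, z, ht, hz, -, hzY⟩ := exists_frame q hY a v
  subst ht
  have hv' : t ∈ b ⁻¹ᵁ N := hv
  have hdom := stalk_isDomain (b ≫ a ≫ q) t
  have hnoe := stalk_isNoetherianRing (b ≫ a ≫ q) t
  let B := T.presheaf.stalk t
  let := ((constHom (b ≫ a ≫ q) t).comp (algebraMap ℚ ℂ)).toAlgebra
  let := (b.stalkMap t).hom.toAlgebra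
  have hflat : Module.Flat (V.presheaf.stalk (b t)) B := Flat.stalkMap b t
  have hloc : IsLocalHom (algebraMap (V.presheaf.stalk (b t)) B) :=
    inferInstanceAs (IsLocalHom (b.stalkMap t).hom)
  have het : Algebra.FormallyEtale (V.presheaf.stalk (b t)) B := stalkMap_formallyEtale b t
  have hmap : ∀ f : Γ(V, N), algebraMap (V.presheaf.stalk (b t)) B (V.presheaf.germ N (b t) hv f)
      = T.presheaf.germ (b ⁻¹ᵁ N) t hv' (b.app N f) := fun f => map_germ b t hv f
  -- The product of the `zᵢ` has a power divisible by each function invertible outside the divisor.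
  have hpow : ∀ f : Γ(V, N), (∀ w ∈ N, a w ∉ Y → w ∈ V.basicOpen f) → ∃ n,
      algebraMap (V.presheaf.stalk (b t)) B (V.presheaf.germ N (b t) hv f) ∣
        (∏ i, T.presheaf.germ ⊤ t trivial (z i)) ^ n := by
    intro f hf
    obtain ⟨n, hn⟩ := exists_germ_pow_mem (N := b ⁻¹ᵁ N) hv' {b.app N f}
      (resO le_top (∏ i, z i)) (fun w hw hj => by
        have h1 := hj _ rfl
        rw [mem_preimage_basicOpen] at h1
        have h2 : a (b w) ∈ Y := by
          by_contra h
          exact h1 (hf _ hw h)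
        obtain ⟨i, hi⟩ := (hzY w).1 h2
        rw [resO, Scheme.basicOpen_res]
        rintro ⟨-, h3⟩
        replace h3 : w ∈ T.basicOpen (∏ i, z i) := h3
        rw [Scheme.mem_basicOpen_top, map_prod] at h3
        rw [Scheme.mem_basicOpen_top] at hi
        exact hi (isUnit_of_dvd_unit (Finset.dvd_prod_of_mem
          (fun i => T.presheaf.germ ⊤ w trivial (z i)) (Finset.mem_univ i)) h3))
    rw [Set.image_singleton, Ideal.mem_span_singleton, germ_resO, map_prod] at hn
    exact ⟨n, by rw [hmap]; exact hn⟩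
  have hne : ∀ f : Γ(V, N), (∀ w ∈ N, a w ∉ Y → w ∈ V.basicOpen f) →
      algebraMap (V.presheaf.stalk (b t)) B (V.presheaf.germ N (b t) hv f) ≠ 0 := by
    intro f hf h0
    obtain ⟨n, hn⟩ := hpow f hf
    rw [h0, zero_dvd_iff] at hn
    obtain ⟨i, -, hi⟩ := Finset.prod_eq_zero_iff.1 (eq_zero_of_pow_eq_zero hn)
    exact (hz i).ne_zero hi
  refine ⟨fun h => hne g hg (by rw [h, map_zero]), fun h hh D hD => ?_⟩
  have hh' : ∀ w ∈ N, a w ∉ Y → w ∈ V.basicOpen h := fun w hw hw' => by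
    by_contra hc
    exact hw' ((hh w hw).2 hc)
  obtain ⟨D', hD'⟩ := exists_derivation_extension ℤ
    ((Algebra.linearMap (V.presheaf.stalk (b t)) B).compDer D)
  change ∀ r, D' (algebraMap (V.presheaf.stalk (b t)) B r)
    = algebraMap (V.presheaf.stalk (b t)) B (D r) at hD'
  -- Each `zᵢ` divides the equation `h`, so the extension of `D` is logarithmic for each `zᵢ`, hence
  -- for each divisor of a power of their product.
  have hzD : ∀ i, T.presheaf.germ ⊤ t trivial (z i) ∣ D' (T.presheaf.germ ⊤ t trivial (z i)) := by
    intro i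
    refine prime_dvd_derivation D' (hz i) (hne h hh') ?_ ?_
    · obtain ⟨n, hn⟩ := exists_germ_pow_mem (N := b ⁻¹ᵁ N) hv' {resO le_top (z i)} (b.app N h)
        (fun w hw hj => by
          have h1 := hj _ rfl
          rw [mem_preimage_basicOpen, ← hh _ hw, hzY]
          refine ⟨i, fun h2 => h1 ?_⟩
          rw [resO, Scheme.basicOpen_res]
          exact ⟨hw, h2⟩)
      rw [Set.image_singleton, Ideal.mem_span_singleton, germ_resO] at hn
      rw [hmap]
      exact (hz i).dvd_of_dvd_pow hn
    · rw [hD']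
      exact map_dvd _ hD
  obtain ⟨n, hn⟩ := hpow g hg
  have := dvd_derivation_of_dvd_prod D' _ hz hzD hn
  rw [hD'] at this
  exact dvd_of_algebraMap_dvd this

/-- A normal crossing divisor on a smooth complex scheme has a local equation. -/
lemma exists_equation {X : Scheme.{0}} (q : X ⟶ Spec (CommRingCat.of ℂ)) [Smooth q]
    {Y : Closeds X} (hY : IsNCDivisor X Y) (x : X) :
    ∃ (N : X.Opens) (_ : x ∈ N) (h : Γ(X, N)), ∀ w ∈ N, w ∈ Y ↔ w ∉ X.basicOpen h := by
  obtain ⟨T, b, hb, t, k, z, ht, hz, hzn, hzY⟩ := exists_frame q hY (𝟙 X) x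
  replace hzY : ∀ w : T, b w ∈ Y ↔ ∃ i, w ∉ T.basicOpen (z i) := hzY
  subst ht
  have hdom := stalk_isDomain (b ≫ q) t
  have hnoe := stalk_isNoetherianRing q (b t)
  let R := X.presheaf.stalk (b t)
  let B := T.presheaf.stalk t
  let := (b.stalkMap t).hom.toAlgebra
  have hflat : Module.Flat R B := Flat.stalkMap b t
  have hloc : IsLocalHom (algebraMap R B) :=
    inferInstanceAs (IsLocalHom (b.stalkMap t).hom)
  have het : Algebra.FormallyUnramified R B := FormallyUnramified.stalkMap b t
  have hft : Algebra.EssFiniteType R B := LocallyOfFiniteType.stalkMap b t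
  -- The vanishing ideal `I` of `Y` in the local ring generates, in the étale extension `B`, the
  -- radical ideal of `∏ zᵢ`. So `I` is principal.
  let Z : Set (PrimeSpectrum R) := X.fromSpecStalk (b t) ⁻¹' Y
  have hZ : IsClosed Z := Y.isClosed.preimage (X.fromSpecStalk (b t)).continuous
  let I : Ideal R := PrimeSpectrum.vanishingIdeal Z
  have hIZ : PrimeSpectrum.zeroLocus (I : Set R) = Z := by
    rw [PrimeSpectrum.zeroLocus_vanishingIdeal_eq_closure, hZ.closure_eq]
  let zB : B := ∏ i, T.presheaf.germ ⊤ t trivial (z i)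
  have hcomm : ∀ P : PrimeSpectrum B, X.fromSpecStalk (b t) (PrimeSpectrum.comap (algebraMap R B) P)
      = b (T.fromSpecStalk t P) := fun P =>
    congrArg (fun m : Spec (T.presheaf.stalk t) ⟶ X => m P)
      (Scheme.SpecMap_stalkMap_fromSpecStalk b (x := t))
  have hrad : (I.map (algebraMap R B)).radical = (Ideal.span {zB}).radical := by
    rw [← PrimeSpectrum.zeroLocus_eq_iff]
    ext P
    rw [Ideal.map, PrimeSpectrum.zeroLocus_span, ← PrimeSpectrum.preimage_comap_zeroLocus, hIZ]
    change X.fromSpecStalk (b t) (PrimeSpectrum.comap (algebraMap R B) P) ∈ Y ↔ _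
    rw [hcomm, hzY, PrimeSpectrum.zeroLocus_span, PrimeSpectrum.mem_zeroLocus,
      Set.singleton_subset_iff, SetLike.mem_coe, Ideal.IsPrime.prod_mem_iff]
    simp only [fromSpecStalk_mem_basicOpen (N := ⊤) (t := t) trivial, not_not, Finset.mem_univ,
      true_and]
  have hzrad : (Ideal.span {zB}).IsRadical := by
    rw [← isRadical_iff_span_singleton]
    intro n y hy
    exact prod_dvd_of_prime _ (fun i _ => hz i) (fun i _ j _ => hzn i j) fun i hi =>
      (hz i).dvd_of_dvd_pow ((Finset.dvd_prod_of_mem _ hi).trans hy)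
  obtain ⟨r, hrI, hr⟩ := exists_generator_of_etale (PrimeSpectrum.isRadical_vanishingIdeal Z) hzrad
    hrad (Finset.prod_ne_zero_iff.2 fun i _ => (hz i).ne_zero)
  -- A function with this germ defines `Y` on the generizations of the point, hence near the point.
  obtain ⟨N, hN, h, hh⟩ := X.presheaf.exists_germ_eq r
  have key : ∀ y : X, y ⤳ b t → (y ∈ Y ↔ y ∉ X.basicOpen h) := by
    intro y hy
    obtain ⟨P, rfl⟩ : y ∈ Set.range (X.fromSpecStalk (b t)) := by
      rw [Scheme.range_fromSpecStalk]; exact hy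
    have h1 := fromSpecStalk_mem_basicOpen (N := N) hN h P
    rw [hh] at h1
    rw [h1, not_not]
    change P ∈ Z ↔ _
    rw [← hIZ, show I = _ from hr, PrimeSpectrum.zeroLocus_span]
    exact Set.singleton_subset_iff
  have := LocallyOfFiniteType.isLocallyNoetherian q
  have hc : IsClosed ((X.basicOpen h : Set X)ᶜ) := (X.basicOpen h).2.isClosed_compl
  obtain ⟨N₁, hN₁, h₁⟩ := exists_opens_inter_subset Y.isClosed hc (b t) fun y hy => (key y hy).1
  obtain ⟨N₂, hN₂, h₂⟩ := exists_opens_inter_subset hc Y.isClosed (b t) fun y hy => (key y hy).2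
  refine ⟨N ⊓ N₁ ⊓ N₂, ⟨⟨hN, hN₁⟩, hN₂⟩, resO (inf_le_left.trans inf_le_left) h, fun w hw => ?_⟩
  rw [resO, Scheme.basicOpen_res]
  exact ⟨fun hY h3 => h₁ ⟨hY, hw.1.2⟩ h3.2, fun h3 => h₂ ⟨fun h4 => h3 ⟨hw, h4⟩, hw.2⟩⟩

/-! ### Lifting logarithmic derivations on stalks -/

/-- A derivation of the structure sheaf induces derivations of its stalks. -/
lemma exists_stalk_derivation {X : Scheme.{0}} {U : X.Opens} (P : OpO X U)
    (hadd : ∀ (W : X.Opens) (h : W ≤ U) (a b : Γ(X, W)), P.ev h (a + b) = P.ev h a + P.ev h b)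
    (hmul : ∀ (W : X.Opens) (h : W ≤ U) (a b : Γ(X, W)),
      P.ev h (a * b) = a * P.ev h b + b * P.ev h a) {x : X} (hx : x ∈ U) :
    ∃ D : Derivation ℤ (X.presheaf.stalk x) (X.presheaf.stalk x),
      ∀ (W : X.Opens) (h : W ≤ U) (hxW : x ∈ W) (a : Γ(X, W)),
        D (X.presheaf.germ W x hxW a) = X.presheaf.germ W x hxW (P.ev h a) := by
  have rep : ∀ r : X.presheaf.stalk x, ∃ (W : X.Opens) (_ : W ≤ U) (hxW : x ∈ W) (a : Γ(X, W)),
      X.presheaf.germ W x hxW a = r := by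
    intro r
    obtain ⟨W, hxW, a, ha⟩ := X.presheaf.exists_germ_eq r
    exact ⟨W ⊓ U, inf_le_right, ⟨hxW, hx⟩, resO inf_le_left a,
      (germ_resO inf_le_left ⟨hxW, hx⟩ a).trans ha⟩
  have wd : ∀ (W W' : X.Opens) (h : W ≤ U) (h' : W' ≤ U) (hW : x ∈ W) (hW' : x ∈ W')
      (a : Γ(X, W)) (b : Γ(X, W')), X.presheaf.germ W x hW a = X.presheaf.germ W' x hW' b →
      X.presheaf.germ W x hW (P.ev h a) = X.presheaf.germ W' x hW' (P.ev h' b) := by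
    intro W W' h h' hW hW' a b hab
    obtain ⟨W'', hx'', i, i', e⟩ := X.presheaf.germ_eq x hW hW' a b hab
    rw [← germ_resO i.le hx'', ← germ_resO i'.le hx'', ← P.ev_resO h i.le, ← P.ev_resO h' i'.le]
    exact congrArg (fun t => X.presheaf.germ W'' x hx'' (P.ev _ t)) e
  choose W hW hxW a ha using rep
  let D0 : X.presheaf.stalk x → X.presheaf.stalk x := fun r =>
    X.presheaf.germ (W r) x (hxW r) (P.ev (hW r) (a r))
  have hD0 : ∀ (W' : X.Opens) (h : W' ≤ U) (hx' : x ∈ W') (b : Γ(X, W')),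
      D0 (X.presheaf.germ W' x hx' b) = X.presheaf.germ W' x hx' (P.ev h b) := fun W' h hx' b =>
    wd _ _ _ _ _ _ _ _ (ha _)
  -- Two germs are represented on a common neighbourhood.
  have two : ∀ r s : X.presheaf.stalk x, ∃ (W : X.Opens) (_ : W ≤ U) (hxW : x ∈ W)
      (a b : Γ(X, W)), X.presheaf.germ W x hxW a = r ∧ X.presheaf.germ W x hxW b = s := fun r s =>
    ⟨W r ⊓ W s, inf_le_left.trans (hW r), ⟨hxW r, hxW s⟩, resO inf_le_left (a r),
      resO inf_le_right (a s), (germ_resO inf_le_left ⟨hxW r, hxW s⟩ (a r)).trans (ha r),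
      (germ_resO inf_le_right ⟨hxW r, hxW s⟩ (a s)).trans (ha s)⟩
  refine ⟨.mk' (AddMonoidHom.mk' D0 fun r s => ?_).toIntLinearMap fun r s => ?_, hD0⟩
  · obtain ⟨W, hW, hx, b, c, rfl, rfl⟩ := two r s
    rw [← map_add, hD0 _ hW, hD0 _ hW, hD0 _ hW, hadd, map_add]
  · obtain ⟨W, hW, hx, b, c, rfl, rfl⟩ := two r s
    change D0 _ = _ • D0 _ + _ • D0 _
    rw [← map_mul, hD0 _ hW, hD0 _ hW, hD0 _ hW, hmul, map_add, map_mul, map_mul]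
    rfl

open TrivSqZeroExt in
/-- Let `U ⟶ V` be given by a logarithmically smooth chart. A derivation of the local ring of `V`,
with logarithmic derivatives on `P` which extend to `Q`, lifts to a derivation of the local ring of
`U` with the given logarithmic derivatives on `Q`: this is the infinitesimal lifting property for
the smooth morphism `U ⟶ V ×_{Spec ℤ[P]} Spec ℤ[Q]` and the dual numbers of the local ring. -/
lemma exists_derivation_lift {U V : Scheme.{0}} (g : U ⟶ V) {P Q : Type} [CommMonoid P]
    [CommMonoid Q] (β : P →* Γ(V, ⊤)) (γ : Q →* Γ(U, ⊤)) (h : P →* Q)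
    (hβγ : ∀ p, g.appTop (β p) = γ (h p))
    (c : U ⟶ pullback (toMonoidSpec β)
      (Spec.map (CommRingCat.ofHom (MonoidAlgebra.mapDomainRingHom ℤ h)))) [Smooth c]
    (hc1 : c ≫ pullback.fst _ _ = g) (hc2 : c ≫ pullback.snd _ _ = toMonoidSpec γ) (u : U)
    (D : Derivation ℤ (V.presheaf.stalk (g u)) (V.presheaf.stalk (g u)))
    (τ : Q →* Multiplicative (U.presheaf.stalk u))
    (hτ : ∀ p, g.stalkMap u (D (V.presheaf.germ ⊤ (g u) trivial (β p)))
      = g.stalkMap u (V.presheaf.germ ⊤ (g u) trivial (β p)) * (τ (h p)).toAdd) :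
    ∃ D' : Derivation ℤ (U.presheaf.stalk u) (U.presheaf.stalk u),
      (∀ r, D' (g.stalkMap u r) = g.stalkMap u (D r)) ∧
      ∀ q, D' (U.presheaf.germ ⊤ u trivial (γ q))
        = U.presheaf.germ ⊤ u trivial (γ q) * (τ q).toAdd := by
  let C := V.presheaf.stalk (g u)
  let B := U.presheaf.stalk u
  let E : CommRingCat.{0} := CommRingCat.of (TrivSqZeroExt B B)
  let gs : C →+* B := (g.stalkMap u).hom
  -- The derivation along the base and the logarithmic derivatives on `Q` define ring homomorphisms
  -- `φC` and `φQ` to the dual numbers `E` of `B`, which agree on `P`.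
  let φC : C →+* TrivSqZeroExt B B :=
    { toFun := fun r => inl (gs r) + inr (gs (D r))
      map_one' := by simp
      map_zero' := by simp
      map_add' := fun r s => by
        ext <;> simp
      map_mul' := fun r s => by
        ext
        · simp
        · simp
          ring }
  let γB : Q →* B := (U.presheaf.germ ⊤ u trivial).hom.toMonoidHom.comp γ
  let φQ0 : Q →* TrivSqZeroExt B B :=
    { toFun := fun q => inl (γB q) + inr (γB q * (τ q).toAdd)
      map_one' := by simp
      map_mul' := fun q q' => by
        ext
        · simp
        · simp
          ring }
  let φQ : MonoidAlgebra ℤ Q →+* TrivSqZeroExt B B := (MonoidAlgebra.lift ℤ _ Q φQ0).toRingHom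
  let fstE : TrivSqZeroExt B B →+* B := (fstHom ℤ B B).toRingHom
  have hfC : fstE.comp φC = gs := by ext r; simp [fstE, φC]
  have hfQ : fstE.comp φQ = (U.presheaf.germ ⊤ u trivial).hom.comp
      (MonoidAlgebra.lift ℤ Γ(U, ⊤) Q γ).toRingHom := by
    refine MonoidAlgebra.ringHom_ext' (Subsingleton.elim _ _) ?_
    ext q
    simp [fstE, φQ, φQ0, γB]
  have hPQ : φC.comp ((V.presheaf.germ ⊤ (g u) trivial).hom.comp
      (MonoidAlgebra.lift ℤ Γ(V, ⊤) P β).toRingHom)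
        = φQ.comp (MonoidAlgebra.mapDomainRingHom ℤ h) := by
    have hγ : ∀ p, γB (h p) = gs (V.presheaf.germ ⊤ (g u) trivial (β p)) := fun p => by
      change U.presheaf.germ ⊤ u trivial (γ (h p)) = _
      rw [← hβγ]
      exact (Scheme.Hom.germ_stalkMap_apply g ⊤ u trivial (β p)).symm
    refine MonoidAlgebra.ringHom_ext' (Subsingleton.elim _ _) ?_
    ext p
    · simp [φC, φQ, φQ0, hγ]
    · simpa [φC, φQ, φQ0, hγ] using hτ p
  let m1 : Spec E ⟶ V := Spec.map (CommRingCat.ofHom φC) ≫ V.fromSpecStalk (g u)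
  let m2 : Spec E ⟶ Spec (CommRingCat.of (MonoidAlgebra ℤ Q)) := Spec.map (CommRingCat.ofHom φQ)
  have hm : m1 ≫ toMonoidSpec β
      = m2 ≫ Spec.map (CommRingCat.ofHom (MonoidAlgebra.mapDomainRingHom ℤ h)) := by
    simp only [m1, m2, toMonoidSpec, Category.assoc, Scheme.fromSpecStalk_toSpecΓ_assoc,
      ← Spec.map_comp]
    congr 1
    exact CommRingCat.hom_ext hPQ
  -- So they define a point `m` of the fibre product which reduces to the given point of `U`.
  let m : Spec E ⟶ _ := pullback.lift m1 m2 hm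
  have hmu : Spec.map (CommRingCat.ofHom fstE) ≫ m = U.fromSpecStalk u ≫ c := by
    apply pullback.hom_ext
    · simp only [m, Category.assoc, pullback.lift_fst, hc1, m1, ← Spec.map_comp_assoc]
      rw [← Scheme.SpecMap_stalkMap_fromSpecStalk]
      congr 2
      exact CommRingCat.hom_ext hfC
    · rw [Category.assoc, Category.assoc, hc2, show toMonoidSpec γ = U.toSpecΓ ≫ _ from rfl,
        Scheme.fromSpecStalk_toSpecΓ_assoc,
        show m ≫ pullback.snd _ _ = m2 from pullback.lift_snd _ _ _,
        ← Spec.map_comp,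
        ← Spec.map_comp]
      congr 1
      exact CommRingCat.hom_ext hfQ
  have : IsLocalRing B := inferInstanceAs (IsLocalRing (U.presheaf.stalk u))
  have : Nontrivial (TrivSqZeroExt B B) := ⟨⟨0, 1, fun h => zero_ne_one (congrArg fst h)⟩⟩
  have : IsLocalRing (TrivSqZeroExt B B) := .of_isUnit_or_isUnit_of_isUnit_add fun r s hrs => by
    rw [isUnit_iff_isUnit_fst, fst_add] at hrs
    rw [isUnit_iff_isUnit_fst, isUnit_iff_isUnit_fst]
    exact IsLocalRing.isUnit_or_isUnit_of_isUnit_add hrs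
  have : IsLocalRing E := this
  have : IsLocalHom fstE := ⟨fun r hr => isUnit_iff_isUnit_fst.2 hr⟩
  have hpt : m (IsLocalRing.closedPoint E) = c u := by
    have h1 : m (Spec.map (CommRingCat.ofHom fstE) (IsLocalRing.closedPoint B))
        = c (U.fromSpecStalk u (IsLocalRing.closedPoint B)) :=
      congrArg (fun t : Spec B ⟶ _ => t (IsLocalRing.closedPoint B)) hmu
    rw [Scheme.fromSpecStalk_closedPoint] at h1
    refine Eq.trans (congrArg m ?_) h1
    exact (IsLocalRing.comap_closedPoint fstE).symm
  -- As `E` is local, `m` factors through the local ring `A` of the fibre product.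
  obtain ⟨ψ, hψ⟩ : ∃ ψ : _ ⟶ E, Spec.map ψ ≫ Scheme.fromSpecStalk _ (c u) = m := by
    rw [← hpt]
    exact ⟨_, Scheme.Spec_stalkClosedPointTo_fromSpecStalk m⟩
  have hψ1 : ψ ≫ CommRingCat.ofHom fstE = c.stalkMap u := by
    apply Spec.map_injective
    rw [← cancel_mono (Scheme.fromSpecStalk _ (c u)), Spec.map_comp, Category.assoc, hψ, hmu,
      Scheme.SpecMap_stalkMap_fromSpecStalk]
  let A := (pullback (toMonoidSpec β)
    (Spec.map (CommRingCat.ofHom (MonoidAlgebra.mapDomainRingHom ℤ h)))).presheaf.stalk (c u)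
  have hsm := stalkMap_formallySmooth c u
  let := (c.stalkMap u).hom.toAlgebra
  let : Algebra A (TrivSqZeroExt B B) := ψ.hom.toAlgebra
  have : Algebra.FormallySmooth A B := hsm
  let fA : TrivSqZeroExt B B →ₐ[A] B :=
    { fstE with commutes' := fun r => congrArg (fun t : A ⟶ CommRingCat.of B => t r) hψ1 }
  have hnil : IsNilpotent (RingHom.ker fA) := ⟨2, kerIdeal_sq B B⟩
  -- Formal smoothness of `B` over `A` lifts the identity of `B` to `E`; the second component of the
  -- lift is the derivation.
  let l : B →ₐ[A] TrivSqZeroExt B B :=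
    Algebra.FormallySmooth.liftOfSurjective (AlgHom.id A B) fA fst_surjective hnil
  have hl : ∀ r, (l r).fst = r := fun r =>
    Algebra.FormallySmooth.liftOfSurjective_apply (AlgHom.id A B) fA fst_surjective hnil r
  have hlm : Spec.map (CommRingCat.ofHom l.toRingHom) ≫ U.fromSpecStalk u ≫ c = m := by
    rw [← Scheme.SpecMap_stalkMap_fromSpecStalk, ← Spec.map_comp_assoc, ← hψ]
    congr 2
    exact CommRingCat.hom_ext (RingHom.ext fun r => l.commutes r)
  have hl1 : ∀ r, l (gs r) = φC r := by
    have h1 : Spec.map (CommRingCat.ofHom l.toRingHom) ≫ Spec.map (g.stalkMap u) ≫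
        V.fromSpecStalk (g u) = Spec.map (CommRingCat.ofHom φC) ≫ V.fromSpecStalk (g u) := by
      have h2 : (Spec.map (CommRingCat.ofHom l.toRingHom) ≫ U.fromSpecStalk u ≫ c) ≫
          pullback.fst _ _ = m1 := by rw [hlm, pullback.lift_fst]
      rw [Category.assoc, Category.assoc, hc1] at h2
      rw [Scheme.SpecMap_stalkMap_fromSpecStalk, h2]
    rw [← Category.assoc, cancel_mono, ← Spec.map_comp] at h1
    exact fun r => congrArg (fun t : C ⟶ E => t r) (Spec.map_injective h1)
  have hl2 : ∀ q, l (γB q) = φQ0 q := by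
    have h1 : Spec.map (CommRingCat.ofHom l.toRingHom) ≫ U.fromSpecStalk u ≫ toMonoidSpec γ
        = m2 := by
      have h2 : (Spec.map (CommRingCat.ofHom l.toRingHom) ≫ U.fromSpecStalk u ≫ c) ≫
          pullback.snd _ _ = m2 := by rw [hlm, pullback.lift_snd]
      rwa [Category.assoc, Category.assoc, hc2] at h2
    simp only [m2, toMonoidSpec, Scheme.fromSpecStalk_toSpecΓ_assoc, ← Spec.map_comp] at h1
    intro q
    have h2 := congrArg (fun t : CommRingCat.of (MonoidAlgebra ℤ Q) ⟶ E =>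
      t (MonoidAlgebra.of ℤ Q q)) (Spec.map_injective h1)
    simp [φQ] at h2
    exact h2
  refine ⟨.mk' (AddMonoidHom.mk' (fun r => (l r).snd) fun r s => by simp).toIntLinearMap
    fun r s => ?_, fun r => ?_, fun q => ?_⟩
  · change (l (r * s)).snd = r • (l s).snd + s • (l r).snd
    rw [map_mul, snd_mul, hl, hl, op_smul_eq_smul]
  · change (l (gs r)).snd = gs (D r)
    rw [hl1]
    simp [φC]
  · change (l (γB q)).snd = γB q * (τ q).toAdd
    rw [hl2]
    simp [φQ0]

lemma germ_app_eq {U S : Scheme.{0}} {m m' : U ⟶ S} (h : m = m') (u : U) {W : S.Opens}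
    (hu : m u ∈ W) (hu' : m' u ∈ W) (e : Γ(S, W)) : U.presheaf.germ (m ⁻¹ᵁ W) u hu (m.app W e)
      = U.presheaf.germ (m' ⁻¹ᵁ W) u hu' (m'.app W e) := by
  subst h; rfl

/-- Near `u`, the local equation of the divisor is a unit times an element of the chart. -/
lemma exists_chart_eq {X U : Scheme.{0}} (a : U ⟶ X) {Y : Set X} {Q : Type} [CommMonoid Q]
    {γ : Q →* Γ(U, ⊤)} (hγ : IsLogChart (a ⁻¹' Y) γ) (u : U) {N : X.Opens} (hN : a u ∈ N)
    {h : Γ(X, N)} (hh : ∀ w ∈ N, w ∈ Y ↔ w ∉ X.basicOpen h) :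
    ∃ (q : Q) (c : U.presheaf.stalk u), IsUnit c ∧
      a.stalkMap u (X.presheaf.germ N (a u) hN h) = c * U.presheaf.germ ⊤ u trivial (γ q) := by
  let W : U.Opens := a ⁻¹ᵁ N
  let w : W.toScheme := (⟨u, hN⟩ : W)
  have hW : (⊤ : W.toScheme.Opens) ≤ (W.ι ≫ a) ⁻¹ᵁ N := fun w _ => w.2
  let g : Γ(W, ⊤) := resO hW ((W.ι ≫ a).app N h)
  obtain ⟨W', hw, q, c, hc, hg⟩ := hγ.surj W W.ι inferInstance w g fun y _ hy => by
    have h1 : W.ι y ∉ a ⁻¹' Y := hy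
    have h2 : a (W.ι y) ∈ X.basicOpen h := by
      by_contra h3
      exact h1 ((hh _ y.2).2 h3)
    change y ∈ W.toScheme.basicOpen (resO hW ((W.ι ≫ a).app N h))
    rw [resO, Scheme.basicOpen_res]
    exact ⟨trivial, (mem_preimage_basicOpen (W.ι ≫ a) h y).2 h2⟩
  have hU : u ∈ a ⁻¹ᵁ N := hN
  let i : U.presheaf.stalk u →+* W.toScheme.presheaf.stalk w := (W.ι.stalkMap w).hom
  have hi : Function.Bijective i := ConcreteCategory.bijective_of_isIso (W.ι.stalkMap w)
  have e1 : W.toScheme.presheaf.germ W' w hw (resO le_top g)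
      = i (a.stalkMap u (X.presheaf.germ N (a u) hN h)) := by
    rw [germ_resO, germ_resO hW, map_germ a u hN h]
    exact (map_germ W.ι w (N := a ⁻¹ᵁ N) hU (a.app N h)).symm
  have e2 : W.toScheme.presheaf.germ W' w hw (resO le_top (W.ι.appTop (γ q)))
      = i (U.presheaf.germ ⊤ u trivial (γ q)) := by
    rw [germ_resO]
    exact (map_germ W.ι w (N := ⊤) trivial (γ q)).symm
  obtain ⟨c', hc'⟩ := hi.2 (W.toScheme.presheaf.germ W' w hw c)
  refine ⟨q, c', ?_, hi.1 ?_⟩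
  · have : IsUnit (i c') := hc' ▸ hc.map _
    have : IsLocalHom i := inferInstanceAs (IsLocalHom (W.ι.stalkMap w).hom)
    exact isUnit_of_map_unit i _ ‹_›
  · rw [← e1, hg, map_mul, map_mul, e2, hc']

/-- A derivation which vanishes on the constants is linear over them. -/
lemma exists_linear_derivation {K B : Type} [CommRing K] [CommRing B] [Algebra K B]
    (D : Derivation ℤ B B) (h : ∀ c : K, D (algebraMap K B c) = 0) :
    ∃ D' : Derivation K B B, ∀ r, D' r = D r :=
  let l : B →ₗ[K] B :=
    { D.toLinearMap.toAddMonoidHom with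
      map_smul' := fun c r => by
        change D (c • r) = c • D r
        rw [Algebra.smul_def, D.leibniz, h, smul_zero, add_zero, smul_eq_mul, ← Algebra.smul_def] }
  ⟨.mk' l D.leibniz, fun _ => rfl⟩

/-- The logarithmic derivatives `p ↦ D (β p) / β p` form an additive character. -/
lemma exists_logarithmic_derivative {P C : Type} [CommMonoid P] [CommRing C] [IsDomain C]
    (D : Derivation ℤ C C) (β : P →* C) (h : ∀ p, β p ≠ 0 ∧ β p ∣ D (β p)) :
    ∃ τ : P →* Multiplicative C, ∀ p, D (β p) = β p * (τ p).toAdd := by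
  choose t ht using fun p => (h p).2
  refine ⟨⟨⟨fun p => .ofAdd (t p), ?_⟩, fun p q => ?_⟩, ht⟩
  · have := ht 1
    rw [map_one, D.map_one_eq_zero, one_mul] at this
    exact congrArg Multiplicative.ofAdd this.symm
  · refine congrArg Multiplicative.ofAdd (mul_left_cancel₀ (h (p * q)).1 ?_)
    rw [← ht, map_mul, D.leibniz, ht, ht, smul_eq_mul, smul_eq_mul]
    change _ = β p * β q * (t p + t q)
    ring

/-- A logarithmic derivation of the base lifts to each local ring of the total space. -/
lemma exists_lift_stalk {X S : Scheme.{0}} {f : X ⟶ S} {pS : S ⟶ Spec (CommRingCat.of ℂ)}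
    {Δ : Closeds S} {Y : Closeds X} {d : ℕ} (hf : IsLogSmoothFamily f pS Δ Y d) {V₀ : S.Opens}
    {θ : OpO S V₀} (hθ : θ ∈ logDer pS Δ V₀) (x : X) (hx : f x ∈ V₀) {N : X.Opens} (hN : x ∈ N)
    {h : Γ(X, N)} (hh : ∀ w ∈ N, w ∈ Y ↔ w ∉ X.basicOpen h) :
    ∃ D : Derivation ℤ (X.presheaf.stalk x) (X.presheaf.stalk x),
      (∀ c, D (constHom (f ≫ pS) x c) = 0) ∧
      (∀ (W : S.Opens) (hW : W ≤ V₀) (hxW : f x ∈ W) (e : Γ(S, W)),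
        D (X.presheaf.germ (f ⁻¹ᵁ W) x hxW (f.app W e))
          = X.presheaf.germ (f ⁻¹ᵁ W) x hxW (f.app W (θ.ev hW e))) ∧
      X.presheaf.germ N x hN h ∣ D (X.presheaf.germ N x hN h) := by
  have := hf.smooth_base
  have := hf.smooth_total
  obtain ⟨U, V, a, ha, u, b, hb, g, P, Q, _, _, _, _, β, γ, hPQ, c, hu, hgb, hβ, hγ, hβγ, hker, hc1,
    hc2, hc⟩ := hf.log_smooth x
  subst hu
  have hpt : b (g u) = f (a u) := congrArg (fun m : U ⟶ S => m u) hgb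
  have hxb : b (g u) ∈ V₀ := hpt ▸ hx
  obtain ⟨θs, hθs⟩ := exists_stalk_derivation θ hθ.1 hθ.2.1 hxb
  let C := V.presheaf.stalk (g u)
  let B := U.presheaf.stalk u
  let Rs := S.presheaf.stalk (b (g u))
  let bs : Rs →+* C := (b.stalkMap (g u)).hom
  let gs : C →+* B := (g.stalkMap u).hom
  -- The extension of `θ` to the local ring of `V`.
  obtain ⟨DC, hDC⟩ : ∃ DC : Derivation ℤ C C, ∀ r, DC (bs r) = bs (θs r) := by
    let := bs.toAlgebra
    have : Algebra.FormallyEtale Rs C := stalkMap_formallyEtale b (g u)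
    exact exists_derivation_extension ℤ ((Algebra.linearMap Rs C).compDer θs)
  -- It is logarithmic on the chart.
  have hDβ : ∀ p, V.presheaf.germ ⊤ (g u) trivial (β p) ≠ 0 ∧
      V.presheaf.germ ⊤ (g u) trivial (β p) ∣ DC (V.presheaf.germ ⊤ (g u) trivial (β p)) := by
    intro p
    obtain ⟨N₁, hN₁, h₁, hh₁⟩ := exists_equation pS hf.nc_base (b (g u))
    let N₂ := N₁ ⊓ V₀
    have hN₂ : b (g u) ∈ N₂ := ⟨hN₁, hxb⟩
    let h₂ : Γ(S, N₂) := resO inf_le_left h₁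
    have hh₂ : ∀ w ∈ N₂, w ∈ Δ ↔ w ∉ S.basicOpen h₂ := fun w hw => by
      rw [hh₁ w hw.1]
      change _ ↔ w ∉ S.basicOpen (resO inf_le_left h₁)
      rw [resO, Scheme.basicOpen_res]
      exact not_congr ⟨fun h => ⟨hw, h⟩, fun h => h.2⟩
    have hv : g u ∈ b ⁻¹ᵁ N₂ := hN₂
    obtain ⟨e1, e2⟩ := dvd_of_invertible_off pS hf.nc_base b (N := b ⁻¹ᵁ N₂) hv
      (g := resO le_top (β p)) fun w hw hw' => by
        rw [resO, Scheme.basicOpen_res]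
        exact ⟨hw, hβ.invertible p w trivial hw'⟩
    rw [germ_resO le_top hv] at e1 e2
    refine ⟨e1, e2 (b.app N₂ h₂) (fun w hw => ?_) DC ?_⟩
    · rw [mem_preimage_basicOpen]
      exact hh₂ _ hw
    · rw [← map_germ b (g u) hN₂ h₂]
      change bs _ ∣ DC (bs _)
      rw [hDC, hθs N₂ inf_le_right hN₂]
      refine map_dvd bs (map_dvd _ (hθ.2.2.2 N₂ inf_le_right h₂ fun w hw hw' => ?_))
      by_contra h3
      exact hw' ((hh₂ w hw).2 h3)
  have hC : IsDomain C := stalk_isDomain (b ≫ pS) (g u)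
  obtain ⟨τ, hτ⟩ := exists_logarithmic_derivative DC
    ((V.presheaf.germ ⊤ (g u) trivial).hom.toMonoidHom.comp β) hDβ
  let := (((constHom (a ≫ f ≫ pS) u).comp (algebraMap ℚ ℂ)).toAlgebra).toModule
  -- Its logarithmic derivatives extend to the chart of the total space, which gives a derivation of
  -- the local ring of `U`.
  obtain ⟨τ', hτ'⟩ := exists_character_extension hPQ hker
    ((AddMonoidHom.toMultiplicative gs.toAddMonoidHom).comp τ)
  obtain ⟨DB, hDB, hDBγ⟩ := exists_derivation_lift g β γ hPQ hβγ c hc1 hc2 u DC τ' fun p => by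
    rw [hτ']
    exact (congrArg gs (hτ p)).trans (map_mul gs _ _)
  -- It is a derivation over the complex numbers.
  have hconst : ∀ z, DB (constHom (a ≫ f ≫ pS) u z) = 0 := by
    intro z
    have e1 : constHom (a ≫ f ≫ pS) u z = gs (bs (constHom pS (b (g u)) z)) := by
      have e2 : a ≫ f ≫ pS = g ≫ b ≫ pS := by rw [← Category.assoc, ← hgb, Category.assoc]
      rw [e2, ← stalkMap_constHom, ← stalkMap_constHom]
    have e3 : θs (constHom pS (b (g u)) z) = 0 := by
      rw [constHom_apply, ← germ_resO (le_top : V₀ ≤ ⊤) hxb, hθs V₀ le_rfl hxb]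
      exact (congrArg _ (hθ.2.2.1 V₀ le_rfl ⊤ le_top _)).trans (map_zero _)
    rw [e1]
    refine (hDB _).trans ?_
    change gs (DC _) = 0
    rw [hDC, e3, map_zero, map_zero]
  -- The local equation is a unit `w` times an element `γ q` of the chart, so its logarithmic
  -- derivative is `τ' q + w⁻¹ D w`; the derivation is retracted to the local ring of `X`.
  obtain ⟨q, w, hw, hq⟩ := exists_chart_eq a hγ u hN hh
  let R := X.presheaf.stalk (a u)
  let as : R →+* B := (a.stalkMap u).hom
  let := (constHom (f ≫ pS) (a u)).toAlgebra
  let := (constHom (a ≫ f ≫ pS) u).toAlgebra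
  let := as.toAlgebra
  have : IsScalarTower ℂ R B := .of_algebraMap_eq fun z => (stalkMap_constHom a (f ≫ pS) u z).symm
  have : Algebra.EssFiniteType ℂ R := constHom_essFiniteType (f ≫ pS) (a u)
  have : IsNoetherianRing R := stalk_isNoetherianRing (f ≫ pS) (a u)
  have : Module.Flat R B := Flat.stalkMap a u
  have : IsLocalHom (algebraMap R B) := inferInstanceAs (IsLocalHom (a.stalkMap u).hom)
  obtain ⟨DB', hDB'⟩ := exists_linear_derivation (K := ℂ) (B := B) DB hconst
  obtain ⟨w', hw'⟩ := hw.exists_left_inv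
  obtain ⟨D, hD1, hD2⟩ := exists_derivation_retraction (R := R) ℂ DB' ((τ' q).toAdd + w' * DB w)
  refine ⟨D.restrictScalars ℤ, fun z => D.map_algebraMap z, fun W hW hxW e => ?_, ?_⟩
  · refine hD1 _ _ ?_
    have hgW : b (g u) ∈ W := hpt ▸ hxW
    have key : ∀ e' : Γ(S, W), as (X.presheaf.germ (f ⁻¹ᵁ W) (a u) hxW (f.app W e'))
        = gs (bs (S.presheaf.germ W (b (g u)) hgW e')) := by
      intro e'
      have h1 : bs (S.presheaf.germ W (b (g u)) hgW e') = _ := map_germ b (g u) hgW e'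
      have h2 : gs (V.presheaf.germ (b ⁻¹ᵁ W) (g u) hgW (b.app W e')) = _ :=
        map_germ g u (N := b ⁻¹ᵁ W) hgW (b.app W e')
      have h3 : as (X.presheaf.germ (f ⁻¹ᵁ W) (a u) hxW (f.app W e')) = _ :=
        map_germ a u (N := f ⁻¹ᵁ W) hxW (f.app W e')
      rw [h1, h2, h3]
      exact germ_app_eq hgb.symm u hxW hgW e'
    rw [hDB']
    change DB (as _) = as _
    rw [key, key]
    refine (hDB _).trans ?_
    change gs (DC _) = _
    rw [hDC, hθs W hW hgW]
  · refine hD2 _ ?_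
    rw [hDB']
    change DB (a.stalkMap u (X.presheaf.germ N (a u) hN h))
      = a.stalkMap u (X.presheaf.germ N (a u) hN h) * _
    rw [hq, DB.leibniz, hDBγ, smul_eq_mul, smul_eq_mul]
    linear_combination (-U.presheaf.germ ⊤ u trivial (γ q) * DB w) * hw'

/-! ### Extending derivations from stalks to neighbourhoods -/

/-- A derivation of a localization of a finitely generated algebra becomes, after multiplication
with a denominator, a derivation of the algebra. -/
lemma exists_derivation_numerator (K : Type) {A B : Type} [CommRing K] [CommRing A] [CommRing B]
    [Algebra K A] [Algebra K B] [Algebra A B] [IsScalarTower K A B] [Algebra.FiniteType K A]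
    [IsNoetherianRing A] (M : Submonoid A) [IsLocalization M B] (D : Derivation K B B) :
    ∃ (s : A) (_ : s ∈ M) (D₀ : Derivation K A A), ∀ a,
      algebraMap A B (D₀ a) = algebraMap A B s * D (algebraMap A B a) := by
  let D1 : Derivation K A B := D.compAlgebraMap A
  have : Module.FinitePresentation A (Ω[A⁄K]) := Module.finitePresentation_of_finite A _
  obtain ⟨l, s, hs⟩ := Module.FinitePresentation.exists_lift_of_isLocalizedModule M
    (Algebra.linearMap A B) D1.liftKaehlerDifferential
  refine ⟨s.1, s.2, l.compDer (KaehlerDifferential.D K A), fun a => ?_⟩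
  have := LinearMap.congr_fun hs (KaehlerDifferential.D K A a)
  simpa [D1, Submonoid.smul_def, Algebra.smul_def] using this

/-- Divisibility of functions can be checked on germs if the stalks are integral domains. -/
lemma dvd_of_germ_dvd {X : Scheme.{0}} (hX : ∀ x : X, IsDomain (X.presheaf.stalk x)) {W : X.Opens}
    (g p : Γ(X, W)) (h : ∀ (y : X) (hy : y ∈ W), X.presheaf.germ W y hy g ≠ 0 ∧
      X.presheaf.germ W y hy g ∣ X.presheaf.germ W y hy p) : g ∣ p := by
  have loc : ∀ y : W, ∃ (V : X.Opens) (_ : y.1 ∈ V) (hV : V ≤ W) (t : Γ(X, V)),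
      resO hV p = resO hV g * t := by
    rintro ⟨y, hy⟩
    obtain ⟨r, hr⟩ := (h y hy).2
    obtain ⟨V, hyV, t, rfl⟩ := X.presheaf.exists_germ_eq r
    rw [← germ_resO (inf_le_left : W ⊓ V ≤ W) ⟨hy, hyV⟩, ← germ_resO (inf_le_left : W ⊓ V ≤ W)
      ⟨hy, hyV⟩, ← germ_resO (inf_le_right : W ⊓ V ≤ V) ⟨hy, hyV⟩, ← map_mul] at hr
    obtain ⟨V', hyV', i, j, e⟩ := X.presheaf.germ_eq y _ _ _ _ hr
    refine ⟨V', hyV', i.le.trans inf_le_left, resO (i.le.trans inf_le_right) t, ?_⟩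
    have e' : resO i.le (resO inf_le_left p)
      = resO i.le (resO inf_le_left g * resO inf_le_right t) := e
    simpa using e'
  choose V hy hV t ht using loc
  -- The quotients are unique on germs, so they glue.
  obtain ⟨r, hr⟩ : ∃ r : Γ(X, W), ∀ y, resO (hV y) r = t y := exists_glue (OX X) V hV
      (fun y hy' => Opens.mem_iSup.2 ⟨⟨y, hy'⟩, hy _⟩) t (by
    intro i j
    refine TopCat.Presheaf.section_ext X.sheaf _ _ _ fun y hyy => ?_
    have hyW : y ∈ W := hV i hyy.1
    have := hX y
    refine mul_left_cancel₀ (M₀ := X.presheaf.stalk y) (h y hyW).1 ?_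
    have e1 := congrArg (X.presheaf.germ (V i) y hyy.1) (ht i)
    have e2 := congrArg (X.presheaf.germ (V j) y hyy.2) (ht j)
    rw [map_mul, germ_resO, germ_resO] at e1 e2
    refine (congrArg _ (germ_resO inf_le_left hyy (t i))).trans (e1.symm.trans (e2.trans ?_))
    exact (congrArg _ (germ_resO inf_le_right hyy (t j))).symm)
  refine ⟨r, ?_⟩
  refine eq_of_res (OX X) _ _ fun y hy' => ⟨V ⟨y, hy'⟩, hy _, hV _, ?_⟩
  change resO _ p = resO _ (g * r)
  rw [map_mul, ht, hr]

/-- Derivations of the stalks which locally send functions to functions come from a derivation of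
the structure sheaf. -/
lemma exists_operator {X : Scheme.{0}} {U : X.Opens}
    (D : ∀ y : U, Derivation ℤ (X.presheaf.stalk y.1) (X.presheaf.stalk y.1))
    (h : ∀ (W : X.Opens) (hW : W ≤ U) (a : Γ(X, W)), ∀ y ∈ W, ∃ (V : X.Opens) (_ : y ∈ V)
      (hV : V ≤ W) (b : Γ(X, V)), ∀ (z : X) (hz : z ∈ V),
        D ⟨z, hW (hV hz)⟩ (X.presheaf.germ W z (hV hz) a) = X.presheaf.germ V z hz b) :
    ∃ P : OpO X U, ∀ (W : X.Opens) (hW : W ≤ U) (a : Γ(X, W)) (y : X) (hy : y ∈ W),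
      X.presheaf.germ W y hy (P.ev hW a) = D ⟨y, hW hy⟩ (X.presheaf.germ W y hy a) := by
  have key : ∀ (W : X.Opens) (hW : W ≤ U) (a : Γ(X, W)), ∃ p : Γ(X, W), ∀ (y : X) (hy : y ∈ W),
      X.presheaf.germ W y hy p = D ⟨y, hW hy⟩ (X.presheaf.germ W y hy a) := by
    intro W hW a
    choose V hy hV b hb using fun y : W => h W hW a y.1 y.2
    obtain ⟨p, hp⟩ := exists_glue (OX X) V hV (fun y hy' => Opens.mem_iSup.2 ⟨⟨y, hy'⟩, hy _⟩) b (by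
      intro i j
      refine TopCat.Presheaf.section_ext X.sheaf _ _ _ fun y hyy => ?_
      refine (germ_resO inf_le_left hyy (b i)).trans (Eq.trans ?_
        (germ_resO inf_le_right hyy (b j)).symm)
      rw [← hb i y hyy.1, ← hb j y hyy.2])
    refine ⟨p, fun y hy' => ?_⟩
    rw [hb ⟨y, hy'⟩ y (hy _), ← hp]
    exact (germ_resO (hV _) (hy ⟨y, hy'⟩) p).symm
  choose P hP using key
  refine ⟨.mk P fun W W' hW h a => ?_, fun W hW a y hy => hP W hW a y hy⟩
  refine TopCat.Presheaf.section_ext X.sheaf _ _ _ fun y hy => ?_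
  refine (hP _ _ _ y hy).trans (Eq.trans ?_ (germ_resO h hy (P W hW a)).symm)
  rw [germ_resO, hP]

/-- Derivations of a localization are determined by their values on the ring. -/
lemma derivation_eq_of_isLocalization {A B N : Type} [CommRing A] [CommRing B] [Algebra A B]
    [AddCommGroup N] [Module B N] (M : Submonoid A) [IsLocalization M B] (D D' : Derivation ℤ B N)
    (h : ∀ a, D (algebraMap A B a) = D' (algebraMap A B a)) (r : B) : D r = D' r := by
  obtain ⟨⟨a, m⟩, hm⟩ := IsLocalization.surj M r
  have e1 := h a
  rw [← hm, D.leibniz, D'.leibniz, h, add_right_inj] at e1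
  exact (IsLocalization.map_units B m).smul_left_cancel.1 e1

lemma eq_of_germ {X : Scheme.{0}} {W : X.Opens} {a b : Γ(X, W)}
    (h : ∀ (y : X) (hy : y ∈ W), X.presheaf.germ W y hy a = X.presheaf.germ W y hy b) : a = b :=
  TopCat.Presheaf.section_ext X.sheaf _ _ _ h

/-- The complex constants as functions on an open subset. -/
def constSec {X : Scheme.{0}} (q : X ⟶ Spec (CommRingCat.of ℂ)) (W : X.Opens) : ℂ →+* Γ(X, W) :=
  (resO le_top).comp (q.appTop.hom.comp (Scheme.ΓSpecIso (CommRingCat.of ℂ)).inv.hom)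

lemma germ_constSec {X : Scheme.{0}} (q : X ⟶ Spec (CommRingCat.of ℂ)) {W : X.Opens} {x : X}
    (hx : x ∈ W) (c : ℂ) : X.presheaf.germ W x hx (constSec q W c) = constHom q x c :=
  (germ_resO le_top hx _).trans (constHom_apply q x c).symm

lemma constSec_finiteType {X : Scheme.{0}} (q : X ⟶ Spec (CommRingCat.of ℂ)) [LocallyOfFiniteType q]
    {W : X.Opens} (hW : IsAffineOpen W) : (constSec q W).FiniteType := by
  have h1 := q.finiteType_appLE (isAffineOpen_top (Spec (CommRingCat.of ℂ))) hW le_top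
  have h2 : (Scheme.ΓSpecIso (CommRingCat.of ℂ)).inv.hom.FiniteType :=
    RingHom.FiniteType.of_surjective _
      (ConcreteCategory.bijective_of_isIso (Scheme.ΓSpecIso (CommRingCat.of ℂ)).inv).2
  exact h1.comp h2

/-- A derivation of a stalk extends to a derivation of the structure sheaf near the point. -/
lemma exists_extension {X : Scheme.{0}} (q : X ⟶ Spec (CommRingCat.of ℂ)) [Smooth q] {x : X}
    {N : X.Opens} (hN : x ∈ N) (D : Derivation ℤ (X.presheaf.stalk x) (X.presheaf.stalk x))
    (hD : ∀ c, D (constHom q x c) = 0) :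
    ∃ (U : X.Opens) (_ : x ∈ U) (_ : U ≤ N) (P : OpO X U),
      (∀ (W : X.Opens) (h : W ≤ U) (a b : Γ(X, W)), P.ev h (a + b) = P.ev h a + P.ev h b) ∧
      (∀ (W : X.Opens) (h : W ≤ U) (a b : Γ(X, W)),
        P.ev h (a * b) = a * P.ev h b + b * P.ev h a) ∧
      (∀ (W : X.Opens) (h : W ≤ U) (c : ℂ), P.ev h (constSec q W c) = 0) ∧
      ∀ (W : X.Opens) (h : W ≤ U) (hxW : x ∈ W) (a : Γ(X, W)),
        X.presheaf.germ W x hxW (P.ev h a) = D (X.presheaf.germ W x hxW a) := by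
  obtain ⟨_, ⟨W₀, hW₀, rfl⟩, hxW₀, hWN⟩ :=
    X.isBasis_affineOpens.exists_subset_of_mem_open hN N.2
  let A := Γ(X, W₀)
  have := LocallyOfFiniteType.isLocallyNoetherian q
  have : IsNoetherianRing A := IsLocallyNoetherian.component_noetherian ⟨W₀, hW₀⟩
  let := (constSec q W₀).toAlgebra
  have hft : Algebra.FiniteType ℂ A := constSec_finiteType q hW₀
  let algst : ∀ y : W₀, Algebra A (X.presheaf.stalk y.1) := fun y =>
    (X.presheaf.germ W₀ y.1 y.2).hom.toAlgebra
  have hloc : ∀ y : W₀, IsLocalization.AtPrime (X.presheaf.stalk y.1)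
      (hW₀.primeIdealOf y).asIdeal := fun y => hW₀.isLocalization_stalk y
  -- On an affine neighbourhood with ring `A` of finite type, `D` is the quotient by some `s` of a
  -- derivation `D₀` of `A`.
  obtain ⟨s, hs, D₀, hD₀⟩ : ∃ (s : A) (_ : IsUnit (X.presheaf.germ W₀ x hxW₀ s))
      (D₀ : Derivation ℂ A A), ∀ a, X.presheaf.germ W₀ x hxW₀ (D₀ a)
        = X.presheaf.germ W₀ x hxW₀ s * D (X.presheaf.germ W₀ x hxW₀ a) := by
    let := (constHom q x).toAlgebra
    let := algst ⟨x, hxW₀⟩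
    have : IsScalarTower ℂ A (X.presheaf.stalk x) :=
      .of_algebraMap_eq fun c => (germ_constSec q hxW₀ c).symm
    obtain ⟨D', hD'⟩ := exists_linear_derivation (K := ℂ) D hD
    have := hloc ⟨x, hxW₀⟩
    obtain ⟨s, hs, D₀, hD₀⟩ := exists_derivation_numerator ℂ (A := A)
      (hW₀.primeIdealOf ⟨x, hxW₀⟩).asIdeal.primeCompl D'
    refine ⟨s, IsLocalization.map_units (X.presheaf.stalk x)
      (⟨s, hs⟩ : (hW₀.primeIdealOf ⟨x, hxW₀⟩).asIdeal.primeCompl), D₀, fun a => ?_⟩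
    exact (hD₀ a).trans (congrArg _ (hD' _))
  let U := X.basicOpen s
  have hUW : U ≤ W₀ := X.basicOpen_le s
  have hsU : ∀ y : U, IsUnit (X.presheaf.germ W₀ y.1 (hUW y.2) s) := fun y =>
    (X.mem_basicOpen s y.1 (hUW y.2)).1 y.2
  -- Where `s` is invertible, `D₀ / s` is a derivation of the stalks.
  have hDy : ∀ y : U, ∃ Dy : Derivation ℤ (X.presheaf.stalk y.1) (X.presheaf.stalk y.1), ∀ a : A,
      X.presheaf.germ W₀ y.1 (hUW y.2) s * Dy (X.presheaf.germ W₀ y.1 (hUW y.2) a)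
        = X.presheaf.germ W₀ y.1 (hUW y.2) (D₀ a) := by
    intro y
    let := algst ⟨y.1, hUW y.2⟩
    have := hloc ⟨y.1, hUW y.2⟩
    have : Algebra.FormallyEtale A (X.presheaf.stalk y.1) :=
      .of_isLocalization (hW₀.primeIdealOf ⟨y.1, hUW y.2⟩).asIdeal.primeCompl
    obtain ⟨w, hw⟩ := (hsU y).exists_right_inv
    obtain ⟨Dy, hDy⟩ := exists_derivation_extension ℤ (w •
      (Algebra.linearMap A (X.presheaf.stalk y.1)).compDer (D₀.restrictScalars ℤ))
    refine ⟨Dy, fun a => ?_⟩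
    have := hDy a
    change Dy (X.presheaf.germ W₀ y.1 (hUW y.2) a)
      = w * X.presheaf.germ W₀ y.1 (hUW y.2) (D₀ a) at this
    rw [this, ← mul_assoc, hw, one_mul]
  choose Dy hDy using hDy
  have hxU : x ∈ U := (X.mem_basicOpen s x hxW₀).2 hs
  have hDx : ∀ r, Dy ⟨x, hxU⟩ r = D r := by
    let := algst ⟨x, hxW₀⟩
    have := hloc ⟨x, hxW₀⟩
    refine derivation_eq_of_isLocalization (A := A)
      (hW₀.primeIdealOf ⟨x, hxW₀⟩).asIdeal.primeCompl _ _ fun a => ?_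
    exact hs.mul_left_cancel ((hDy ⟨x, hxU⟩ a).trans (hD₀ a))
  obtain ⟨P, hP⟩ := exists_operator Dy (by
    intro W hW a y hy
    let := algst ⟨y, hUW (hW hy)⟩
    have := hloc ⟨y, hUW (hW hy)⟩
    obtain ⟨⟨a₁, m⟩, ham⟩ := IsLocalization.surj
      (hW₀.primeIdealOf ⟨y, hUW (hW hy)⟩).asIdeal.primeCompl (X.presheaf.germ W y hy a)
    have hm : IsUnit (X.presheaf.germ W₀ y (hUW (hW hy)) m.1) :=
      IsLocalization.map_units (X.presheaf.stalk y) m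
    change X.presheaf.germ W y hy a * X.presheaf.germ W₀ y (hUW (hW hy)) m.1
      = X.presheaf.germ W₀ y (hUW (hW hy)) a₁ at ham
    have hWW : W ≤ W₀ := hW.trans hUW
    rw [← germ_resO hWW hy, ← germ_resO hWW hy, ← map_mul] at ham
    obtain ⟨V₁, hyV₁, i, j, e⟩ := X.presheaf.germ_eq y _ _ _ _ ham
    replace e : resO i.le (a * resO hWW m.1) = resO i.le (resO hWW a₁) := by
      exact e
    rw [map_mul, resO_resO, resO_resO] at e
    let V := V₁ ⊓ X.basicOpen m.1
    have hV₁ : V ≤ V₁ := inf_le_left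
    have hVW : V ≤ W := hV₁.trans i.le
    -- Locally `a = a₁ / m` with `a₁` and `m` in `A`, and the values of the derivation on `a` are
    -- the germs of `(D₀ a₁ - a D₀ m) / (s m)`.
    have hms : ∃ w : Γ(X, V), resO (hVW.trans hWW) (s * m.1) * w = 1 := by
      refine IsUnit.exists_right_inv ?_
      rw [map_mul]
      have h1 : IsUnit (resO hUW s) := RingedSpace.isUnit_res_basicOpen _ s
      have h2 : IsUnit (resO (X.basicOpen_le m.1) m.1) := RingedSpace.isUnit_res_basicOpen _ m.1
      refine IsUnit.mul ?_ ?_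
      · have := h1.map (resO (hVW.trans hW))
        rwa [resO_resO] at this
      · have := h2.map (resO (inf_le_right : V ≤ X.basicOpen m.1))
        rwa [resO_resO] at this
    obtain ⟨w, hw⟩ := hms
    refine ⟨V, ⟨hyV₁, (X.mem_basicOpen m.1 y _).2 hm⟩, hVW,
      w * (resO (hVW.trans hWW) (D₀ a₁) - resO hVW a * resO (hVW.trans hWW) (D₀ m.1)),
      fun z hz => ?_⟩
    have hzW₀ : z ∈ W₀ := hWW (hVW hz)
    have e' := congrArg (X.presheaf.germ V₁ z (hV₁ hz)) e
    rw [map_mul, germ_resO, germ_resO, germ_resO] at e'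
    have hw' := congrArg (X.presheaf.germ V z hz) hw
    rw [map_mul, map_one, germ_resO, map_mul] at hw'
    have e1 := hDy ⟨z, hW (hVW hz)⟩ a₁
    have e2 := hDy ⟨z, hW (hVW hz)⟩ m.1
    rw [map_mul, map_sub, map_mul, germ_resO, germ_resO, germ_resO, ← e1, ← e2, ← e',
      Derivation.leibniz,
      smul_eq_mul, smul_eq_mul]
    linear_combination (-(Dy ⟨z, hW (hVW hz)⟩ (X.presheaf.germ W z (hVW hz) a))) * hw')
  refine ⟨U, hxU, hUW.trans hWN, P, fun W h a b => ?_, fun W h a b => ?_, fun W h c => ?_,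
    fun W h hxW a => ?_⟩
  · refine eq_of_germ fun y hy => ?_
    rw [hP, map_add, map_add, map_add, hP, hP]
  · refine eq_of_germ fun y hy => ?_
    rw [hP, map_mul, Derivation.leibniz, map_add, map_mul, map_mul, hP, hP]
    rfl
  · refine eq_of_germ fun y hy => ?_
    rw [hP, germ_constSec, map_zero]
    refine (hsU ⟨y, h hy⟩).mul_right_eq_zero.1 ?_
    rw [← germ_constSec q (hUW (h hy)), hDy ⟨y, h hy⟩]
    exact (congrArg _ (D₀.map_algebraMap c)).trans (map_zero _)
  · rw [hP, hDx]

/-! ### Lifting logarithmic derivations to the total space -/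

/-- Finitely many equalities of germs hold on a common neighbourhood. -/
lemma exists_res_eq {X : Scheme.{0}} {U : X.Opens} {x : X} (hx : x ∈ U) {ι : Type} (T : Finset ι)
    (a b : ι → Γ(X, U)) (h : ∀ i ∈ T, X.presheaf.germ U x hx (a i) = X.presheaf.germ U x hx (b i)) :
    ∃ (V : X.Opens) (_ : x ∈ V) (hV : V ≤ U), ∀ i ∈ T, resO hV (a i) = resO hV (b i) := by
  classical
  induction T using Finset.induction_on with
  | empty => exact ⟨U, hx, le_rfl, by simp⟩
  | insert i T _ ih =>
    obtain ⟨V, hxV, hV, hT⟩ := ih fun j hj => h j (Finset.mem_insert_of_mem hj)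
    obtain ⟨V', hxV', k, k', e⟩ := X.presheaf.germ_eq x hx hx _ _ (h i (Finset.mem_insert_self i T))
    replace e : resO k.le (a i) = resO k.le (b i) := e
    refine ⟨V ⊓ V', ⟨hxV, hxV'⟩, inf_le_left.trans hV, fun j hj => ?_⟩
    rcases Finset.mem_insert.1 hj with rfl | hj
    · have := congrArg (resO (inf_le_right : V ⊓ V' ≤ V')) e
      rwa [resO_resO, resO_resO] at this
    · have := congrArg (resO (inf_le_left : V ⊓ V' ≤ V)) (hT j hj)
      rwa [resO_resO, resO_resO] at this

/-- A derivation which lifts `θ` on generators of the ring of functions on an affine open subset of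
the base lifts `θ` everywhere. -/
lemma lift_of_generators {X S : Scheme.{0}} (f : X ⟶ S) (pS : S ⟶ Spec (CommRingCat.of ℂ))
    {V₀ S₀ : S.Opens} (hS₀ : IsAffineOpen S₀) (hSV : S₀ ≤ V₀) {θ : OpO S V₀} {Δ : Set S}
    (hθ : θ ∈ logDer pS Δ V₀) {U : X.Opens} (hU : U ≤ f ⁻¹ᵁ S₀) (P : OpO X U)
    (hadd : ∀ (W : X.Opens) (h : W ≤ U) (a b : Γ(X, W)), P.ev h (a + b) = P.ev h a + P.ev h b)
    (hmul : ∀ (W : X.Opens) (h : W ≤ U) (a b : Γ(X, W)),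
        P.ev h (a * b) = a * P.ev h b + b * P.ev h a)
    (hconst : ∀ (W : X.Opens) (h : W ≤ U) (c : ℂ), P.ev h (constSec (f ≫ pS) W c) = 0)
    (T : Set Γ(S, S₀)) (hT : letI := (constSec pS S₀).toAlgebra; Algebra.adjoin ℂ T = ⊤)
    (h : ∀ e ∈ T, P.ev le_rfl (resO hU (f.app S₀ e)) = resO hU (f.app S₀ (θ.ev hSV e)))
    (W : X.Opens) (hW : W ≤ U) (V : S.Opens) (hVV : V ≤ V₀) (hV : W ≤ f ⁻¹ᵁ V) (e : Γ(S, V)) :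
    P.ev hW (resO hV (f.app V e)) = resO hV (f.app V (θ.ev hVV e)) := by
  have hconstf : ∀ c, resO hU (f.app S₀ (constSec pS S₀ c)) = constSec (f ≫ pS) U c := by
    intro c
    refine eq_of_germ fun y hy => ?_
    have hyS : f y ∈ S₀ := hU hy
    rw [germ_resO, ← map_germ f y hyS, germ_constSec, germ_constSec, stalkMap_constHom]
  have hθconst : ∀ c, θ.ev hSV (constSec pS S₀ c) = 0 := fun c =>
    hθ.2.2.1 S₀ hSV ⊤ le_top _
  have hE : ∀ e : Γ(S, S₀), P.ev le_rfl (resO hU (f.app S₀ e))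
      = resO hU (f.app S₀ (θ.ev hSV e)) := by
    intro e
    let := (constSec pS S₀).toAlgebra
    have he : e ∈ Algebra.adjoin ℂ T := hT ▸ Algebra.mem_top
    induction he using Algebra.adjoin_induction with
    | mem e he => exact h e he
    | algebraMap c =>
      change P.ev le_rfl (resO hU (f.app S₀ (constSec pS S₀ c)))
        = resO hU (f.app S₀ (θ.ev hSV (constSec pS S₀ c)))
      rw [hconstf, hconst, hθconst, map_zero, map_zero]
    | add e e' _ _ ih ih' => rw [hθ.1]; simp only [map_add]; rw [hadd, ih, ih']
    | mul e e' _ _ ih ih' =>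
      rw [hθ.2.1]; simp only [map_add, map_mul]; rw [hmul, ih, ih']
  refine eq_of_germ fun y hy => ?_
  obtain ⟨D, hD⟩ := exists_stalk_derivation P hadd hmul (hW hy)
  obtain ⟨D', hD'⟩ := exists_stalk_derivation θ hθ.1 hθ.2.1 (hVV (hV hy))
  have hyS : f y ∈ S₀ := hU (hW hy)
  have hyV : f y ∈ V := hV hy
  let := (f.stalkMap y).hom.toAlgebra
  let := (S.presheaf.germ S₀ (f y) hyS).hom.toAlgebra
  have : IsLocalization.AtPrime (S.presheaf.stalk (f y)) (hS₀.primeIdealOf ⟨f y, hyS⟩).asIdeal :=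
    hS₀.isLocalization_stalk ⟨f y, hyS⟩
  -- The stalks of the base are localizations of `Γ(S, S₀)`.
  have key := derivation_eq_of_isLocalization (A := Γ(S, S₀))
    (hS₀.primeIdealOf ⟨f y, hyS⟩).asIdeal.primeCompl
    (D.compAlgebraMap (S.presheaf.stalk (f y)))
    ((Algebra.linearMap (S.presheaf.stalk (f y)) (X.presheaf.stalk y)).compDer D') (fun e => by
      change D (f.stalkMap y (S.presheaf.germ S₀ (f y) hyS e))
        = f.stalkMap y (D' (S.presheaf.germ S₀ (f y) hyS e))
      rw [hD' S₀ hSV, map_germ f y hyS, map_germ f y hyS, ← germ_resO hU (hW hy), hD U le_rfl, hE,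
        germ_resO]) (S.presheaf.germ V (f y) hyV e)
  change D (f.stalkMap y (S.presheaf.germ V (f y) hyV e))
    = f.stalkMap y (D' (S.presheaf.germ V (f y) hyV e)) at key
  rw [hD' V hVV, map_germ f y hyV, map_germ f y hyV, ← germ_resO hV hy, hD W hW] at key
  rw [key, germ_resO]

/-- Logarithmic derivations of the base lift locally to the total space. -/
lemma exists_lift_logDer {X S : Scheme.{0}} {f : X ⟶ S} {pS : S ⟶ Spec (CommRingCat.of ℂ)}
    {Δ : Closeds S} {Y : Closeds X} {d : ℕ} (hf : IsLogSmoothFamily f pS Δ Y d) {V₀ : S.Opens}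
    {θ : OpO S V₀} (hθ : θ ∈ logDer pS Δ V₀) (x : X) (hx : f x ∈ V₀) :
    ∃ (U : X.Opens) (_ : x ∈ U) (hU : U ≤ f ⁻¹ᵁ V₀), ∃ δ ∈ logDer (f ≫ pS) Y U,
      (toBase f).app U δ = pullOp f hU θ := by
  have := hf.smooth_base
  have := hf.smooth_total
  obtain ⟨N₁, hN₁, h₁, hh₁⟩ := exists_equation (f ≫ pS) hf.nc_total x
  obtain ⟨D, hDc, hDl, hDh⟩ := exists_lift_stalk hf hθ x hx hN₁ hh₁
  obtain ⟨_, ⟨S₀, hS₀, rfl⟩, hxS₀, hSV⟩ :=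
    S.isBasis_affineOpens.exists_subset_of_mem_open hx V₀.2
  replace hSV : S₀ ≤ V₀ := hSV
  obtain ⟨U₁, hxU₁, hUN, P, hadd, hmul, hconst, hP⟩ := exists_extension (f ≫ pS)
    (N := N₁ ⊓ f ⁻¹ᵁ S₀) ⟨hN₁, hxS₀⟩ D hDc
  have hU₁S : U₁ ≤ f ⁻¹ᵁ S₀ := hUN.trans inf_le_right
  have hU₁N : U₁ ≤ N₁ := hUN.trans inf_le_left
  obtain ⟨T, hT⟩ : ∃ T : Finset Γ(S, S₀),
      (letI := (constSec pS S₀).toAlgebra; Algebra.adjoin ℂ (T : Set Γ(S, S₀)) = ⊤) := by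
    let := (constSec pS S₀).toAlgebra
    have : Algebra.FiniteType ℂ Γ(S, S₀) := constSec_finiteType pS hS₀
    exact this.out
  obtain ⟨U₂, hxU₂, hU₂, h₂⟩ := exists_res_eq hxU₁ T
    (fun e => P.ev le_rfl (resO hU₁S (f.app S₀ e))) (fun e => resO hU₁S (f.app S₀ (θ.ev hSV e)))
    fun e _ => by
      rw [hP U₁ le_rfl hxU₁, germ_resO, germ_resO]
      exact hDl S₀ hSV hxS₀ e
  -- The equation of the divisor divides its derivative near `x`.
  obtain ⟨r, hr⟩ := hDh
  obtain ⟨V₁, hxV₁, t, rfl⟩ := X.presheaf.exists_germ_eq r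
  let U₃ := U₂ ⊓ V₁
  have hxU₃ : x ∈ U₃ := ⟨hxU₂, hxV₁⟩
  have hU₃ : U₃ ≤ U₁ := inf_le_left.trans hU₂
  obtain ⟨U, hxU, hU, h₃⟩ := exists_res_eq hxU₃ {()}
    (fun _ => P.ev hU₃ (resO (hU₃.trans hU₁N) h₁))
    (fun _ => resO (hU₃.trans hU₁N) h₁ * resO inf_le_right t) fun _ _ => by
      rw [hP U₃ hU₃ hxU₃, map_mul, germ_resO, germ_resO]
      exact hr
  replace h₃ := h₃ () (Finset.mem_singleton_self _)
  have hUU₁ : U ≤ U₁ := hU.trans hU₃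
  have hUS : U ≤ f ⁻¹ᵁ S₀ := hUU₁.trans hU₁S
  have hlift := lift_of_generators f pS hS₀ hSV hθ hUS (P.restrict hUU₁)
    (fun W h => hadd W (h.trans hUU₁)) (fun W h => hmul W (h.trans hUU₁))
    (fun W h => hconst W (h.trans hUU₁)) T hT fun e he => by
      have e1 := congrArg (resO (hU.trans inf_le_left : U ≤ U₂)) (h₂ e he)
      rw [resO_resO, resO_resO, resO_resO, ← P.ev_resO le_rfl hUU₁, resO_resO] at e1
      exact e1
  have hUV : U ≤ f ⁻¹ᵁ V₀ := fun y hy => hSV (hUS hy)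
  have hbase : ∀ (W : X.Opens) (hW : W ≤ U) (V : S.Opens) (hV : W ≤ f ⁻¹ᵁ V) (e : Γ(S, V)),
      (P.restrict hUU₁).ev hW (resO hV (f.app V e))
        = resO (show W ≤ f ⁻¹ᵁ (V₀ ⊓ V) from le_inf (hW.trans hUV) hV)
          (f.app (V₀ ⊓ V) (θ.ev inf_le_left (resO inf_le_right e))) := by
    intro W hW V hV e
    have hWV : W ≤ f ⁻¹ᵁ (V₀ ⊓ V) := le_inf (hW.trans hUV) hV
    exact (congrArg _ (app_resO f inf_le_right hWV e)).symm.trans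
      (hlift W hW (V₀ ⊓ V) inf_le_left hWV _)
  refine ⟨U, hxU, hUV, P.restrict hUU₁, ⟨fun W h => hadd W (h.trans hUU₁),
    fun W h => hmul W (h.trans hUU₁), fun W h V hV b => ?_, fun W h g hg => ?_⟩, ?_⟩
  · have := hbase W h (pS ⁻¹ᵁ V) hV (pS.app V b)
    rw [hθ.2.2.1 _ _ V inf_le_right b, map_zero, map_zero] at this
    rw [Scheme.Hom.comp_app]
    exact this
  · refine dvd_of_germ_dvd (stalk_isDomain (f ≫ pS)) _ _ fun y hy => ?_
    obtain ⟨Dy, hDy⟩ := exists_stalk_derivation P hadd hmul (hUU₁ (h hy))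
    obtain ⟨e1, e2⟩ := dvd_of_invertible_off (f ≫ pS) hf.nc_total (𝟙 X) hy (g := g)
      fun w hw hw' => hg w hw hw'
    refine ⟨e1, ?_⟩
    have hWN : W ≤ N₁ := h.trans (hUU₁.trans hU₁N)
    have := e2 (resO hWN h₁) (fun w hw => by
      rw [resO, Scheme.basicOpen_res]
      refine (hh₁ w (hWN hw)).trans (not_congr ⟨fun h => ⟨hw, h⟩, fun h => h.2⟩)) Dy (by
        rw [hDy W (h.trans hUU₁)]
        refine map_dvd _ ?_
        have e3 := congrArg (resO h) h₃
        rw [map_mul, map_mul, resO_resO, resO_resO, resO_resO, resO_resO, resO_resO,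
          ← P.ev_resO hU₃ (h.trans hU), resO_resO] at e3
        exact ⟨_, e3⟩)
    rw [hDy W (h.trans hUU₁)] at this
    exact this
  · refine Subtype.ext (funext fun W => funext fun z => ?_)
    exact hbase W.1 W.2 z.1.1 z.2 z.1.2

/-! ### Connecting morphisms of right derived functors -/

section Connecting

variable {C D : Type*} [Category* C] [Category* D] [Abelian C] [Abelian D]

/-- `toResolution` is induced by the differential of the resolution. -/
lemma g_toResolution {S : ShortComplex C} (h : S.ShortExact) (I : InjectiveResolution S.X₁) :
    have := h.mono_f
    S.g ≫ toResolution h I = Injective.factorThru (resι I) S.f ≫ I.cocomplex.d 0 1 := by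
  have := h.mono_f
  have := h.epi_g
  exact h.exact.g_desc _ _

/-- The middle term of a short exact sequence is the fibre product of its right term and of the
term of degree zero of an injective resolution. -/
lemma isPullback_toResolution {S : ShortComplex C} (h : S.ShortExact)
    (I : InjectiveResolution S.X₁) :
    have := h.mono_f
    IsPullback (Injective.factorThru (resι I) S.f) S.g (I.cocomplex.d 0 1) (toResolution h I) := by
  have := h.mono_f
  have := h.epi_g
  have hf : S.f ≫ Injective.factorThru (resι I) S.f = resι I := Injective.comp_factorThru _ _
  have w := (g_toResolution h I).symm
  have hι : Mono (resι I) := inferInstanceAs (Mono (I.ι.f 0))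
  let l := pullback.lift (f := I.cocomplex.d 0 1) (g := toResolution h I) _ _ w
  have hl1 : l ≫ pullback.fst _ _ = Injective.factorThru (resι I) S.f := pullback.lift_fst _ _ _
  have hl2 : l ≫ pullback.snd _ _ = S.g := pullback.lift_snd _ _ _
  have : Mono l := by
    refine Preadditive.mono_of_cancel_zero _ fun a ha => ?_
    have h2 : a ≫ S.g = 0 := by rw [← hl2, reassoc_of% ha, zero_comp]
    have h1 : a ≫ Injective.factorThru (resι I) S.f = 0 := by rw [← hl1, reassoc_of% ha, zero_comp]
    have e := h.exact.lift_f a h2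
    rw [← e, Category.assoc, hf] at h1
    rw [← e, zero_of_comp_mono _ h1, zero_comp]
  have : Epi l := by
    rw [epi_iff_surjective_up_to_refinements]
    intro A y
    obtain ⟨A', π, hπ, x, hx⟩ := surjective_up_to_refinements_of_epi S.g (y ≫ pullback.snd _ _)
    have hz : (π ≫ y ≫ pullback.fst _ _ - x ≫ Injective.factorThru (resι I) S.f) ≫
        I.cocomplex.d 0 1 = 0 := by
      rw [Preadditive.sub_comp, Category.assoc, Category.assoc, Category.assoc, w,
        pullback.condition, reassoc_of% hx, sub_self]
    let k : A' ⟶ S.X₁ := I.exact₀.lift _ hz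
    have hk : k ≫ resι I = _ := I.exact₀.lift_f _ hz
    refine ⟨A', π, hπ, x + k ≫ S.f, ?_⟩
    refine pullback.hom_ext ?_ ?_
    · rw [Category.assoc, Category.assoc, hl1, Preadditive.add_comp, Category.assoc, hf, hk,
        add_sub_cancel]
    · rw [Category.assoc, Category.assoc, hl2, Preadditive.add_comp, Category.assoc, S.zero,
        comp_zero, add_zero, hx]
  have : IsIso l := isIso_of_mono_of_epi l
  exact IsPullback.of_iso_pullback ⟨w⟩ (asIso l) hl1 hl2

lemma comp_liftCycles_homologyπ (K : CochainComplex D ℕ) {Z Z' R : D} (x : Z ⟶ K.X 1)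
    (hx : x ≫ K.d 1 2 = 0) (y : Z' ⟶ Z) (r : K.homology 1 ⟶ R) :
    y ≫ K.liftCycles x 2 (by simp) hx ≫ K.homologyπ 1 ≫ r
      = (K.liftCycles (y ≫ x) 2 (by simp) (by rw [Category.assoc, hx, comp_zero]) ≫
        K.homologyπ 1) ≫ r := by
  rw [HomologicalComplex.comp_liftCycles_assoc, Category.assoc]

lemma liftCycles_homologyπ_naturality {K K' : CochainComplex D ℕ} (ψ : K ⟶ K') {Z R R' : D}
    (x : Z ⟶ K.X 1) (hx : x ≫ K.d 1 2 = 0) (r : K.homology 1 ⟶ R) (r' : K'.homology 1 ⟶ R')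
    (ρ : R ⟶ R') (h : r ≫ ρ = HomologicalComplex.homologyMap ψ 1 ≫ r') :
    (K.liftCycles x 2 (by simp) hx ≫ K.homologyπ 1 ≫ r) ≫ ρ
      = (K'.liftCycles (x ≫ ψ.f 1) 2 (by simp)
          (by rw [Category.assoc, ψ.comm, ← Category.assoc, hx, zero_comp]) ≫
        K'.homologyπ 1) ≫ r' := by
  rw [Category.assoc, Category.assoc, h, HomologicalComplex.homologyπ_naturality_assoc,
    HomologicalComplex.liftCycles_comp_cyclesMap_assoc, Category.assoc]

variable [HasInjectiveResolutions C] (F : C ⥤ D) [F.Additive]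

/-- The connecting morphism is natural. -/
lemma connectingHom_naturality {S S' : ShortComplex C} (h : S.ShortExact) (h' : S'.ShortExact)
    (φ : S ⟶ S') :
    F.map φ.τ₃ ≫ connectingHom F h' = connectingHom F h ≫ (F.rightDerived 1).map φ.τ₁ := by
  have := h.mono_f
  have := h'.mono_f
  have := h.epi_g
  let I := injectiveResolution S.X₁
  let J := injectiveResolution S'.X₁
  let ψ : I.cocomplex ⟶ J.cocomplex := InjectiveResolution.desc φ.τ₁ J I
  have hψ : I.ι.f 0 ≫ ψ.f 0 = φ.τ₁ ≫ J.ι.f 0 := InjectiveResolution.desc_commutes_zero _ _ _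
  let a := Injective.factorThru (resι I) S.f
  let b := Injective.factorThru (resι J) S'.f
  have ha : S.f ≫ a = resι I := Injective.comp_factorThru _ _
  have hb : S'.f ≫ b = resι J := Injective.comp_factorThru _ _
  -- The two extensions of `X₁ ⟶ J⁰` to `X₂` differ by a map on `X₃`.
  have hz : S.f ≫ (φ.τ₂ ≫ b - a ≫ ψ.f 0) = 0 := by
    rw [Preadditive.comp_sub, ← Category.assoc, ← Category.assoc, ← φ.comm₁₂, ha, Category.assoc,
      hb, sub_eq_zero]
    exact hψ.symm
  let u : S.X₃ ⟶ J.cocomplex.X 0 := h.exact.desc _ hz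
  have hu : S.g ≫ u = φ.τ₂ ≫ b - a ≫ ψ.f 0 := h.exact.g_desc _ hz
  have key : φ.τ₃ ≫ toResolution h' J = toResolution h I ≫ ψ.f 1 + u ≫ J.cocomplex.d 0 1 := by
    rw [← cancel_epi S.g, Preadditive.comp_add, ← Category.assoc, ← Category.assoc,
      ← Category.assoc, ← φ.comm₂₃, hu, Category.assoc, g_toResolution h' J, g_toResolution h I,
      Preadditive.sub_comp, Category.assoc, Category.assoc, Category.assoc, ψ.comm 0 1,
      add_sub_cancel]
  have nat := InjectiveResolution.isoRightDerivedObj_inv_naturality φ.τ₁ I J ψ hψ F 1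
  let K' := (F.mapHomologicalComplex (ComplexShape.up ℕ)).obj J.cocomplex
  have w₁ : (F.map φ.τ₃ ≫ F.map (toResolution h' J)) ≫ F.map (J.cocomplex.d 1 2) = 0 := by
    rw [← F.map_comp, ← F.map_comp, Category.assoc, toResolution_d, comp_zero, F.map_zero]
  have w₂ : (F.map (toResolution h I) ≫ F.map (ψ.f 1)) ≫ F.map (J.cocomplex.d 1 2) = 0 := by
    rw [← F.map_comp, ← F.map_comp, Category.assoc, ψ.comm, ← Category.assoc, toResolution_d,
      zero_comp, F.map_zero]
  have w₃ : F.map (toResolution h I) ≫ F.map (I.cocomplex.d 1 2) = 0 := by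
    rw [← F.map_comp, toResolution_d, F.map_zero]
  have fin := (K'.liftCycles_comp_homologyπ_eq_iff_up_to_refinements 0 1 2 (by simp) (by simp)
    (F.map φ.τ₃ ≫ F.map (toResolution h' J)) (F.map (toResolution h I) ≫ F.map (ψ.f 1)) w₁ w₂).2
    ⟨_, 𝟙 _, inferInstance, F.map u, by
      rw [Category.id_comp, Category.id_comp]
      have := congrArg F.map key
      rwa [F.map_add, F.map_comp, F.map_comp, F.map_comp] at this⟩
  calc F.map φ.τ₃ ≫ connectingHom F h'
      = (K'.liftCycles (i := 1) (F.map φ.τ₃ ≫ F.map (toResolution h' J)) 2 (by simp) w₁ ≫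
          K'.homologyπ 1) ≫ (J.isoRightDerivedObj F 1).inv :=
        comp_liftCycles_homologyπ K' _ _ _ _
    _ = (K'.liftCycles (i := 1) (F.map (toResolution h I) ≫ F.map (ψ.f 1)) 2 (by simp) w₂ ≫
          K'.homologyπ 1) ≫ (J.isoRightDerivedObj F 1).inv := congrArg (· ≫ _) fin
    _ = connectingHom F h ≫ (F.rightDerived 1).map φ.τ₁ :=
        (liftCycles_homologyπ_naturality ((F.mapHomologicalComplex (ComplexShape.up ℕ)).map ψ)
          (F.map (toResolution h I)) w₃ _ _ _ nat).symm

/-- Sections which lift are killed by the connecting morphism. -/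
lemma map_g_connectingHom {S : ShortComplex C} (h : S.ShortExact) :
    F.map S.g ≫ connectingHom F h = 0 := by
  have := h.mono_f
  let I := injectiveResolution S.X₁
  let K := (F.mapHomologicalComplex (ComplexShape.up ℕ)).obj I.cocomplex
  have w : F.map (toResolution h I) ≫ F.map (I.cocomplex.d 1 2) = 0 := by
    rw [← F.map_comp, toResolution_d, F.map_zero]
  refine (comp_liftCycles_homologyπ K (F.map (toResolution h I)) w (F.map S.g)
    (I.isoRightDerivedObj F 1).inv).trans ?_
  refine (congrArg (· ≫ _) ((K.liftCycles_comp_homologyπ_eq_zero_iff_up_to_refinements 0 1 2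
    (by simp) (by simp) _ _).2
    ⟨_, 𝟙 _, inferInstance, F.map (Injective.factorThru (resι I) S.f), ?_⟩)).trans zero_comp
  rw [Category.id_comp]
  have := congrArg F.map (g_toResolution h I)
  rwa [F.map_comp, F.map_comp] at this

/-- A section killed by the connecting morphism lifts locally. -/
lemma exists_lift_of_connectingHom [PreservesFiniteLimits F] {S : ShortComplex C}
    (h : S.ShortExact) {Z : D} (x : Z ⟶ F.obj S.X₃) (hx : x ≫ connectingHom F h = 0) :
    ∃ (Z' : D) (π : Z' ⟶ Z) (_ : Epi π) (y : Z' ⟶ F.obj S.X₂), y ≫ F.map S.g = π ≫ x := by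
  have := h.mono_f
  let I := injectiveResolution S.X₁
  let K := (F.mapHomologicalComplex (ComplexShape.up ℕ)).obj I.cocomplex
  have w : F.map (toResolution h I) ≫ F.map (I.cocomplex.d 1 2) = 0 := by
    rw [← F.map_comp, toResolution_d, F.map_zero]
  have hx' := (comp_liftCycles_homologyπ K (F.map (toResolution h I)) w x
    (I.isoRightDerivedObj F 1).inv).symm.trans hx
  obtain ⟨Z', π, hπ, y, hy⟩ := (K.liftCycles_comp_homologyπ_eq_zero_iff_up_to_refinements 0 1 2
    (by simp) (by simp) _ _).1 ((cancel_mono (I.isoRightDerivedObj F 1).inv).1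
      (hx'.trans zero_comp.symm))
  let P := (isPullback_toResolution h I).map F
  have hy' : y ≫ F.map (I.cocomplex.d 0 1) = (π ≫ x) ≫ F.map (toResolution h I) := by
    rw [Category.assoc]; exact hy.symm
  exact ⟨Z', π, hπ, P.lift y (π ≫ x) hy', P.lift_snd _ _ _⟩

/-- Let `D` be an extension of `T` by `O`, embedded in `W`, such that the connecting morphism of `F`
for `D` is an isomorphism `F T ⟶ R¹F O`. Sections of the quotients `P₁ / D` and `P₂ / D`, where `P₁`
and `P₂` map to `W` compatibly with `D`, whose obstructions in `R¹F T` cancel, lift locally to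
sections of `W`. -/
theorem exists_lift_of_obstruction_eq_zero [PreservesFiniteLimits F] {E A₁ A₂ : ShortComplex C}
    (hE : E.ShortExact) (h₁ : A₁.ShortExact) (h₂ : A₂.ShortExact) [IsIso (connectingHom F hE)]
    {W : C} (i : E.X₂ ⟶ W) [Mono i] (a₁ : A₁.X₁ ≅ E.X₂) (a₂ : A₂.X₁ ≅ E.X₂)
    (j₁ : A₁.X₂ ⟶ W) (j₂ : A₂.X₂ ⟶ W) (hj₁ : A₁.f ≫ j₁ = a₁.hom ≫ i)
    (hj₂ : A₂.f ≫ j₂ = a₂.hom ≫ i) {Z : D} (e₁ : Z ⟶ F.obj A₁.X₃) (e₂ : Z ⟶ F.obj A₂.X₃)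
    (he : e₁ ≫ connectingHom F h₁ ≫ (F.rightDerived 1).map (a₁.hom ≫ E.g)
      + e₂ ≫ connectingHom F h₂ ≫ (F.rightDerived 1).map (a₂.hom ≫ E.g) = 0) :
    ∃ (Z' : D) (π : Z' ⟶ Z) (_ : Epi π) (y : Z' ⟶ F.obj W), ∀ {V : C} (v : W ⟶ V)
      (c₁ : A₁.X₃ ⟶ V) (c₂ : A₂.X₃ ⟶ V), i ≫ v = 0 → j₁ ≫ v = A₁.g ≫ c₁ → j₂ ≫ v = A₂.g ≫ c₂ →
      y ≫ F.map v = π ≫ (e₁ ≫ F.map c₁ + e₂ ≫ F.map c₂) := by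
  have := hE.mono_f
  have := hE.epi_g
  have := h₁.epi_g
  have := h₂.epi_g
  let m := E.f ≫ i
  have hm : Mono m := mono_comp _ _
  -- the sequence `0 ⟶ O ⟶ W ⟶ W / O ⟶ 0`
  let SW : ShortComplex C := ShortComplex.mk m (cokernel.π m) (cokernel.condition m)
  have hSW : SW.ShortExact :=
    { exact := ShortComplex.exact_of_g_is_cokernel _ (cokernelIsCokernel m) }
  -- the sequence `0 ⟶ T ⟶ W / O ⟶ W / D ⟶ 0`
  let t : E.X₃ ⟶ cokernel m := hE.exact.desc (i ≫ cokernel.π m) (by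
    rw [← Category.assoc]; exact cokernel.condition m)
  have ht : E.g ≫ t = i ≫ cokernel.π m := hE.exact.g_desc _ _
  let p : cokernel m ⟶ cokernel i := cokernel.desc m (cokernel.π i) (by
    rw [Category.assoc, cokernel.condition, comp_zero])
  have hp : cokernel.π m ≫ p = cokernel.π i := cokernel.π_desc _ _ _
  have htp : t ≫ p = 0 := by
    rw [← cancel_epi E.g, ← Category.assoc, ht, Category.assoc, hp, cokernel.condition, comp_zero]
  have htm : Mono t := by
    refine Preadditive.mono_of_cancel_zero _ fun a ha => ?_
    obtain ⟨Z, π, hπ, b, hb⟩ := surjective_up_to_refinements_of_epi E.g a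
    have h0 : (b ≫ i) ≫ cokernel.π m = 0 := by
      rw [Category.assoc, ← ht, ← Category.assoc, ← hb, Category.assoc, ha, comp_zero]
    have h1 := hSW.exact.lift_f (b ≫ i) h0
    have h2 : hSW.exact.lift (b ≫ i) h0 ≫ E.f = b := by
      rw [← cancel_mono i, Category.assoc]; exact h1
    rw [← cancel_epi π, comp_zero, hb, ← h2, Category.assoc, E.zero, comp_zero]
  let SN : ShortComplex C := ShortComplex.mk t p htp
  have hpe : Epi p := epi_of_epi_fac hp
  have hSN : SN.ShortExact :=
    { exact := ShortComplex.exact_of_g_is_cokernel _ (CokernelCofork.IsColimit.ofπ _ _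
        (fun k hk => cokernel.desc i (cokernel.π m ≫ k) (by
          rw [← Category.assoc, ← ht, Category.assoc]
          exact (congrArg _ hk).trans comp_zero))
        (fun k hk => by
          rw [← cancel_epi (cokernel.π m), ← Category.assoc, hp, cokernel.π_desc])
        (fun k hk l hl => by
          rw [← cancel_epi (cokernel.π i), cokernel.π_desc, ← hl, ← hp, Category.assoc])) }
  have quot : ∀ (A : ShortComplex C) (_ : A.ShortExact) (a : A.X₁ ≅ E.X₂) (j : A.X₂ ⟶ W)
      (_ : A.f ≫ j = a.hom ≫ i), ∃ r : A.X₃ ⟶ cokernel i, A.g ≫ r = j ≫ cokernel.π i := by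
    intro A hA a j hj
    have := hA.epi_g
    refine ⟨hA.exact.desc (j ≫ cokernel.π i) ?_, hA.exact.g_desc _ _⟩
    rw [← Category.assoc, hj, Category.assoc, cokernel.condition, comp_zero]
  obtain ⟨r₁, hr₁⟩ := quot A₁ h₁ a₁ j₁ hj₁
  obtain ⟨r₂, hr₂⟩ := quot A₂ h₂ a₂ j₂ hj₂
  have n₁ := connectingHom_naturality F h₁ hSN
    (ShortComplex.homMk (a₁.hom ≫ E.g) (j₁ ≫ cokernel.π m) r₁
      (by change (a₁.hom ≫ E.g) ≫ t = A₁.f ≫ j₁ ≫ cokernel.π m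
          rw [Category.assoc, ht, reassoc_of% hj₁])
      (by change (j₁ ≫ cokernel.π m) ≫ p = A₁.g ≫ r₁
          rw [Category.assoc, hp, hr₁]))
  have n₂ := connectingHom_naturality F h₂ hSN
    (ShortComplex.homMk (a₂.hom ≫ E.g) (j₂ ≫ cokernel.π m) r₂
      (by change (a₂.hom ≫ E.g) ≫ t = A₂.f ≫ j₂ ≫ cokernel.π m
          rw [Category.assoc, ht, reassoc_of% hj₂])
      (by change (j₂ ≫ cokernel.π m) ≫ p = A₂.g ≫ r₂
          rw [Category.assoc, hp, hr₂]))
  change F.map r₁ ≫ connectingHom F hSN = connectingHom F h₁ ≫ (F.rightDerived 1).map (a₁.hom ≫ E.g)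
    at n₁
  change F.map r₂ ≫ connectingHom F hSN = connectingHom F h₂ ≫ (F.rightDerived 1).map (a₂.hom ≫ E.g)
    at n₂
  have n₃ := connectingHom_naturality F hE hSW (ShortComplex.homMk (𝟙 _) i t
    (by change 𝟙 _ ≫ m = _; rw [Category.id_comp]) ht.symm)
  change F.map t ≫ connectingHom F hSW = connectingHom F hE ≫ (F.rightDerived 1).map (𝟙 _) at n₃
  rw [CategoryTheory.Functor.map_id, Category.comp_id] at n₃
  rw [← n₁, ← n₂, ← Category.assoc, ← Category.assoc, ← Preadditive.add_comp] at he
  obtain ⟨Z₁, π₁, hπ₁, y₁, hy₁⟩ := exists_lift_of_connectingHom F hSN _ he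
  change Z₁ ⟶ F.obj (cokernel m) at y₁
  change y₁ ≫ F.map p = _ at hy₁
  -- The lift to `W / O` is corrected by a section of `T` so as to lift to `W`.
  let y₂ : Z₁ ⟶ F.obj E.X₃ := y₁ ≫ connectingHom F hSW ≫ inv (connectingHom F hE)
  let y₃ : Z₁ ⟶ F.obj (cokernel m) := y₁ - y₂ ≫ F.map t
  obtain ⟨Z₂, π₂, hπ₂, y, hy⟩ := exists_lift_of_connectingHom F hSW y₃ (by
      change (y₁ - y₂ ≫ F.map t) ≫ connectingHom F hSW = 0
      rw [Preadditive.sub_comp, Category.assoc, n₃, Category.assoc, Category.assoc,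
        IsIso.inv_hom_id, Category.comp_id, sub_self])
  change y ≫ F.map (cokernel.π m) = _ at hy
  refine ⟨Z₂, π₂ ≫ π₁, epi_comp _ _, y, fun {V} v c₁ c₂ hv hv₁ hv₂ => ?_⟩
  let v' : cokernel i ⟶ V := cokernel.desc i v hv
  have hv' : cokernel.π i ≫ v' = v := cokernel.π_desc _ _ _
  have hrc₁ : r₁ ≫ v' = c₁ := by
    rw [← cancel_epi A₁.g, ← Category.assoc, hr₁, Category.assoc, hv', hv₁]
  have hrc₂ : r₂ ≫ v' = c₂ := by
    rw [← cancel_epi A₂.g, ← Category.assoc, hr₂, Category.assoc, hv', hv₂]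
  have e : v = cokernel.π m ≫ p ≫ v' := by rw [← Category.assoc, hp, hv']
  rw [e, F.map_comp, ← Category.assoc, hy, Category.assoc, Preadditive.sub_comp, Category.assoc,
    ← F.map_comp t, ← Category.assoc t, htp, zero_comp, F.map_zero, comp_zero, sub_zero, F.map_comp,
    Category.assoc, reassoc_of% hy₁, ← hrc₁, ← hrc₂, F.map_comp, F.map_comp]
  simp only [Category.assoc, Preadditive.add_comp]

/-- The sequence `A ⟶ p⁻¹(C₀) ⟶ C₀` whose connecting morphism is `connecting`. -/
abbrev pullbackComplex {A B E C₀ : C} (i : A ⟶ B) (p : B ⟶ E) (w : i ≫ p = 0) (c : C₀ ⟶ E) :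
    ShortComplex C :=
  ShortComplex.mk (pullback.lift i (0 : A ⟶ C₀) (by rw [w, zero_comp]) : A ⟶ pullback p c)
    (pullback.snd p c) (pullback.lift_snd _ _ _)

lemma connecting_eq {A B E C₀ : C} {i : A ⟶ B} {p : B ⟶ E} {w : i ≫ p = 0} {c : C₀ ⟶ E}
    (h : (pullbackComplex i p w c).ShortExact) : connecting F i p w c = connectingHom F h :=
  dif_pos h

/-- The connecting morphism of `connecting` is natural in the sequence. The third terms are compared
in the direction opposite to the other two, along a monomorphism. -/
lemma connecting_naturality {A B E A' B' E' C₀ : C} {i : A ⟶ B} {p : B ⟶ E} {w : i ≫ p = 0}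
    {c : C₀ ⟶ E} {i' : A' ⟶ B'} {p' : B' ⟶ E'} {w' : i' ≫ p' = 0} {c' : C₀ ⟶ E'}
    (h : (pullbackComplex i p w c).ShortExact) (h' : (pullbackComplex i' p' w' c').ShortExact)
    (φ : A ⟶ A') (ψ : B ⟶ B') (m : E' ⟶ E) [Mono m] (h₁ : i ≫ ψ = φ ≫ i')
    (h₂ : ψ ≫ p' ≫ m = p) (h₃ : c' ≫ m = c) :
    connecting F i p w c ≫ (F.rightDerived 1).map φ = connecting F i' p' w' c' := by
  let τ₂ : pullback p c ⟶ pullback p' c' :=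
    pullback.lift (pullback.fst _ _ ≫ ψ) (pullback.snd _ _) (by
      rw [← cancel_mono m, Category.assoc, Category.assoc, Category.assoc, h₂, h₃,
        pullback.condition])
  have nat := connectingHom_naturality F h h' (ShortComplex.homMk φ τ₂ (𝟙 _) (by
      change _ ≫ pullback.lift _ _ _ = pullback.lift _ _ _ ≫ τ₂
      refine pullback.hom_ext ?_ ?_
      · rw [Category.assoc, Category.assoc, pullback.lift_fst, pullback.lift_fst,
          pullback.lift_fst_assoc, h₁]
      · rw [Category.assoc, Category.assoc, pullback.lift_snd, pullback.lift_snd,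
          pullback.lift_snd, comp_zero])
      (by
        change τ₂ ≫ pullback.snd _ _ = pullback.snd _ _ ≫ 𝟙 _
        rw [pullback.lift_snd, Category.comp_id]))
  rw [connecting_eq F h, connecting_eq F h']
  refine nat.symm.trans ?_
  exact (congrArg (· ≫ _) (F.map_id _)).trans (Category.id_comp _)

/-- The form of `exists_lift_of_obstruction_eq_zero` for the sequences defining `connecting`: the
two obstructions cancel, and the lift is described by its two symbols `v₁` and `v₂`. -/
lemma exists_lift_of_connecting [PreservesFiniteLimits F] {O M T B₁ E₁ C₁ B₂ E₂ C₂ W : C}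
    {m : O ⟶ M} {s : M ⟶ T} {w : m ≫ s = 0} (hE : (pullbackComplex m s w (𝟙 T)).ShortExact)
    (hiso : IsIso (connecting F m s w (𝟙 T)))
    {i₁ : M ⟶ B₁} {p₁ : B₁ ⟶ E₁} {w₁ : i₁ ≫ p₁ = 0} {c₁ : C₁ ⟶ E₁}
    (h₁ : (pullbackComplex i₁ p₁ w₁ c₁).ShortExact)
    {i₂ : M ⟶ B₂} {p₂ : B₂ ⟶ E₂} {w₂ : i₂ ≫ p₂ = 0} {c₂ : C₂ ⟶ E₂}
    (h₂ : (pullbackComplex i₂ p₂ w₂ c₂).ShortExact)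
    (k₁ : B₁ ⟶ W) (k₂ : B₂ ⟶ W) (hk : i₁ ≫ k₁ = i₂ ≫ k₂) (hm : Mono (i₂ ≫ k₂))
    (v₁ : W ⟶ E₁) (v₂ : W ⟶ E₂) (h₁₁ : k₁ ≫ v₁ = p₁) (h₁₂ : k₁ ≫ v₂ = 0) (h₂₁ : k₂ ≫ v₁ = 0)
    (h₂₂ : k₂ ≫ v₂ = p₂) {Z : D} (e₁ : Z ⟶ F.obj C₁) (e₂ : Z ⟶ F.obj C₂)
    (he : e₁ ≫ connecting F i₁ p₁ w₁ c₁ ≫ (F.rightDerived 1).map s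
      + e₂ ≫ connecting F i₂ p₂ w₂ c₂ ≫ (F.rightDerived 1).map s = 0) :
    ∃ (Z' : D) (π : Z' ⟶ Z) (_ : Epi π) (y : Z' ⟶ F.obj W),
      y ≫ F.map v₁ = π ≫ e₁ ≫ F.map c₁ ∧ y ≫ F.map v₂ = π ≫ e₂ ≫ F.map c₂ := by
  have hiso' : IsIso (connectingHom F hE) := by rwa [connecting_eq F hE] at hiso
  rw [connecting_eq F h₁, connecting_eq F h₂] at he
  let a := pullback.fst s (𝟙 T)
  have ha : IsIso a := inferInstance
  have has : inv a ≫ pullback.snd s (𝟙 T) = s := by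
    rw [IsIso.inv_comp_eq]
    exact (Category.comp_id _).symm.trans pullback.condition.symm
  have hi : Mono (a ≫ i₂ ≫ k₂) := mono_comp _ _
  obtain ⟨Z', π, hπ, y, hy⟩ := exists_lift_of_obstruction_eq_zero F hE h₁ h₂ (a ≫ i₂ ≫ k₂)
    (asIso a).symm (asIso a).symm (pullback.fst _ _ ≫ k₁) (pullback.fst _ _ ≫ k₂) (by
      change pullback.lift _ _ _ ≫ pullback.fst _ _ ≫ _ = inv a ≫ a ≫ _
      rw [pullback.lift_fst_assoc, IsIso.inv_hom_id_assoc, hk])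
    (by
      change pullback.lift _ _ _ ≫ pullback.fst _ _ ≫ _ = inv a ≫ a ≫ _
      rw [pullback.lift_fst_assoc, IsIso.inv_hom_id_assoc])
    e₁ e₂ (by
      change e₁ ≫ connectingHom F h₁ ≫ (F.rightDerived 1).map (inv a ≫ pullback.snd _ _)
        + e₂ ≫ connectingHom F h₂ ≫ (F.rightDerived 1).map (inv a ≫ pullback.snd _ _) = 0
      rw [has]
      exact he)
  refine ⟨Z', π, hπ, y, ?_, ?_⟩
  · have := hy v₁ c₁ 0 (by rw [Category.assoc, Category.assoc, h₂₁, comp_zero, comp_zero])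
      (by rw [Category.assoc, h₁₁, pullback.condition])
      (by rw [Category.assoc, h₂₁, comp_zero, comp_zero])
    rwa [F.map_zero, comp_zero, add_zero] at this
  · have := hy v₂ 0 c₂ (by
        rw [← hk, Category.assoc, Category.assoc, h₁₂, comp_zero, comp_zero])
      (by rw [Category.assoc, h₁₂, comp_zero, comp_zero])
      (by rw [Category.assoc, h₂₂, pullback.condition])
    rwa [F.map_zero, comp_zero, zero_add] at this

/-- If `connecting` is injective on `F T`, then maps which lift vanish. -/
lemma map_eq_zero_of_connecting {O M T : C} {m : O ⟶ M} {s : M ⟶ T} {w : m ≫ s = 0}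
    (hE : (pullbackComplex m s w (𝟙 T)).ShortExact)
    (hmono : Mono (connecting F m s w (𝟙 T))) : F.map s = 0 := by
  have h := map_g_connectingHom F hE
  rw [← connecting_eq F hE] at h
  have h' : F.map (pullback.snd s (𝟙 T)) = 0 := (cancel_mono _).1 (h.trans zero_comp.symm)
  have has : inv (pullback.fst s (𝟙 T)) ≫ pullback.snd s (𝟙 T) = s := by
    rw [IsIso.inv_comp_eq]
    exact (Category.comp_id _).symm.trans pullback.condition.symm
  rw [← has, F.map_comp, h', comp_zero]

end Connecting

/-! ### Exact sequences of sheaves from sections -/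

section Sheaves

variable {X : Scheme.{0}}

lemma mono_of_injective {A B : TopCat.Sheaf AddCommGrpCat.{0} X} (i : A ⟶ B)
    (hi : ∀ U, Function.Injective (i.hom.app U)) : Mono i := by
  refine ⟨fun g h e => ?_⟩
  refine Sheaf.hom_ext (NatTrans.ext (funext fun U => ?_))
  ext s
  exact hi U (ConcreteCategory.congr_hom (congrArg (fun k => k.hom.app U) e) s)

/-- A morphism of sheaves which is injective on sections and whose image on sections is the kernel
of `p` is a kernel of `p`. -/
lemma exists_factor {A B E Z : TopCat.Sheaf AddCommGrpCat.{0} X} (i : A ⟶ B) (p : B ⟶ E)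
    (hi : ∀ U, Function.Injective (i.hom.app U))
    (hk : ∀ U (b : B.obj.obj U), p.hom.app U b = 0 → ∃ a, i.hom.app U a = b)
    (k : Z ⟶ B) (h : k ≫ p = 0) : ∃ l : Z ⟶ A, l ≫ i = k := by
  have h' : ∀ U (s : Z.obj.obj U), p.hom.app U (k.hom.app U s) = 0 := fun U s =>
    ConcreteCategory.congr_hom (congrArg (fun k => k.hom.app U) h) s
  choose l hl using fun U s => hk U _ (h' U s)
  let l' : ∀ U, Z.obj.obj U →+ A.obj.obj U := fun U =>
    { toFun := l U
      map_zero' := by apply hi; rw [hl, map_zero, map_zero]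
      map_add' := fun s t => by apply hi; rw [hl, map_add, map_add, hl, hl] }
  have nat : ∀ {U V} (r : U ⟶ V), Z.obj.map r ≫ AddCommGrpCat.ofHom (l' V)
      = AddCommGrpCat.ofHom (l' U) ≫ A.obj.map r := by
    intro U V r
    ext s
    apply hi V
    change i.hom.app V (l V (Z.obj.map r s)) = i.hom.app V (A.obj.map r (l U s))
    rw [hl, NatTrans.naturality_apply, NatTrans.naturality_apply, hl]
  let N : Z.obj ⟶ A.obj := NatTrans.mk (fun U => AddCommGrpCat.ofHom (l' U)) fun _ _ r => nat r
  refine ⟨⟨N⟩, Sheaf.hom_ext (NatTrans.ext (funext fun U => ?_))⟩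
  ext s
  exact hl U s

/-- The functor of sections over an open set. -/
def sectionsFunctor (T : TopCat.{0}) (V : Opens T) :
    TopCat.Sheaf AddCommGrpCat.{0} T ⥤ AddCommGrpCat.{0} :=
  sheafToPresheaf (Opens.grothendieckTopology T) AddCommGrpCat.{0} ⋙
    (evaluation _ _).obj (op V)

instance (T : TopCat.{0}) (V : Opens T) :
    PreservesLimitsOfShape WalkingCospan (sectionsFunctor T V) :=
  have : PreservesLimitsOfShape WalkingCospan
      (sheafToPresheaf (Opens.grothendieckTopology T) AddCommGrpCat.{0}) :=
    preservesLimitOfShape_of_createsLimitsOfShape_and_hasLimitsOfShape _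
  show PreservesLimitsOfShape WalkingCospan
      (sheafToPresheaf (Opens.grothendieckTopology T) AddCommGrpCat.{0} ⋙
        (evaluation (Opens T)ᵒᵖ AddCommGrpCat.{0}).obj (op V)) from
    comp_preservesLimitsOfShape _ _

/-- The projection of a fibre product of sheaves is an epimorphism if sections of the base lift
locally. -/
lemma epi_pullback_snd {B E C : TopCat.Sheaf AddCommGrpCat.{0} X} (p : B ⟶ E) (c : C ⟶ E)
    (hs : ∀ (U : X.Opens) (s : C.obj.obj (op U)), ∀ x ∈ U, ∃ (V : X.Opens) (_ : x ∈ V) (hV : V ≤ U)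
      (b : B.obj.obj (op V)), p.hom.app (op V) b = c.hom.app (op V) (C.obj.map (homOfLE hV).op s)) :
    Epi (pullback.snd p c) := by
  rw [← TopCat.Sheaf.isLocallySurjective_iff_epi, TopCat.Presheaf.isLocallySurjective_iff]
  intro U s x hx
  obtain ⟨V, hxV, hV, b, hb⟩ := hs U s x hx
  let G := sectionsFunctor X.toTopCat V
  have P := (IsPullback.of_hasPullback p c).map G
  let t : AddCommGrpCat.of ℤ ⟶ G.obj B := AddCommGrpCat.ofHom (zmultiplesHom (B.obj.obj (op V)) b)
  let u : AddCommGrpCat.of ℤ ⟶ G.obj C :=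
    AddCommGrpCat.ofHom (zmultiplesHom (C.obj.obj (op V)) (C.obj.map (homOfLE hV).op s))
  have htu : t ≫ G.map p = u ≫ G.map c := by
    ext
    change p.hom.app (op V) ((1 : ℤ) • b)
      = c.hom.app (op V) ((1 : ℤ) • C.obj.map (homOfLE hV).op s)
    rw [one_zsmul, one_zsmul, hb]
  refine ⟨V, hV, ⟨P.lift t u htu (1 : ℤ), ?_⟩, hxV⟩
  refine (ConcreteCategory.congr_hom (P.lift_snd t u htu) (1 : ℤ)).trans ?_
  exact one_zsmul (C.obj.map (homOfLE hV).op s)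

/-- A criterion on sections for `0 ⟶ A ⟶ p⁻¹(C) ⟶ C ⟶ 0` to be exact. -/
lemma pullback_shortExact {A B E : X.Modules} {C : TopCat.Sheaf AddCommGrpCat.{0} X} (i : A ⟶ B)
    (p : B ⟶ E) (c : C ⟶ (toAb X).obj E) (hi : ∀ U, Function.Injective (i.app U))
    (hk : ∀ U (b : Γ(B, U)), p.app U b = 0 → ∃ a, i.app U a = b)
    (hs : ∀ (U : X.Opens) (s : C.obj.obj (op U)), ∀ x ∈ U, ∃ (V : X.Opens) (_ : x ∈ V) (hV : V ≤ U)
      (b : Γ(B, V)), p.app V b = c.hom.app (op V) (C.obj.map (homOfLE hV).op s))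
    (w : (toAb X).map i ≫ (toAb X).map p = 0) :
    (pullbackComplex ((toAb X).map i) ((toAb X).map p) w c).ShortExact := by
  have hi' : Mono ((toAb X).map i) := mono_of_injective _ fun U => hi U.unop
  have hm : Mono (pullback.lift ((toAb X).map i) 0 (by rw [w, zero_comp]) :
      (toAb X).obj A ⟶ pullback ((toAb X).map p) c) :=
    mono_of_mono_fac (pullback.lift_fst ((toAb X).map i) 0 (by rw [w, zero_comp]))
  have he : Epi (pullback.snd ((toAb X).map p) c) := epi_pullback_snd _ _ hs
  refine { exact := ?_, mono_f := hm, epi_g := he }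
  rw [ShortComplex.exact_iff_exact_up_to_refinements]
  intro Z x hx
  change Z ⟶ pullback ((toAb X).map p) c at x
  change x ≫ pullback.snd _ _ = 0 at hx
  obtain ⟨l, hl⟩ := exists_factor ((toAb X).map i) ((toAb X).map p) (fun U => hi U.unop)
    (fun U => hk U.unop) (x ≫ pullback.fst _ _) (by
      rw [Category.assoc, pullback.condition, ← Category.assoc, hx, zero_comp])
  refine ⟨Z, 𝟙 _, inferInstance, l, ?_⟩
  change 𝟙 _ ≫ x = l ≫ pullback.lift _ _ _
  rw [Category.id_comp]
  refine pullback.hom_ext ?_ ?_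
  · rw [Category.assoc, pullback.lift_fst, hl]
  · rw [Category.assoc, pullback.lift_snd, hx, comp_zero]

/-- Epimorphisms of sheaves of modules are surjective locally on sections. -/
lemma exists_of_epi {M N : X.Modules} (φ : M ⟶ N) [Epi φ] {U : X.Opens} (s : Γ(N, U)) (x : X)
    (hx : x ∈ U) : ∃ (V : X.Opens) (_ : x ∈ V) (hV : V ≤ U) (t : Γ(M, V)),
      φ.app V t = res N hV s := by
  -- The subsheaf of sections which lie locally in the image is all of `N`.
  let R : ∀ U : X.Opens, Submodule Γ(X, U) Γ(N, U) := fun U =>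
    { carrier := Set.range (φ.app U)
      add_mem' := by
        rintro _ _ ⟨a, rfl⟩ ⟨b, rfl⟩
        exact ⟨a + b, map_add _ _ _⟩
      zero_mem' := ⟨0, map_zero _⟩
      smul_mem' := by
        rintro c _ ⟨a, rfl⟩
        exact ⟨c • a, Scheme.Modules.Hom.app_smul _ _ _⟩ }
  let l : M ⟶ locSub R := locSubLift R φ fun U s x hx =>
    ⟨U, hx, le_rfl, fun W hW => ⟨res M hW s, app_res φ hW s⟩⟩
  have hl : l ≫ locSubι R = φ := rfl
  have : Epi (locSubι R) := epi_of_epi_fac hl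
  have : Mono (locSubι R) := by
    refine ⟨fun g h e => hom_ext_app fun U s => Subtype.ext ?_⟩
    exact ConcreteCategory.congr_hom (congrArg (fun k : _ ⟶ N => k.app U) e) s
  have : IsIso (locSubι R) := isIso_of_mono_of_epi _
  have hmem := locSubι_mem R ((inv (locSubι R)).app U s)
  have : (locSubι R).app U ((inv (locSubι R)).app U s) = s :=
    ConcreteCategory.congr_hom
      (congrArg (fun k : N ⟶ N => k.app U) (IsIso.inv_hom_id (locSubι R))) s
  rw [this] at hmem
  obtain ⟨V, hxV, hV, h⟩ := hmem x hx
  obtain ⟨t, ht⟩ := h V le_rfl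
  exact ⟨V, hxV, hV, t, ht⟩

end Sheaves

/-! ### Operators on line bundles and their symbols -/

section LineBundleOperators

variable {X S B : Scheme.{0}}

/-- A section which lies locally in the image of an injective morphism lies in the image. -/
lemma exists_section_of_local {M N : X.Modules} (φ : M ⟶ N)
    (hφ : ∀ U, Function.Injective (φ.app U)) {U : X.Opens} (s : Γ(N, U))
    (h : ∀ x ∈ U, ∃ (V : X.Opens) (_ : x ∈ V) (hV : V ≤ U) (t : Γ(M, V)),
      φ.app V t = res N hV s) : ∃ t, φ.app U t = s := by
  choose V hx hV t ht using fun x : U => h x x.2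
  obtain ⟨t', ht'⟩ := exists_glue M V hV (fun x hx' => Opens.mem_iSup.2 ⟨⟨x, hx'⟩, hx _⟩) t (by
    intro i j
    apply hφ
    rw [app_res, app_res, ht, ht, res_res, res_res])
  refine ⟨t', eq_of_res N _ _ fun x hx' => ⟨V ⟨x, hx'⟩, hx _, hV _, ?_⟩⟩
  rw [← app_res, ht', ht]

lemma app_res_eq_zero {M N : X.Modules} (φ : M ⟶ N) {U V : X.Opens} (h : V ≤ U) {s : Γ(M, U)}
    (hs : φ.app U s = 0) : φ.app V (res M h s) = 0 := by
  rw [app_res, hs, map_zero]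

/-- If the elements of `N` in the kernel of `φ` belong to `N'`, the same holds for the sections
which belong to `N` locally. -/
lemma LocSub.of_forall {M K : X.Modules} {N N' : ∀ U : X.Opens, Submodule Γ(X, U) Γ(M, U)}
    (φ : M ⟶ K) (h : ∀ U, ∀ m ∈ N U, φ.app U m = 0 → m ∈ N' U) {U : X.Opens} {m : Γ(M, U)}
    (hm : m ∈ LocSub M N U) (h0 : φ.app U m = 0) : m ∈ LocSub M N' U := by
  intro x hx
  obtain ⟨V, hxV, hV, hl⟩ := hm x hx
  refine ⟨V, hxV, hV, fun W hW => h W _ (hl W hW) (app_res_eq_zero _ _ h0)⟩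

lemma locSubι_injective {M : X.Modules} (N : ∀ U : X.Opens, Submodule Γ(X, U) Γ(M, U))
    (U : X.Opens) : Function.Injective ((locSubι N).app U) := fun _ _ e => Subtype.ext e

lemma mem_locSub {M : X.Modules} {N : ∀ U : X.Opens, Submodule Γ(X, U) Γ(M, U)} {U : X.Opens}
    {m : Γ(M, U)} (h : ∀ (W : X.Opens) (hW : W ≤ U), res M hW m ∈ N W) : m ∈ LocSub M N U :=
  fun _ hx => ⟨U, hx, le_rfl, h⟩

lemma symb1_apply {L : X.Modules} {U : X.Opens} {D : Op L U} (h : (symb1 L).app U D = 0)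
    {W : X.Opens} (hW : W ≤ U) (a : Γ(X, W)) (s : Γ(L, W)) : D.ev hW (a • s) = a • D.ev hW s :=
  sub_eq_zero.1 (congrArg (fun t : LocMap (inProd (inO X) (inM L)) L U => t.1 ⟨W, hW⟩ (a, s)) h)

lemma mulOp_injective {L : X.Modules} (hL : IsLineBundle L) (U : X.Opens) :
    Function.Injective ((mulOp L).app U) := by
  intro c c' e
  refine eq_of_res (OX X) _ _ fun x hx => ?_
  obtain ⟨W, hxW, s, hs⟩ := hL x
  refine ⟨U ⊓ W, ⟨hx, hxW⟩, inf_le_left, (hs (U ⊓ W) inf_le_right).1 ?_⟩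
  exact congrArg (fun D : Op L U => D.ev inf_le_left (res L inf_le_right s)) e

/-- Operators on a line bundle which commute with functions are functions. -/
lemma exists_mulOp_eq {L : X.Modules} (hL : IsLineBundle L) {U : X.Opens} (D : Op L U)
    (h : (symb1 L).app U D = 0) : ∃ c : Γ(X, U), (mulOp L).app U c = D := by
  refine exists_section_of_local (mulOp L) (mulOp_injective hL) D fun x hx => ?_
  obtain ⟨W, hxW, s, hs⟩ := hL x
  obtain ⟨c, hc⟩ := (hs (U ⊓ W) inf_le_right).2 (D.ev inf_le_left (res L inf_le_right s))
  refine ⟨U ⊓ W, ⟨hx, hxW⟩, inf_le_left, c, Op.ext fun V hV u => ?_⟩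
  obtain ⟨g, rfl⟩ := (hs V (hV.trans inf_le_right)).2 u
  change resO hV c • g • res L (hV.trans inf_le_right) s
    = D.ev (hV.trans inf_le_left) (g • res L (hV.trans inf_le_right) s)
  have e := congrArg (res L hV) hc
  change res L hV (c • _) = _ at e
  rw [res_smul, res_res, ← D.ev_res, res_res] at e
  rw [symb1_apply h, ← e, smul_comm]

/-- An operator on functions gives an operator on a trivialised line bundle. -/
lemma exists_corresponds {L : X.Modules} {V : X.Opens} {s : Γ(L, V)} (hs : IsGenerator L s)
    (P : OpO X V) : ∃ D : Op L V, Corresponds D le_rfl s P := by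
  choose c hc using fun (W : {W : X.Opens // W ≤ V}) (u : Γ(L, W.1)) => (hs W.1 W.2).2 u
  refine ⟨⟨fun W u => P.ev W.2 (c W u) • res L W.2 s, fun W W' hW h u => ?_⟩, fun W hW g => ?_⟩
  · have e : c ⟨W', h.trans hW⟩ (res L h u) = resO h (c ⟨W, hW⟩ u) := by
      refine (hs W' (h.trans hW)).1 ((hc _ _).trans ?_)
      have := congrArg (res L h) (hc ⟨W, hW⟩ u)
      change res L h (c ⟨W, hW⟩ u • res L hW s) = res L h u at this
      rw [res_smul, res_res] at this
      exact this.symm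
    change P.ev (h.trans hW) (c ⟨W', h.trans hW⟩ (res L h u)) • res L (h.trans hW) s
      = res L h (P.ev hW (c ⟨W, hW⟩ u) • res L hW s)
    rw [e, P.ev_resO hW h, res_smul, res_res]
  · exact congrArg (fun k => P.ev hW k • res L hW s) ((hs W hW).1 (hc ⟨W, hW⟩ (g • res L hW s)))

variable {q : X ⟶ B} {Z : Set X}

lemma IsDO.comp_mul {k : ℕ} : ∀ {U : X.Opens} (c : Γ(X, U)) {P : OpO X U}, IsDO q Z k U P →
    IsDO q Z k U (P.comp (.mul c)) := by
  induction k with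
  | zero =>
    rintro U c P ⟨d, rfl⟩
    exact ⟨d * c, OpO.ext fun W h a => by simp [mul_assoc]⟩
  | succ k ih =>
    intro U c P hP
    refine ⟨fun x hx => ?_, fun W h a => ?_⟩
    · obtain ⟨V, hxV, hV, h⟩ := hP.1 x hx
      exact ⟨V, hxV, hV, .comp _ _ h ((Gen.mul c).restrict hV)⟩
    · convert ih (resO h c) (hP.2 W h a) using 1
      refine OpO.ext fun W' h' b => ?_
      simp only [OpO.comm_ev, OpO.restrict_ev, OpO.comp_ev, OpO.mul_ev, resO_resO]
      rw [mul_left_comm]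

lemma isDO_one_of_mem_logDer {U : X.Opens} {δ : OpO X U} (hδ : δ ∈ logDer q Z U) :
    IsDO q Z 1 U δ := by
  refine ⟨fun x hx => ⟨U, hx, le_rfl, .der _ (logDer_restrict q Z le_rfl hδ)⟩, fun W h a =>
    ⟨δ.ev h a, OpO.ext fun W' h' b => ?_⟩⟩
  rw [OpO.comm_ev, OpO.restrict_ev, OpO.restrict_ev, hδ.2.1, OpO.mul_ev, ← δ.ev_resO h h']
  ring

/-- The product of two logarithmic derivations is an operator of order two. -/
lemma isDO_two_of_mem_logDer {U : X.Opens} {δ δ' : OpO X U} (hδ : δ ∈ logDer q Z U)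
    (hδ' : δ' ∈ logDer q Z U) : IsDO q Z 2 U (δ.comp δ') := by
  refine ⟨fun x hx => ⟨U, hx, le_rfl, .comp _ _ (.der _ (logDer_restrict q Z le_rfl hδ))
    (.der _ (logDer_restrict q Z le_rfl hδ'))⟩, fun W h a => ?_⟩
  have : ((δ.comp δ').restrict h).comm a = OpO.mul (δ.ev h (δ'.ev h a))
      + (δ.ev h a • δ'.restrict h + δ'.ev h a • δ.restrict h) := by
    refine OpO.ext fun W' h' b => ?_
    simp only [OpO.comm_ev, OpO.restrict_ev, OpO.comp_ev, OpO.mul_ev, OpO.add_ev, OpO.smul_ev,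
      ← δ.ev_resO h h', ← δ'.ev_resO h h']
    rw [hδ'.2.1, hδ.1, hδ.2.1, hδ.2.1]
    ring
  rw [this]
  exact (IsDO.mul 1 _).add
    (((isDO_one_of_mem_logDer (logDer_restrict q Z h hδ')).smul _).add
      ((isDO_one_of_mem_logDer (logDer_restrict q Z h hδ)).smul _))

/-- The order of an operator may be computed in a single trivialisation. -/
lemma mem_logDO_of_corresponds {L : X.Modules} {k : ℕ} {V : X.Opens} {s : Γ(L, V)}
    (hs : IsGenerator L s) {P : OpO X V} (hP : IsDO q Z k V P) {D : Op L V}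
    (hD : Corresponds D le_rfl s P) : D ∈ logDO q Z L k V := by
  intro W hW s' hs'
  obtain ⟨u, hu⟩ := (hs W hW).2 s'
  obtain ⟨v, hv⟩ := (hs' W le_rfl).2 (res L hW s)
  change u • res L hW s = s' at hu
  change v • res L le_rfl s' = res L hW s at hv
  rw [res_self] at hv
  -- In the trivialisation `s' = u s`, with `s = v s'`, the operator `P` becomes `v P u`.
  refine ⟨v • (P.restrict hW).comp (.mul u), ((hP.restrict hW).comp_mul u).smul v,
    fun W' h' g => ?_⟩
  have hu' : resO h' u • res L (h'.trans hW) s = res L h' s' := by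
    rw [← hu, res_smul, res_res]
  have hv' : resO h' v • res L h' s' = res L (h'.trans hW) s := by
    rw [← res_smul, hv, res_res]
  have e := hD W' (h'.trans hW) (resO h' u * g)
  rw [OpO.smul_ev, OpO.comp_ev, OpO.mul_ev, OpO.restrict_ev, mul_comm, mul_smul, hv', ← e,
    mul_comm, mul_smul, hu']

/-- A second order operator whose second order symbol vanishes is of first order. -/
lemma mem_logDO_one_of_symb2 {L : X.Modules} {U : X.Opens} {D : Op L U}
    (hD : D ∈ logDO q Z L 2 U) (h0 : (symb2 L).app U D = 0) : D ∈ logDO q Z L 1 U := by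
  intro W hW s hs
  obtain ⟨P, hP, hc⟩ := hD W hW s hs
  refine ⟨P, ⟨hP.1, fun W₁ h₁ a => ⟨P.ev h₁ a - a * P.ev h₁ 1, OpO.ext fun W₂ h₂ b => ?_⟩⟩, hc⟩
  have key : ∀ a b : Γ(X, W₂), P.ev (h₂.trans h₁) (a * b) - a * P.ev (h₂.trans h₁) b
      - b * P.ev (h₂.trans h₁) a + a * b * P.ev (h₂.trans h₁) 1 = 0 := by
    intro a b
    have e := congrArg (fun t : LocMap (inProd (inProd (inO X) (inO X)) (inM L)) L U =>
      t.1 ⟨W₂, (h₂.trans h₁).trans hW⟩ ((a, b), (1 : Γ(X, W₂)) • res L (h₂.trans h₁) s)) h0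
    change D.ev ((h₂.trans h₁).trans hW) ((a * b) • (1 : Γ(X, W₂)) • res L (h₂.trans h₁) s)
      - a • D.ev ((h₂.trans h₁).trans hW) (b • (1 : Γ(X, W₂)) • res L (h₂.trans h₁) s)
      - b • D.ev ((h₂.trans h₁).trans hW) (a • (1 : Γ(X, W₂)) • res L (h₂.trans h₁) s)
      + (a * b) • D.ev ((h₂.trans h₁).trans hW) ((1 : Γ(X, W₂)) • res L (h₂.trans h₁) s) = 0 at e
    rw [← mul_smul, ← mul_smul, ← mul_smul, mul_one, mul_one, mul_one, hc, hc, hc, hc, ← mul_smul,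
      ← mul_smul, ← mul_smul, ← sub_smul, ← sub_smul, ← add_smul] at e
    refine (hs W₂ (h₂.trans h₁)).1 (e.trans ?_)
    exact (zero_smul _ _).symm
  have k := key (resO h₂ a) b
  simp only [OpO.comm_ev, OpO.restrict_ev, OpO.mul_ev, map_sub, map_mul, ← P.ev_resO h₁ h₂, map_one]
  linear_combination k

lemma symb2_eq_zero {L : X.Modules} (hL : IsLineBundle L) {U : X.Opens} {D : Op L U}
    (hD : D ∈ LocSub (opSheaf L) (logDO q Z L 1) U) : (symb2 L).app U D = 0 :=
  congrArg (fun k : logD q Z L 1 ⟶ _ => k.app U (⟨D, hD⟩ : LocSub (opSheaf L) (logDO q Z L 1) U))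
    (incD_symb2 q Z hL)

variable (f : X ⟶ S) {pS : S ⟶ B} {Y : Set X}

lemma symbBase_eq_zero {L : X.Modules} (hL : IsLineBundle L) {k : ℕ} {U : X.Opens} {D : Op L U}
    (hD : D ∈ LocSub (opSheaf L) (logDO f Y L k) U) : (symbBase f L).app U D = 0 :=
  Subtype.ext (funext fun W => funext fun z =>
    sub_eq_zero.2 ((logDO_lin hL hD).2 W.1 W.2 z.1.1.1 z.1.2 z.1.1.2 z.2))

/-- A first order operator on `X` which commutes with functions on the base is an operator relative
to the base. -/
lemma mem_logDO_of_symbBase {L : X.Modules} {U : X.Opens} {D : Op L U}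
    (hD : D ∈ logDO (f ≫ pS) Y L 1 U) (h0 : (symbBase f L).app U D = 0) :
    D ∈ logDO f Y L 1 U := by
  intro W hW s hs
  obtain ⟨P, hP, hc⟩ := hD W hW s hs
  refine ⟨P, ⟨fun x hx => ?_, hP.2⟩, hc⟩
  obtain ⟨V, hxV, hV, hG⟩ := hP.1 x hx
  obtain ⟨δ, hδ, hδP⟩ := exists_logDer (hP.restrict hV) hG
  refine ⟨V, hxV, hV, ?_⟩
  -- A first order operator is a derivation plus the multiplication with its value at `1`.
  have e : P.restrict hV = δ + .mul ((P.restrict hV).ev le_rfl 1) := by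
    refine OpO.ext fun W' h' a => ?_
    have := hδP W' h' a 1
    rw [mul_one, mul_one, sub_eq_iff_eq_add] at this
    rw [OpO.add_ev, OpO.mul_ev, ← OpO.ev_resO _ le_rfl h', map_one, this, mul_comm a]
  rw [e]
  refine .add _ _ (.der _ ⟨hδ.1, hδ.2.1, fun W' h' V' hV' b => ?_, hδ.2.2.2⟩) (.mul _)
  have e1 := hδP W' h' (resO hV' (f.app V' b)) 1
  rw [mul_one, mul_one] at e1
  rw [← e1]
  have hW' : W' ≤ W := h'.trans hV
  have e2 := congrArg (fun t : LocMap (inProd (inPull f) (inM L)) L U =>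
    t.1 ⟨W', hW'.trans hW⟩ (⟨⟨V', b⟩, hV'⟩, (1 : Γ(X, W')) • res L hW' s)) h0
  change D.ev (hW'.trans hW) (resO hV' (f.app V' b) • (1 : Γ(X, W')) • res L hW' s)
    - resO hV' (f.app V' b) • D.ev (hW'.trans hW) ((1 : Γ(X, W')) • res L hW' s) = 0 at e2
  rw [← mul_smul, mul_one, hc, hc, ← mul_smul, ← sub_smul] at e2
  exact (hs W' hW').1 (e2.trans (zero_smul _ _).symm)

/-- The operators in `𝒲` both of whose symbols vanish are the first order operators relative to the
base. -/
lemma mem_of_symbols_eq_zero {L : X.Modules} (hL : IsLineBundle L) {U : X.Opens} {D : Op L U}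
    (hD : D ∈ LocSub (opSheaf L) (heatSum f pS Y L) U) (h1 : (symbBase f L).app U D = 0)
    (h2 : (symb2 L).app U D = 0) : D ∈ LocSub (opSheaf L) (logDO f Y L 1) U := by
  refine LocSub.mem_of_cover _ fun x hx => ?_
  obtain ⟨V, hxV, hV, h⟩ := hD x hx
  refine ⟨V, hxV, hV, ?_⟩
  obtain ⟨D₁, hD₁, D₂, hD₂, e⟩ := Submodule.mem_sup.1 (h V le_rfl)
  have k1 : (symbBase f L).app V (D₁ + D₂) = 0 :=
    (congrArg ((symbBase f L).app V) e).trans (app_res_eq_zero _ hV h1)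
  have k2 : (symb2 L).app V (D₁ + D₂) = 0 :=
    (congrArg ((symb2 L).app V) e).trans (app_res_eq_zero _ hV h2)
  rw [map_add, symb2_eq_zero hL hD₁, zero_add] at k2
  have hD₂' := LocSub.of_forall (symb2 L) (fun U m hm => mem_logDO_one_of_symb2 hm) hD₂ k2
  rw [map_add, symbBase_eq_zero f hL hD₂', add_zero] at k1
  have hD₁' := LocSub.of_forall (symbBase f L) (fun U m hm => mem_logDO_of_symbBase f hm) hD₁ k1
  change res (opSheaf L) hV D ∈ LocSub (opSheaf L) (logDO f Y L 1) V
  rw [← show D₁ + D₂ = res (opSheaf L) hV D from e]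
  exact add_mem hD₁' hD₂'

end LineBundleOperators

/-! ### The exact sequences of logarithmic operators -/

section ExactSequences

variable {X S B : Scheme.{0}}

/-- A section of the subsheaf defined by `N`. -/
def locSubMk {M : X.Modules} (N : ∀ U : X.Opens, Submodule Γ(X, U) Γ(M, U)) {U : X.Opens}
    (m : Γ(M, U)) (h : m ∈ LocSub M N U) : Γ(locSub N, U) :=
  (⟨m, h⟩ : LocSub M N U)

lemma locSubMap_injective {M : X.Modules} {N N' : ∀ U : X.Opens, Submodule Γ(X, U) Γ(M, U)}
    (h : ∀ U, N U ≤ N' U) (U : X.Opens) : Function.Injective ((locSubMap h).app U) := by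
  intro m m' e
  have e' : (locSubι N).app U m = (locSubι N).app U m' := congrArg ((locSubι N').app U) e
  exact locSubι_injective N U e'

lemma logDer_mem_locSub {q : X ⟶ B} {Z : Set X} {U : X.Opens} {δ : OpO X U}
    (hδ : δ ∈ logDer q Z U) : δ ∈ LocSub (locMap (inO X) (OX X)) (logDer q Z) U :=
  mem_locSub (M := locMap (inO X) (OX X)) fun _ hW => logDer_restrict q Z hW hδ

lemma logDO_mem_locSub {q : X ⟶ B} {Z : Set X} {L : X.Modules} {k : ℕ} {U : X.Opens} {D : Op L U}
    (hD : D ∈ logDO q Z L k U) : D ∈ LocSub (opSheaf L) (logDO q Z L k) U :=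
  mem_locSub (M := opSheaf L) fun _ hW W' hW' s hs => hD W' (hW'.trans hW) s hs

/-! ### Symbols of operators on a trivialised line bundle -/

section Symbols

variable {L : X.Modules} {V : X.Opens} {s : Γ(L, V)} {D : Op L V}

/-- Under a trivialisation of `L`, the symbol of the operator given by a derivation is that
derivation. -/
lemma symb1_of_corresponds (hs : IsGenerator L s) {q : X ⟶ B} {Z : Set X} {δ : OpO X V}
    (hδ : δ ∈ logDer q Z V)
    (hD : Corresponds D le_rfl s δ) : (symb1 L).app V D = (actOn (inO X) L).app V δ := by
  refine Subtype.ext (funext fun W => funext fun z => ?_)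
  obtain ⟨a, u⟩ := z
  change Γ(X, W.1) at a
  change Γ(L, W.1) at u
  obtain ⟨g, rfl⟩ := (hs W.1 W.2).2 u
  change D.ev W.2 (a • g • res L W.2 s) - a • D.ev W.2 (g • res L W.2 s)
    = δ.ev W.2 a • g • res L W.2 s
  rw [← mul_smul, hD W.1 W.2, hD W.1 W.2, ← mul_smul, ← mul_smul, ← sub_smul, hδ.2.1]
  congr 1
  ring

lemma symbBase_of_corresponds (hs : IsGenerator L s) (f : X ⟶ S) {q : X ⟶ B} {Z : Set X}
    {δ : OpO X V} (hδ : δ ∈ logDer q Z V) (hD : Corresponds D le_rfl s δ) :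
    (symbBase f L).app V D = (actOn (inPull f) L).app V ((toBase f).app V δ) := by
  refine Subtype.ext (funext fun W => funext fun z => ?_)
  obtain ⟨⟨⟨V', b⟩, hz⟩, u⟩ := z
  exact congrArg (fun t : LocMap (inProd (inO X) (inM L)) L V =>
    t.1 W (resO hz (f.app V' b), u)) (symb1_of_corresponds hs hδ hD)

lemma symb2_of_corresponds (hs : IsGenerator L s) {q : X ⟶ B} {Z : Set X} {δ δ' : OpO X V}
    (hδ : δ ∈ logDer q Z V) (hδ' : δ' ∈ logDer q Z V) (hD : Corresponds D le_rfl s (δ.comp δ')) :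
    (symb2 L).app V D = (actOn (inProd (inO X) (inO X)) L).app V (symProd δ δ') := by
  refine Subtype.ext (funext fun W => funext fun z => ?_)
  obtain ⟨⟨a, b⟩, u⟩ := z
  change Γ(X, W.1) at a b
  change Γ(L, W.1) at u
  obtain ⟨g, rfl⟩ := (hs W.1 W.2).2 u
  change D.ev W.2 ((a * b) • g • res L W.2 s) - a • D.ev W.2 (b • g • res L W.2 s)
      - b • D.ev W.2 (a • g • res L W.2 s) + (a * b) • D.ev W.2 (g • res L W.2 s)
    = (δ.ev W.2 a * δ'.ev W.2 b + δ'.ev W.2 a * δ.ev W.2 b) • g • res L W.2 s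
  rw [← mul_smul, ← mul_smul, ← mul_smul, hD W.1 W.2, hD W.1 W.2, hD W.1 W.2, hD W.1 W.2,
    ← mul_smul, ← mul_smul, ← mul_smul, ← mul_smul, ← sub_smul, ← sub_smul, ← add_smul]
  congr 1
  simp only [OpO.comp_ev, hδ'.2.1, hδ.1, hδ.2.1]
  ring

/-- Sections of the symmetric square are the second order symbols of operators on a trivialised line
bundle. -/
lemma exists_symb2_eq (hs : IsGenerator L s) {f : X ⟶ S} {Y : Set X} {φ : Γ(biOp X, V)}
    (hφ : φ ∈ symSpan f Y V) :
    ∃ D ∈ logDO f Y L 2 V,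
      (symb2 L).app V D = (actOn (inProd (inO X) (inO X)) L).app V φ := by
  induction hφ using Submodule.span_induction with
  | mem φ h =>
    obtain ⟨δ, hδ, δ', hδ', rfl⟩ := h
    obtain ⟨D, hD⟩ := exists_corresponds hs (δ.comp δ')
    exact ⟨D, mem_logDO_of_corresponds hs (isDO_two_of_mem_logDer hδ hδ') hD,
      symb2_of_corresponds hs hδ hδ' hD⟩
  | zero => exact ⟨0, zero_mem _, (map_zero ((symb2 L).app V).hom).trans
      (map_zero ((actOn (inProd (inO X) (inO X)) L).app V).hom).symm⟩
  | add φ ψ _ _ ih ih' =>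
    obtain ⟨D, hD, e⟩ := ih
    obtain ⟨D', hD', e'⟩ := ih'
    exact ⟨D + D', add_mem hD hD', (map_add ((symb2 L).app V).hom D D').trans
      ((congrArg₂ (· + ·) e e').trans
        (map_add ((actOn (inProd (inO X) (inO X)) L).app V).hom φ ψ).symm)⟩
  | smul c φ _ ih =>
    obtain ⟨D, hD, e⟩ := ih
    exact ⟨c • D, Submodule.smul_mem _ c hD, (Scheme.Modules.Hom.app_smul (symb2 L) c D).trans
      ((congrArg (c • ·) e).trans
        (Scheme.Modules.Hom.app_smul (actOn (inProd (inO X) (inO X)) L) c φ).symm)⟩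

end Symbols

/-! ### First order operators -/

lemma symb1_eq_zero_of_sigma1 {f : X ⟶ S} {Y : Set X} {L : X.Modules} (hL : IsLineBundle L)
    {U : X.Opens} {D : Γ(logD f Y L 1, U)} (h : (sigma1 f Y hL).app U D = 0) :
    (symb1 L).app U ((logDι f Y L 1).app U D) = 0 := by
  have e := congrArg (fun k : logD f Y L 1 ⟶ locMap (inProd (inO X) (inM L)) L => k.app U D)
    (sigma1_spec f Y hL)
  refine e.symm.trans ?_
  change (logTι f Y ≫ actOn (inO X) L).app U ((sigma1 f Y hL).app U D) = 0
  rw [h, map_zero]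

lemma mulD_injective (f : X ⟶ S) (Y : Set X) {L : X.Modules} (hL : IsLineBundle L)
    (U : X.Opens) : Function.Injective ((mulD f Y L).app U) := by
  intro c c' e
  have e' : (mulOp L).app U c = (mulOp L).app U c' := congrArg ((logDι f Y L 1).app U) e
  exact mulOp_injective hL U e'

lemma exists_mulD_eq {f : X ⟶ S} {Y : Set X} {L : X.Modules} (hL : IsLineBundle L)
    {U : X.Opens} {D : Γ(logD f Y L 1, U)} (h : (sigma1 f Y hL).app U D = 0) :
    ∃ c : Γ(X, U), (mulD f Y L).app U c = D := by
  obtain ⟨c, hc⟩ := exists_mulOp_eq hL _ (symb1_eq_zero_of_sigma1 hL h)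
  exact ⟨c, Subtype.ext hc⟩

lemma exists_sigma1_eq {f : X ⟶ S} {Y : Set X} {L : X.Modules} (hL : IsLineBundle L)
    {U : X.Opens} (δ : Γ(logT f Y, U)) (x : X) (hx : x ∈ U) :
    ∃ (V : X.Opens) (_ : x ∈ V) (hV : V ≤ U) (D : Γ(logD f Y L 1, V)),
      (sigma1 f Y hL).app V D = res (logT f Y) hV δ := by
  obtain ⟨V, hxV, hV, h⟩ := locSubι_mem (M := locMap (inO X) (OX X)) (logDer f Y) δ x hx
  obtain ⟨W, hxW, s, hs⟩ := hL x
  have hs' := hs.res (inf_le_right : V ⊓ W ≤ W)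
  have hδ := h (V ⊓ W) inf_le_left
  let δ' : OpO X (V ⊓ W) := logT.toOp f Y (res (logT f Y) (inf_le_left.trans hV) δ)
  have hδ' : δ' ∈ logDer f Y (V ⊓ W) := hδ
  obtain ⟨D, hD⟩ := exists_corresponds hs' δ'
  let D' : Γ(logD f Y L 1, V ⊓ W) := locSubMk (M := opSheaf L) _ D (logDO_mem_locSub
    (mem_logDO_of_corresponds hs' (isDO_one_of_mem_logDer hδ') hD))
  have e₁ : (logTι f Y ≫ actOn (inO X) L).app (V ⊓ W) ((sigma1 f Y hL).app (V ⊓ W) D')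
      = (symb1 L).app (V ⊓ W) D :=
    congrArg (fun k : logD f Y L 1 ⟶ locMap (inProd (inO X) (inM L)) L => k.app (V ⊓ W) D')
      (sigma1_spec f Y hL)
  have e₂ : (logTι f Y ≫ actOn (inO X) L).app (V ⊓ W) (res (logT f Y) (inf_le_left.trans hV) δ)
      = (actOn (inO X) L).app (V ⊓ W) δ' := rfl
  exact ⟨V ⊓ W, ⟨hxV, hxW⟩, inf_le_left.trans hV, D', logTι_actOn_injective f Y hL _
    (e₁.trans ((symb1_of_corresponds hs' hδ' hD).trans e₂.symm))⟩

/-- The sequence `0 ⟶ 𝒪_X ⟶ 𝒟¹_{X/S}(L) ⟶ T_{X/S}(log Y) ⟶ 0` is exact. -/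
lemma sigma1_shortExact (f : X ⟶ S) (Y : Set X) {L : X.Modules} (hL : IsLineBundle L)
    (w : (toAb X).map (mulD f Y L) ≫ (toAb X).map (sigma1 f Y hL) = 0) :
    (pullbackComplex ((toAb X).map (mulD f Y L))
      ((toAb X).map (sigma1 f Y hL)) w
      (𝟙 _)).ShortExact :=
  pullback_shortExact _ _ _
    (mulD_injective f Y hL)
    (fun _ _ h => exists_mulD_eq hL h) (fun _ δ x hx => exists_sigma1_eq hL δ x hx) w

/-- The sequence `0 ⟶ 𝒟¹_{X/S}(L) ⟶ 𝒟²_{X/S}(L) ⟶ S²T_{X/S}(log Y) ⟶ 0` is exact. -/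
lemma symb2_shortExact (f : X ⟶ S) (Y : Set X) {L : X.Modules} (hL : IsLineBundle L)
    (w : (toAb X).map (incD f Y L) ≫ (toAb X).map (logDι f Y L 2 ≫ symb2 L) = 0) :
    (pullbackComplex ((toAb X).map (incD f Y L))
      ((toAb X).map (logDι f Y L 2 ≫ symb2 L)) w
      ((toAb X).map (symTι f Y ≫ actOn (inProd (inO X) (inO X)) L))).ShortExact := by
  refine pullback_shortExact (incD f Y L) _ _
    (locSubMap_injective (M := opSheaf L) _)
    (fun U D h => ?_) (fun U φ x hx => ?_) w
  · have hD := LocSub.of_forall (M := opSheaf L) (symb2 L)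
      (N' := logDO f Y L 1) (fun U m hm => mem_logDO_one_of_symb2 hm)
      (locSubι_mem (M := opSheaf L) (logDO f Y L 2) D) h
    exact ⟨locSubMk (M := opSheaf L) _ _ hD, rfl⟩
  · obtain ⟨V, hxV, hV, h⟩ := locSubι_mem (M := biOp X) (symSpan f Y) (U := U) φ x hx
    obtain ⟨W, hxW, s, hs⟩ := hL x
    obtain ⟨D, hD, e⟩ := exists_symb2_eq (hs.res (inf_le_right : V ⊓ W ≤ W))
      (h (V ⊓ W) inf_le_left)
    exact ⟨V ⊓ W, ⟨hxV, hxW⟩, inf_le_left.trans hV,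
      locSubMk (M := opSheaf L) _ D (logDO_mem_locSub hD), e⟩

/-! ### The Kodaira-Spencer sequence -/

lemma mem_logDer_of_toBase {f : X ⟶ S} {pS : S ⟶ B} {Y : Set X} {U : X.Opens} {δ : OpO X U}
    (hδ : δ ∈ logDer (f ≫ pS) Y U) (h : (toBase f).app U δ = 0) : δ ∈ logDer f Y U :=
  ⟨hδ.1, hδ.2.1, fun W hW V hV b => congrArg (fun t : LocMap (inPull f) (OX X) U =>
    t.1 ⟨W, hW⟩ ⟨⟨V, b⟩, hV⟩) h, hδ.2.2.2⟩

/-- The map `T_X(log Y) ⟶ f^*T_S(log Δ)` is surjective locally on sections. -/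
lemma exists_toBase_eq {f : X ⟶ S} {pS : S ⟶ Spec (CommRingCat.of ℂ)} {Δ : Closeds S}
    {Y : Closeds X} {d : ℕ} (hf : IsLogSmoothFamily f pS Δ Y d) {U : X.Opens} {φ : Γ(baseOp f, U)}
    (hφ : φ ∈ pullSpan f pS Δ U) (x : X) (hx : x ∈ U) :
    ∃ (V : X.Opens) (_ : x ∈ V) (hV : V ≤ U), ∃ δ ∈ logDer (f ≫ pS) Y V,
      (toBase f).app V δ = res (baseOp f) hV φ := by
  induction hφ using Submodule.span_induction with
  | mem φ h =>
    obtain ⟨V₀, hU, θ, hθ, rfl⟩ := h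
    obtain ⟨V, hxV, hV, δ, hδ, e⟩ := exists_lift_logDer hf hθ x (hU hx)
    refine ⟨V ⊓ U, ⟨hxV, hx⟩, inf_le_right, δ.restrict inf_le_left,
      logDer_restrict _ _ inf_le_left hδ, ?_⟩
    exact (app_res (toBase f) (inf_le_left : V ⊓ U ≤ V) δ).trans
      (congrArg (res (baseOp f) (inf_le_left : V ⊓ U ≤ V)) e)
  | zero => exact ⟨U, hx, le_rfl, 0, zero_mem _, (map_zero ((toBase f).app U).hom).trans
      (map_zero (res (baseOp f) le_rfl)).symm⟩
  | add φ ψ _ _ ih ih' =>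
    obtain ⟨V, hxV, hV, δ, hδ, e⟩ := ih
    obtain ⟨V', hxV', hV', δ', hδ', e'⟩ := ih'
    refine ⟨V ⊓ V', ⟨hxV, hxV'⟩, inf_le_left.trans hV,
      δ.restrict inf_le_left + δ'.restrict inf_le_right,
      add_mem (logDer_restrict _ _ inf_le_left hδ) (logDer_restrict _ _ inf_le_right hδ'), ?_⟩
    have k := (app_res (toBase f) (inf_le_left : V ⊓ V' ≤ V) δ).trans
      (congrArg (res (baseOp f) (inf_le_left : V ⊓ V' ≤ V)) e)
    have k' := (app_res (toBase f) (inf_le_right : V ⊓ V' ≤ V') δ').trans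
      (congrArg (res (baseOp f) (inf_le_right : V ⊓ V' ≤ V')) e')
    rw [res_res] at k k'
    rw [map_add, ← k, ← k']
    exact map_add ((toBase f).app (V ⊓ V')).hom _ _
  | smul c φ _ ih =>
    obtain ⟨V, hxV, hV, δ, hδ, e⟩ := ih
    refine ⟨V, hxV, hV, resO hV c • δ, Submodule.smul_mem _ _ hδ, ?_⟩
    rw [res_smul, ← e]
    exact Scheme.Modules.Hom.app_smul (toBase f) _ _

/-- The sequence `0 ⟶ T_{X/S}(log Y) ⟶ T_X(log Y) ⟶ f^*T_S(log Δ) ⟶ 0` is exact. -/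
lemma toBase_shortExact {f : X ⟶ S} {pS : S ⟶ Spec (CommRingCat.of ℂ)} {Δ : Closeds S}
    {Y : Closeds X} {d : ℕ} (hf : IsLogSmoothFamily f pS Δ Y d)
    (w : (toAb X).map (relT f pS Y) ≫ (toAb X).map (logTι (f ≫ pS) Y ≫ toBase f) = 0) :
    (pullbackComplex ((toAb X).map (relT f pS Y))
      ((toAb X).map (logTι (f ≫ pS) Y ≫ toBase f)) w
      ((toAb X).map (pullTι f pS Δ))).ShortExact := by
  refine pullback_shortExact (relT f pS Y) _ _
    (locSubMap_injective (M := locMap (inO X) (OX X)) _)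
    (fun U δ h => ?_) (fun U φ x hx => ?_) w
  · have hδ := LocSub.of_forall (M := locMap (inO X) (OX X)) (toBase f)
      (N' := logDer f Y) (fun U m hm => mem_logDer_of_toBase hm)
      (locSubι_mem (M := locMap (inO X) (OX X)) (logDer (f ≫ pS) Y) δ) h
    exact ⟨locSubMk (M := locMap (inO X) (OX X)) _ _ hδ, rfl⟩
  · obtain ⟨V, hxV, hV, h⟩ := locSubι_mem (M := baseOp f) (pullSpan f pS Δ) (U := U) φ x hx
    obtain ⟨V', hxV', hV', δ, hδ, e⟩ := exists_toBase_eq hf (h V le_rfl) x hxV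
    refine ⟨V', hxV', hV'.trans hV,
      locSubMk (M := locMap (inO X) (OX X)) _ δ (logDer_mem_locSub hδ), ?_⟩
    rw [res_res] at e
    exact e

lemma Gen.comp_le {f : X ⟶ S} {pS : S ⟶ B} {Y : Set X} {U : X.Opens} {P : OpO X U}
    (hP : Gen f Y U P) : Gen (f ≫ pS) Y U P := by
  induction hP with
  | mul c => exact .mul c
  | der δ hδ => exact .der δ (logDer_comp_le f pS Y U hδ)
  | add P Q _ _ ihP ihQ => exact .add P Q ihP ihQ
  | comp P Q _ _ ihP ihQ => exact .comp P Q ihP ihQ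

lemma logDO_comp_le (f : X ⟶ S) (pS : S ⟶ B) (Y : Set X) (L : X.Modules) (U : X.Opens) :
    logDO f Y L 1 U ≤ logDO (f ≫ pS) Y L 1 U := by
  intro D hD W h s hs
  obtain ⟨P, hP, hc⟩ := hD W h s hs
  refine ⟨P, ⟨fun x hx => ?_, hP.2⟩, hc⟩
  obtain ⟨V, hxV, hV, hG⟩ := hP.1 x hx
  exact ⟨V, hxV, hV, hG.comp_le⟩

/-- The inclusion `𝒟¹_{X/S}(L) ⟶ 𝒟¹_X(L)`. -/
def relD (f : X ⟶ S) (pS : S ⟶ B) (Y : Set X) (L : X.Modules) :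
    logD f Y L 1 ⟶ logD (f ≫ pS) Y L 1 :=
  locSubMap (M := opSheaf L) (logDO_comp_le f pS Y L)

lemma relD_symbBase (f : X ⟶ S) (pS : S ⟶ B) (Y : Set X) {L : X.Modules} (hL : IsLineBundle L) :
    relD f pS Y L ≫ logDι (f ≫ pS) Y L 1 ≫ symbBase f L = 0 :=
  hom_ext_app fun _ D => symbBase_eq_zero f hL
    (locSubι_mem (M := opSheaf L) (logDO f Y L 1) D)

/-- The sequence `0 ⟶ 𝒟¹_{X/S}(L) ⟶ 𝒟¹_X(L) ⟶ f^*T_S(log Δ) ⟶ 0` is exact. -/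
lemma symbBase_shortExact {f : X ⟶ S} {pS : S ⟶ Spec (CommRingCat.of ℂ)} {Δ : Closeds S}
    {Y : Closeds X} {d : ℕ} (hf : IsLogSmoothFamily f pS Δ Y d) {L : X.Modules}
    (hL : IsLineBundle L)
    (w : (toAb X).map (relD f pS Y L) ≫ (toAb X).map (logDι (f ≫ pS) Y L 1 ≫ symbBase f L) = 0) :
    (pullbackComplex ((toAb X).map (relD f pS Y L))
      ((toAb X).map (logDι (f ≫ pS) Y L 1 ≫ symbBase f L)) w
      ((toAb X).map (pullTι f pS Δ ≫ actOn (inPull f) L))).ShortExact := by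
  refine pullback_shortExact (relD f pS Y L) _ _
    (locSubMap_injective (M := opSheaf L) _)
    (fun U D h => ?_) (fun U φ x hx => ?_) w
  · have hD := LocSub.of_forall (M := opSheaf L) (symbBase f L)
      (N' := logDO f Y L 1) (fun U m hm => mem_logDO_of_symbBase f hm)
      (locSubι_mem (M := opSheaf L) (logDO (f ≫ pS) Y L 1) D) h
    exact ⟨locSubMk (M := opSheaf L) _ _ hD, rfl⟩
  · obtain ⟨V, hxV, hV, h⟩ := locSubι_mem (M := baseOp f) (pullSpan f pS Δ) (U := U) φ x hx
    obtain ⟨V', hxV', hV', δ, hδ, e⟩ := exists_toBase_eq hf (h V le_rfl) x hxV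
    obtain ⟨W, hxW, s, hs⟩ := hL x
    have hs' := hs.res (inf_le_right : V' ⊓ W ≤ W)
    have hδ' := logDer_restrict _ _ (inf_le_left : V' ⊓ W ≤ V') hδ
    obtain ⟨D, hD⟩ := exists_corresponds hs' (δ.restrict inf_le_left)
    refine ⟨V' ⊓ W, ⟨hxV', hxW⟩, inf_le_left.trans (hV'.trans hV),
      locSubMk (M := opSheaf L) _ D (logDO_mem_locSub
        (mem_logDO_of_corresponds hs' (isDO_one_of_mem_logDer hδ') hD)),
      (symbBase_of_corresponds hs' f hδ' hD).trans (congrArg _ ?_)⟩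
    have k := (app_res (toBase f) (inf_le_left : V' ⊓ W ≤ V') δ).trans
      (congrArg (res (baseOp f) (inf_le_left : V' ⊓ W ≤ V')) e)
    rw [res_res, res_res] at k
    exact k

end ExactSequences

/-! ### Local existence of heat operators -/

section LocalHeat

variable {X S B : Scheme.{0}}

/-- The inclusion `𝒟¹_X(L) ⟶ 𝒲_{X/S}(L)`. -/
def heatOfTotal (f : X ⟶ S) (pS : S ⟶ B) (Y : Set X) (L : X.Modules) :
    logD (f ≫ pS) Y L 1 ⟶ heatSheaf f pS Y L :=
  locSubLift (M := opSheaf L) (heatSum f pS Y L) (logDι (f ≫ pS) Y L 1) fun _ D =>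
    mem_locSub (M := opSheaf L) fun _ hW => Submodule.mem_sup_left
      (LocSub.res_mem (M := opSheaf L) _ hW (locSubι_mem (M := opSheaf L) _ D))

/-- The inclusion `𝒟²_{X/S}(L) ⟶ 𝒲_{X/S}(L)`. -/
def heatOfRel (f : X ⟶ S) (pS : S ⟶ B) (Y : Set X) (L : X.Modules) :
    logD f Y L 2 ⟶ heatSheaf f pS Y L :=
  locSubLift (M := opSheaf L) (heatSum f pS Y L) (logDι f Y L 2) fun _ D =>
    mem_locSub (M := opSheaf L) fun _ hW => Submodule.mem_sup_right
      (LocSub.res_mem (M := opSheaf L) _ hW (locSubι_mem (M := opSheaf L) _ D))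

lemma relD_heatOfTotal (f : X ⟶ S) (pS : S ⟶ B) (Y : Set X) (L : X.Modules) :
    relD f pS Y L ≫ heatOfTotal f pS Y L = incD f Y L ≫ heatOfRel f pS Y L := rfl

lemma logDι_symb2 (q : X ⟶ B) (Z : Set X) {L : X.Modules} (hL : IsLineBundle L) :
    logDι q Z L 1 ≫ symb2 L = 0 :=
  hom_ext_app fun _ D => symb2_eq_zero hL (locSubι_mem (M := opSheaf L) (logDO q Z L 1) D)

lemma logDι_symbBase (f : X ⟶ S) (Y : Set X) {L : X.Modules} (hL : IsLineBundle L) (k : ℕ) :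
    logDι f Y L k ≫ symbBase f L = 0 :=
  hom_ext_app fun _ D => symbBase_eq_zero f hL (locSubι_mem (M := opSheaf L) (logDO f Y L k) D)

/-- The symbol of `D` in the direction of the base is the image of its first order symbol. -/
lemma sigma1_toBase (f : X ⟶ S) (pS : S ⟶ B) (Y : Set X) {L : X.Modules} (hL : IsLineBundle L) :
    sigma1 (f ≫ pS) Y hL ≫ logTι (f ≫ pS) Y ≫ toBase f ≫ actOn (inPull f) L
      = logDι (f ≫ pS) Y L 1 ≫ symbBase f L := by
  refine hom_ext_app fun U D => Subtype.ext (funext fun W => funext fun z => ?_)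
  have e := congrArg (fun k : logD (f ≫ pS) Y L 1 ⟶ locMap (inProd (inO X) (inM L)) L => k.app U D)
    (sigma1_spec (f ≫ pS) Y hL)
  exact congrArg (fun t : LocMap (inProd (inO X) (inM L)) L U =>
    t.1 W (resO z.1.2 (f.app z.1.1.1 z.1.1.2), z.2)) e

lemma sigma1_relT (f : X ⟶ S) (pS : S ⟶ B) (Y : Set X) {L : X.Modules} (hL : IsLineBundle L) :
    sigma1 f Y hL ≫ relT f pS Y = relD f pS Y L ≫ sigma1 (f ≫ pS) Y hL := by
  have e : (sigma1 f Y hL ≫ relT f pS Y) ≫ logTι (f ≫ pS) Y ≫ actOn (inO X) L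
      = (relD f pS Y L ≫ sigma1 (f ≫ pS) Y hL) ≫ logTι (f ≫ pS) Y ≫ actOn (inO X) L := by
    rw [Category.assoc, Category.assoc, sigma1_spec]
    exact sigma1_spec f Y hL
  refine hom_ext_app fun U D => logTι_actOn_injective (f ≫ pS) Y hL U ?_
  exact congrArg (fun k : logD f Y L 1 ⟶ _ => k.app U D) e

variable {f : X ⟶ S} {pS : S ⟶ Spec (CommRingCat.of ℂ)} {Δ : Closeds S} {Y : Closeds X} {d : ℕ}

/-- The Kodaira-Spencer map is the obstruction to lifting logarithmic vector fields on the base to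
first order operators on `L`, projected to derivations by the symbol. -/
lemma connecting_symbBase (hf : IsLogSmoothFamily f pS Δ Y d) {L : X.Modules}
    (hL : IsLineBundle L)
    (w : (toAb X).map (relD f pS Y L) ≫ (toAb X).map (logDι (f ≫ pS) Y L 1 ≫ symbBase f L) = 0)
    (w' : (toAb X).map (relT f pS Y) ≫ (toAb X).map (logTι (f ≫ pS) Y ≫ toBase f) = 0) :
    connecting (fstar f) ((toAb X).map (relD f pS Y L))
        ((toAb X).map (logDι (f ≫ pS) Y L 1 ≫ symbBase f L)) w
        ((toAb X).map (pullTι f pS Δ ≫ actOn (inPull f) L)) ≫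
        ((fstar f).rightDerived 1).map ((toAb X).map (sigma1 f Y hL))
      = connecting (fstar f) ((toAb X).map (relT f pS Y))
        ((toAb X).map (logTι (f ≫ pS) Y ≫ toBase f)) w' ((toAb X).map (pullTι f pS Δ)) := by
  have hm : Mono ((toAb X).map (actOn (inPull f) L)) :=
    mono_of_injective _ fun U => actOn_injective (inPull f) hL U.unop
  have e₁ : (toAb X).map (relD f pS Y L) ≫ (toAb X).map (sigma1 (f ≫ pS) Y hL)
      = (toAb X).map (sigma1 f Y hL) ≫ (toAb X).map (relT f pS Y) := by
    rw [← Functor.map_comp, ← Functor.map_comp, sigma1_relT]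
  have e₂ : (toAb X).map (sigma1 (f ≫ pS) Y hL) ≫ (toAb X).map (logTι (f ≫ pS) Y ≫ toBase f) ≫
      (toAb X).map (actOn (inPull f) L)
      = (toAb X).map (logDι (f ≫ pS) Y L 1 ≫ symbBase f L) := by
    rw [← Functor.map_comp, ← Functor.map_comp, Category.assoc, sigma1_toBase]
  have e₃ : (toAb X).map (pullTι f pS Δ) ≫ (toAb X).map (actOn (inPull f) L)
      = (toAb X).map (pullTι f pS Δ ≫ actOn (inPull f) L) := ((toAb X).map_comp _ _).symm
  exact connecting_naturality (fstar f) (symbBase_shortExact hf hL w) (toBase_shortExact hf w')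
    _ _ _ e₁ e₂ e₃

/-- Sections of `T_S(log Δ)` lift locally to heat operators with the given symbol. -/
theorem exists_local_heat (hf : IsLogSmoothFamily f pS Δ Y d) {L : X.Modules} (hL : IsLineBundle L)
    (ρ : logT pS (Δ : Set S) ⟶ (Scheme.Modules.pushforward f).obj (symT f (Y : Set X)))
    (h1 : (toAb S).map ρ ≫ muClass f (Y : Set X) hL
      + kodairaSpencer f pS (Δ : Set S) (Y : Set X) = 0)
    (h2 : IsIso (cupClass f (Y : Set X) hL)) {V : S.Opens} (θ : Γ(logT pS (Δ : Set S), V)) (x : S)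
    (hx : x ∈ V) : ∃ (V' : S.Opens) (_ : x ∈ V') (hV : V' ≤ V)
      (D : Γ(heatSheaf f pS (Y : Set X) L, f ⁻¹ᵁ V')),
      (heatι f pS (Y : Set X) L ≫ symbBase f L).app (f ⁻¹ᵁ V') D
        = (pullTι f pS Δ ≫ actOn (inPull f) L).app (f ⁻¹ᵁ V')
          ((canon f pS Δ).app V' (res (logT pS (Δ : Set S)) hV θ)) ∧
      (heatι f pS (Y : Set X) L ≫ symb2 L).app (f ⁻¹ᵁ V') D
        = (symTι f (Y : Set X) ≫ actOn (inProd (inO X) (inO X)) L).app (f ⁻¹ᵁ V')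
          (ρ.app V' (res (logT pS (Δ : Set S)) hV θ)) := by
  have wE : (toAb X).map (mulD f Y L) ≫ (toAb X).map (sigma1 f Y hL) = 0 := by
    rw [← Functor.map_comp, mulD_sigma1, Functor.map_zero]
  have w₁ : (toAb X).map (relD f pS Y L) ≫
      (toAb X).map (logDι (f ≫ pS) Y L 1 ≫ symbBase f L) = 0 := by
    rw [← Functor.map_comp, relD_symbBase f pS Y hL, Functor.map_zero]
  have w₂ : (toAb X).map (incD f Y L) ≫ (toAb X).map (logDι f Y L 2 ≫ symb2 L) = 0 := by
    rw [← Functor.map_comp, incD_symb2 f Y hL, Functor.map_zero]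
  have w' : (toAb X).map (relT f pS Y) ≫ (toAb X).map (logTι (f ≫ pS) Y ≫ toBase f) = 0 := by
    rw [← Functor.map_comp, relT_toBase, Functor.map_zero]
  have hk : (toAb X).map (relD f pS Y L) ≫ (toAb X).map (heatOfTotal f pS Y L)
      = (toAb X).map (incD f Y L) ≫ (toAb X).map (heatOfRel f pS Y L) := by
    rw [← Functor.map_comp, ← Functor.map_comp, relD_heatOfTotal]
  have hm : Mono ((toAb X).map (incD f Y L) ≫ (toAb X).map (heatOfRel f pS Y L)) :=
    mono_of_injective _ fun U D D' e => locSubι_injective (M := opSheaf L) (logDO f Y L 1) U.unop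
      (congrArg ((heatι f pS Y L).app U.unop) e)
  have h₁₁ : (toAb X).map (heatOfTotal f pS Y L) ≫ (toAb X).map (heatι f pS Y L ≫ symbBase f L)
      = (toAb X).map (logDι (f ≫ pS) Y L 1 ≫ symbBase f L) := rfl
  have h₁₂ : (toAb X).map (heatOfTotal f pS Y L) ≫ (toAb X).map (heatι f pS Y L ≫ symb2 L) = 0 := by
    have e : heatOfTotal f pS Y L ≫ heatι f pS Y L ≫ symb2 L = 0 := logDι_symb2 (f ≫ pS) Y hL
    rw [← Functor.map_comp, e, Functor.map_zero]
  have h₂₁ : (toAb X).map (heatOfRel f pS Y L) ≫ (toAb X).map (heatι f pS Y L ≫ symbBase f L)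
      = 0 := by
    have e : heatOfRel f pS Y L ≫ heatι f pS Y L ≫ symbBase f L = 0 := logDι_symbBase f Y hL 2
    rw [← Functor.map_comp, e, Functor.map_zero]
  have h₂₂ : (toAb X).map (heatOfRel f pS Y L) ≫ (toAb X).map (heatι f pS Y L ≫ symb2 L)
      = (toAb X).map (logDι f Y L 2 ≫ symb2 L) := rfl
  -- The image of the obstruction in `R¹f_*T_{X/S}(log Y)` is `κ + μ ∘ ρ`.
  have he : (toAb S).map (canon f pS Δ) ≫ connecting (fstar f) ((toAb X).map (relD f pS Y L))
        ((toAb X).map (logDι (f ≫ pS) Y L 1 ≫ symbBase f L)) w₁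
        ((toAb X).map (pullTι f pS Δ ≫ actOn (inPull f) L)) ≫
        ((fstar f).rightDerived 1).map ((toAb X).map (sigma1 f Y hL))
      + (toAb S).map ρ ≫ connecting (fstar f) ((toAb X).map (incD f Y L))
        ((toAb X).map (logDι f Y L 2 ≫ symb2 L)) w₂
        ((toAb X).map (symTι f Y ≫ actOn (inProd (inO X) (inO X)) L)) ≫
        ((fstar f).rightDerived 1).map ((toAb X).map (sigma1 f Y hL)) = 0 := by
    refine Eq.trans (congrArg (· + _) (congrArg ((toAb S).map (canon f pS Δ) ≫ ·)
      (connecting_symbBase hf hL w₁ w'))) ?_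
    exact (add_comm _ _).trans h1
  obtain ⟨Z', π, hπ, y, y₁, y₂⟩ := exists_lift_of_connecting (fstar f)
    (sigma1_shortExact f Y hL wE) h2 (symbBase_shortExact hf hL w₁) (symb2_shortExact f Y hL w₂)
    _ _ hk hm _ _ h₁₁ h₁₂ h₂₁ h₂₂ _ _ he
  -- The lift exists after an epimorphism `π`, which is surjective locally on sections.
  rw [← TopCat.Sheaf.isLocallySurjective_iff_epi, TopCat.Presheaf.isLocallySurjective_iff] at hπ
  obtain ⟨V', hV', ⟨z, hz⟩, hxV'⟩ := hπ V θ x hx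
  replace hz : π.hom.app (op V') z = res (logT pS (Δ : Set S)) hV' θ := hz
  refine ⟨V', hxV', hV', y.hom.app (op V') z, ?_, ?_⟩
  · rw [← hz]
    exact congrArg (fun k => k.hom.app (op V') z) y₁
  · rw [← hz]
    exact congrArg (fun k => k.hom.app (op V') z) y₂

end LocalHeat

/-! ### Projective heat operators -/

section Projective

variable {X S B : Scheme.{0}}

/-- A pair of morphisms `p₁, p₂` on `K` factors through a pair of jointly injective morphisms
`c₁, c₂` on `C` if it does so locally on sections. -/
lemma exists_lift_pair {K C E₁ E₂ : X.Modules} (p₁ : K ⟶ E₁) (p₂ : K ⟶ E₂) (c₁ : C ⟶ E₁)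
    (c₂ : C ⟶ E₂)
    (hc : ∀ (U : X.Opens) (t : Γ(C, U)), c₁.app U t = 0 → c₂.app U t = 0 → t = 0)
    (h : ∀ (U : X.Opens) (s : Γ(K, U)), ∀ x ∈ U, ∃ V : X.Opens, x ∈ V ∧ ∃ hV : V ≤ U,
      ∃ t : Γ(C, V), c₁.app V t = p₁.app V (res K hV s) ∧ c₂.app V t = p₂.app V (res K hV s)) :
    ∃ φ : K ⟶ C, φ ≫ c₁ = p₁ ∧ φ ≫ c₂ = p₂ := by
  have hfst : ∀ {A : X.Modules} (a₁ : A ⟶ E₁) (a₂ : A ⟶ E₂) (U : X.Opens) (t : Γ(A, U)),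
      (biprod.fst : E₁ ⊞ E₂ ⟶ E₁).app U ((biprod.lift a₁ a₂).app U t) = a₁.app U t :=
    fun a₁ a₂ U t => congrArg (fun k : _ ⟶ E₁ => k.app U t) (biprod.lift_fst a₁ a₂)
  have hsnd : ∀ {A : X.Modules} (a₁ : A ⟶ E₁) (a₂ : A ⟶ E₂) (U : X.Opens) (t : Γ(A, U)),
      (biprod.snd : E₁ ⊞ E₂ ⟶ E₂).app U ((biprod.lift a₁ a₂).app U t) = a₂.app U t :=
    fun a₁ a₂ U t => congrArg (fun k : _ ⟶ E₂ => k.app U t) (biprod.lift_snd a₁ a₂)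
  have htot : ∀ (U : X.Opens) (e : Γ(E₁ ⊞ E₂, U)),
      (biprod.inl : E₁ ⟶ E₁ ⊞ E₂).app U ((biprod.fst : E₁ ⊞ E₂ ⟶ E₁).app U e)
        + (biprod.inr : E₂ ⟶ E₁ ⊞ E₂).app U ((biprod.snd : E₁ ⊞ E₂ ⟶ E₂).app U e) = e :=
    fun U e => congrArg (fun k : E₁ ⊞ E₂ ⟶ E₁ ⊞ E₂ => k.app U e) biprod.total
  -- A pair of morphisms is a morphism to the biproduct.
  obtain ⟨φ, hφ⟩ := exists_lift (biprod.lift p₁ p₂) (biprod.lift c₁ c₂) (fun U => by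
      refine (injective_iff_map_eq_zero ((biprod.lift c₁ c₂).app U).hom).2 fun t ht => ?_
      replace ht : (biprod.lift c₁ c₂).app U t = 0 := ht
      refine hc U t ?_ ?_
      · rw [← hfst c₁ c₂, ht, map_zero]
      · rw [← hsnd c₁ c₂, ht, map_zero])
    fun U s x hx => by
      obtain ⟨V, hxV, hV, t, h₁, h₂⟩ := h U s x hx
      refine ⟨V, hxV, hV, t, ?_⟩
      rw [← htot V ((biprod.lift c₁ c₂).app V t), hfst, hsnd, h₁, h₂, ← hfst p₁ p₂, ← hsnd p₁ p₂,
        htot]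
  refine ⟨φ, ?_, ?_⟩
  · rw [← biprod.lift_fst c₁ c₂, ← Category.assoc, hφ, biprod.lift_fst]
  · rw [← biprod.lift_snd c₁ c₂, ← Category.assoc, hφ, biprod.lift_snd]

/-- The projection `f_*𝒲_{X/S}(L) ⟶ f_*𝒲_{X/S}(L) / 𝒪_S`. -/
def heatπ (f : X ⟶ S) (pS : S ⟶ B) (Y : Set X) (L : X.Modules) :
    (Scheme.Modules.pushforward f).obj (heatSheaf f pS Y L) ⟶ projHeat f pS Y L :=
  cokernel.π (baseHeat f pS Y L)

instance (f : X ⟶ S) (pS : S ⟶ B) (Y : Set X) (L : X.Modules) : Epi (heatπ f pS Y L) :=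
  inferInstanceAs (Epi (cokernel.π (baseHeat f pS Y L)))

variable (f : X ⟶ S) (pS : S ⟶ B) (Y : Set X) (L : X.Modules) {V : S.Opens}

lemma heatπ_baseHeat (b : Γ(S, V)) :
    (heatπ f pS Y L).app V ((baseHeat f pS Y L).app V b) = 0 :=
  congrArg (fun k : OX S ⟶ projHeat f pS Y L => k.app V b) (cokernel.condition (baseHeat f pS Y L))

lemma heatπ_heatSymbBase : heatπ f pS Y L ≫ heatSymbBase f pS Y L
    = (Scheme.Modules.pushforward f).map (heatι f pS Y L ≫ symbBase f L) :=
  cokernel.π_desc _ _ _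

lemma heatSymbBase_heatπ (D : Γ(heatSheaf f pS Y L, f ⁻¹ᵁ V)) :
    (heatSymbBase f pS Y L).app V ((heatπ f pS Y L).app V D)
      = (heatι f pS Y L ≫ symbBase f L).app (f ⁻¹ᵁ V) D := by
  have e := heatπ_heatSymbBase f pS Y L
  generalize heatSymbBase f pS Y L = p at e ⊢
  generalize heatι f pS Y L ≫ symbBase f L = q at e ⊢
  exact congrArg (fun k : (Scheme.Modules.pushforward f).obj (heatSheaf f pS Y L) ⟶ _ =>
    k.app V D) e

lemma heatπ_heatSymb2 : heatπ f pS Y L ≫ heatSymb2 f pS Y L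
    = (Scheme.Modules.pushforward f).map (heatι f pS Y L ≫ symb2 L) :=
  cokernel.π_desc _ _ _

lemma heatSymb2_heatπ (D : Γ(heatSheaf f pS Y L, f ⁻¹ᵁ V)) :
    (heatSymb2 f pS Y L).app V ((heatπ f pS Y L).app V D)
      = (heatι f pS Y L ≫ symb2 L).app (f ⁻¹ᵁ V) D := by
  have e := heatπ_heatSymb2 f pS Y L
  generalize heatSymb2 f pS Y L = p at e ⊢
  generalize heatι f pS Y L ≫ symb2 L = q at e ⊢
  exact congrArg (fun k : (Scheme.Modules.pushforward f).obj (heatSheaf f pS Y L) ⟶ _ =>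
    k.app V D) e

variable {f pS Y L}

/-- If `∪[L]` is injective, the symbol of each relative first order operator on the preimage of an
open subset of the base vanishes: `f_*σ₁` composed with `∪[L]` is zero. -/
lemma sigma1_app_eq_zero (hL : IsLineBundle L) (h2 : IsIso (cupClass f Y hL))
    (D : Γ(logD f Y L 1, f ⁻¹ᵁ V)) : (sigma1 f Y hL).app (f ⁻¹ᵁ V) D = 0 := by
  have w : (toAb X).map (mulD f Y L) ≫ (toAb X).map (sigma1 f Y hL) = 0 := by
    rw [← Functor.map_comp, mulD_sigma1, Functor.map_zero]
  have h2' : IsIso (connecting (fstar f) ((toAb X).map (mulD f Y L))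
    ((toAb X).map (sigma1 f Y hL)) w (𝟙 _)) := h2
  have e := map_eq_zero_of_connecting (fstar f) (sigma1_shortExact f Y hL w) inferInstance
  exact congrArg (fun k : (fstar f).obj ((toAb X).obj (logD f Y L 1)) ⟶
    (fstar f).obj ((toAb X).obj (logT f Y)) => k.hom.app (op V) D) e

/-- A global heat operator both of whose symbols vanish is a function on the base. -/
lemma exists_baseHeat_eq (hL : IsLineBundle L) (hO : ∀ V : S.Opens, IsIso (f.app V))
    (h2 : IsIso (cupClass f Y hL)) {D : Γ(heatSheaf f pS Y L, f ⁻¹ᵁ V)}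
    (hb : (heatι f pS Y L ≫ symbBase f L).app (f ⁻¹ᵁ V) D = 0)
    (hs : (heatι f pS Y L ≫ symb2 L).app (f ⁻¹ᵁ V) D = 0) :
    ∃ b : Γ(S, V), (baseHeat f pS Y L).app V b = D := by
  have hD := mem_of_symbols_eq_zero f hL
    (locSubι_mem (M := opSheaf L) (heatSum f pS Y L) D) hb hs
  obtain ⟨c, hc⟩ := exists_mulD_eq (f := f) (Y := Y) hL
    (sigma1_app_eq_zero hL h2 (locSubMk (M := opSheaf L) _ _ hD))
  have := hO V
  obtain ⟨b, rfl⟩ := (ConcreteCategory.bijective_of_isIso (f.app V)).2 c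
  refine ⟨b, locSubι_injective (M := opSheaf L) (heatSum f pS Y L) (f ⁻¹ᵁ V) ?_⟩
  exact congrArg ((logDι f Y L 1).app (f ⁻¹ᵁ V)) hc

/-- A section of `f_*𝒲 / 𝒪_S` is determined by its two symbols. -/
lemma eq_zero_of_heatSymb (hL : IsLineBundle L) (hO : ∀ V : S.Opens, IsIso (f.app V))
    (h2 : IsIso (cupClass f Y hL)) (t : Γ(projHeat f pS Y L, V))
    (hb : (heatSymbBase f pS Y L).app V t = 0) (hs : (heatSymb2 f pS Y L).app V t = 0) :
    t = 0 := by
  refine eq_of_res _ _ _ fun x hx => ?_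
  obtain ⟨V', hxV', hV', D, hD⟩ := exists_of_epi (heatπ f pS Y L) t x hx
  refine ⟨V', hxV', hV', ?_⟩
  rw [map_zero, ← hD]
  obtain ⟨b, rfl⟩ := exists_baseHeat_eq (pS := pS) hL hO h2 (D := D)
    ((heatSymbBase_heatπ f pS Y L D).symm.trans
      ((congrArg _ hD).trans (app_res_eq_zero _ hV' hb)))
    ((heatSymb2_heatπ f pS Y L D).symm.trans
      ((congrArg _ hD).trans (app_res_eq_zero _ hV' hs)))
  exact heatπ_baseHeat f pS Y L b

/-- The first order symbol of the action of `f_*𝒲` on `f_*L` may be computed before passing to the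
quotient by `𝒪_S`. -/
lemma heatπ_endSymb1 (f : X ⟶ S) (pS : S ⟶ B) (Y : Set X) (hL : IsLineBundle L) :
    heatπ f pS Y L ≫ projHeatAct f pS Y hL ≫ endSymb1 pS ((Scheme.Modules.pushforward f).obj L)
      = ((Scheme.Modules.pushforward f).map (heatι f pS Y L) ≫ pushOp f L) ≫
        symb1 ((Scheme.Modules.pushforward f).obj L) := by
  have e₁ : heatπ f pS Y L ≫ projHeatAct f pS Y hL
      = heatAct f pS Y hL ≫ cokernel.π (mulEnd pS _) := cokernel.π_desc _ _ _
  have e₂ : cokernel.π (mulEnd pS ((Scheme.Modules.pushforward f).obj L)) ≫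
      endSymb1 pS ((Scheme.Modules.pushforward f).obj L)
      = endι pS _ ≫ symb1 _ := cokernel.π_desc _ _ _
  refine (Category.assoc _ _ _).symm.trans ((congrArg (· ≫ _) e₁).trans
    ((Category.assoc _ _ _).trans ((congrArg (_ ≫ ·) e₂).trans ?_)))
  rfl

/-- The action on `f_*L` of a heat operator has the first order symbol determined by its symbol in
the direction of the base. -/
lemma endSymb1_projHeatAct (hL : IsLineBundle L) (D : Γ(heatSheaf f pS Y L, f ⁻¹ᵁ V))
    {W : S.Opens} (hW : W ≤ V) (a : Γ(S, W)) (s : Γ(L, f ⁻¹ᵁ W)) :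
    (show LocMap (inProd (inO S) (inM ((Scheme.Modules.pushforward f).obj L)))
        ((Scheme.Modules.pushforward f).obj L) V from
      (projHeatAct f pS Y hL ≫ endSymb1 pS ((Scheme.Modules.pushforward f).obj L)).app V
        ((heatπ f pS Y L).app V D)).1 ⟨W, hW⟩ (a, s)
      = (show LocMap (inProd (inPull f) (inM L)) L (f ⁻¹ᵁ V) from
        (heatι f pS Y L ≫ symbBase f L).app (f ⁻¹ᵁ V) D).1
          ⟨f ⁻¹ᵁ W, fun _ hx => hW hx⟩ (⟨⟨W, a⟩, le_rfl⟩, s) := by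
  let D' : Op L (f ⁻¹ᵁ V) := (heatι f pS Y L).app (f ⁻¹ᵁ V) D
  have hW' : f ⁻¹ᵁ W ≤ f ⁻¹ᵁ V := fun _ hx => hW hx
  refine (congrArg (fun k : (Scheme.Modules.pushforward f).obj (heatSheaf f pS Y L) ⟶
    locMap (inProd (inO S) (inM ((Scheme.Modules.pushforward f).obj L)))
      ((Scheme.Modules.pushforward f).obj L) =>
    (show LocMap (inProd (inO S) (inM ((Scheme.Modules.pushforward f).obj L)))
        ((Scheme.Modules.pushforward f).obj L) V from k.app V D).1 ⟨W, hW⟩ (a, s))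
      (heatπ_endSymb1 f pS Y hL)).trans ?_
  change D'.ev hW' (f.app W a • s) - f.app W a • D'.ev hW' s
    = D'.ev hW' (resO le_rfl (f.app W a) • s) - resO le_rfl (f.app W a) • D'.ev hW' s
  rw [resO_self]

lemma pullOp_apply (f : X ⟶ S) (θ : OpO S V) {W : S.Opens} (hW : W ≤ V) (a : Γ(S, W)) :
    (pullOp f (le_refl (f ⁻¹ᵁ V)) θ).1 ⟨f ⁻¹ᵁ W, fun _ hx => hW hx⟩ ⟨⟨W, a⟩, le_rfl⟩
      = f.app W (θ.ev hW a) := by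
  change resO _ (f.app (V ⊓ W) (θ.ev inf_le_left (resO inf_le_right a))) = _
  rw [θ.ev_resO hW inf_le_right, app_resO, resO_self]

/-- A projective heat operator acts on `f_*L` as a projective connection. -/
lemma isProjConnection_of_isProjHeat (hL : IsLineBundle L) {Δ : Set S}
    {H : logT pS Δ ⟶ projHeat f pS Y L} (hH : IsProjHeat f pS Δ Y L H) :
    IsProjConnection pS Δ ((Scheme.Modules.pushforward f).obj L)
      (H ≫ projHeatAct f pS Y hL) := by
  refine hom_ext_app fun V θ => eq_of_res _ _ _ fun x hx => ?_
  obtain ⟨V', hxV', hV', D, hD⟩ := exists_of_epi (heatπ f pS Y L) (H.app V θ) x hx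
  refine ⟨V', hxV', hV', ?_⟩
  rw [← app_res, ← app_res]
  generalize hθ : res (logT pS Δ) hV' θ = θ'
  rw [← app_res, hθ] at hD
  refine Subtype.ext (funext fun W => funext fun z => ?_)
  obtain ⟨a, s⟩ := z
  have e₁ : ((H ≫ projHeatAct f pS Y hL) ≫ endSymb1 pS ((Scheme.Modules.pushforward f).obj L)).app
      V' θ' = (projHeatAct f pS Y hL ≫ endSymb1 pS ((Scheme.Modules.pushforward f).obj L)).app V'
        ((heatπ f pS Y L).app V' D) := by
    rw [hD]
    rfl
  have e₂ : (heatι f pS Y L ≫ symbBase f L).app (f ⁻¹ᵁ V') D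
      = (actOn (inPull f) L).app (f ⁻¹ᵁ V')
        (pullOp f (le_refl (f ⁻¹ᵁ V')) (logT.toOp pS Δ θ')) :=
    (heatSymbBase_heatπ f pS Y L D).symm.trans ((congrArg _ hD).trans
      (congrArg (fun k : logT pS Δ ⟶ _ => k.app V' θ') hH))
  refine (congrArg (fun t : LocMap (inProd (inO S) (inM ((Scheme.Modules.pushforward f).obj L)))
    ((Scheme.Modules.pushforward f).obj L) V' => t.1 W (a, s)) e₁).trans ?_
  refine (endSymb1_projHeatAct hL D W.2 a s).trans ?_
  refine (congrArg (fun t : LocMap (inProd (inPull f) (inM L)) L (f ⁻¹ᵁ V') =>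
    t.1 ⟨f ⁻¹ᵁ W.1, fun _ hx => W.2 hx⟩ (⟨⟨W.1, a⟩, le_rfl⟩, s)) e₂).trans ?_
  exact congrArg (fun c : Γ(X, f ⁻¹ᵁ W.1) => c • (show Γ(L, f ⁻¹ᵁ W.1) from s))
    (pullOp_apply f (logT.toOp pS Δ θ') W.2 a)

end Projective

end LogHeat

/-! ### Existence, uniqueness and the connection -/

open LogHeat in
theorem theorem2p1
    {X S : Scheme.{0}} (f : X ⟶ S) (pS : S ⟶ Spec (CommRingCat.of ℂ))
    (Δ : Closeds S) (Y : Closeds X) (d : ℕ)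
    (hf : LogHeat.IsLogSmoothFamily f pS Δ Y d)
    (hO : ∀ V : S.Opens, IsIso (f.app V))
    (L : X.Modules) (hL : LogHeat.IsLineBundle L)
    (ρ : LogHeat.logT pS (Δ : Set S) ⟶
      (Scheme.Modules.pushforward f).obj (LogHeat.symT f (Y : Set X)))
    (h1 : (LogHeat.toAb S).map ρ ≫ LogHeat.muClass f (Y : Set X) hL
      + LogHeat.kodairaSpencer f pS (Δ : Set S) (Y : Set X) = 0)
    (h2 : IsIso (LogHeat.cupClass f (Y : Set X) hL)) :
    ∃ H : LogHeat.logT pS (Δ : Set S) ⟶ LogHeat.projHeat f pS (Y : Set X) L,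
      (LogHeat.IsProjHeat f pS Δ Y L H ∧ LogHeat.HasSymbol f pS Δ Y L H ρ) ∧
      (∀ H', LogHeat.IsProjHeat f pS Δ Y L H' ∧ LogHeat.HasSymbol f pS Δ Y L H' ρ → H' = H) ∧
      LogHeat.IsProjConnection pS Δ ((Scheme.Modules.pushforward f).obj L)
        (H ≫ LogHeat.projHeatAct f pS Y hL) := by
  have inj : ∀ (V : S.Opens) (t : Γ(projHeat f pS (Y : Set X) L, V)),
      (heatSymbBase f pS (Y : Set X) L).app V t = 0 →
      (heatSymb2 f pS (Y : Set X) L).app V t = 0 → t = 0 :=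
    fun V t hb hs => eq_zero_of_heatSymb hL hO h2 t hb hs
  -- Local heat operators with the prescribed symbols are unique modulo `𝒪_S`, so they glue.
  obtain ⟨H, hb, hs⟩ := exists_lift_pair
    (canon f pS Δ ≫ (Scheme.Modules.pushforward f).map (pullTι f pS Δ ≫ actOn (inPull f) L))
    (ρ ≫ (Scheme.Modules.pushforward f).map (symTι f Y ≫ actOn (inProd (inO X) (inO X)) L))
    (heatSymbBase f pS (Y : Set X) L) (heatSymb2 f pS (Y : Set X) L) inj fun V θ x hx => by
      obtain ⟨V', hxV', hV', D, hb, hs⟩ := exists_local_heat hf hL ρ h1 h2 θ x hx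
      exact ⟨V', hxV', hV', (heatπ f pS (Y : Set X) L).app V' D,
        (heatSymbBase_heatπ f pS (Y : Set X) L D).trans hb,
        (heatSymb2_heatπ f pS (Y : Set X) L D).trans hs⟩
  refine ⟨H, ⟨hb, hs⟩, fun H' ⟨hb', hs'⟩ => hom_ext_app fun V θ => ?_,
    isProjConnection_of_isProjHeat hL hb⟩
  refine sub_eq_zero.1 (inj V _ ?_ ?_)
  · rw [map_sub, sub_eq_zero]
    exact congrArg (fun k : logT pS (Δ : Set S) ⟶ _ => k.app V θ) (Eq.trans hb' hb.symm)
  · rw [map_sub, sub_eq_zero]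
    exact congrArg (fun k : logT pS (Δ : Set S) ⟶ _ => k.app V θ) (Eq.trans hs' hs.symm)
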